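/- Let $p_1\le p_2\le p_3<1$ be real numbers with $\sum_i p_i=\sum_i p_i^2=1$, and let $g=-dt\otimes dt+\sum_i t^{2p_i}dx^i\otimes dx^i$ be the corresponding (vacuum, non-flat) Kasner metric on $(0,\infty)\times\mathbb T^3$, $\mathbb T^3=(\mathbb R/2\pi\mathbb Z)^3$. Put $\tau=-\ln t$, $\langle\tau\rangle=(1+\tau^2)^{1/2}$, and for functions $u$ on $\mathbb T^3$ with Fourier coefficients $\hat u(n)$ put $\|u\|_{(s)}=\big(\sum_{n\in\mathbb Z^3}(1+|n|^2)^{s}|\hat u(n)|^2\big)^{1/2}$ (summing over components for vector-valued $u$). Write $u=O(f(\tau))$ if for every $s\in\mathbb R$ there is a constant $C_s$ with $\|u(\tau)\|_{(s)}\le C_s|f(\tau)|$ for all $\tau\ge0$. Here $\square_g\omega=\mathrm{tr}_g(\nabla^2\omega)$ for a one-form $\omega$. *Asymptotic data.* Let $\omega=\omega_\tau d\tau+\omega_jdx^j$ be a smooth real one-form with $\square_g\omega=0$. Let $e_0=1$, $e_i=p_i$, $\widehat\omega_0=\omega_\tau$, $\widehat\omega_j=e^{-(1-p_j)\tau}\omega_j$,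 $$A_\mu=\begin{pmatrix}0&1\\ e_\mu^2-1&-2\end{pmatrix},\qquad \lambda_{\mu,\pm}=-1\pm e_\mu,\qquad v_{\mu,\pm}=(1,\lambda_{\mu,\pm}),$$ so that $v_{\mu,\pm}$ are eigenvectors of $A_\mu$, and let $$D_0w=\sum_i\big(e^{-2(1-p_i)\tau}\partial_i^2w_0+2p_ie^{-(1-p_i)\tau}\partial_iw_i\big),\qquad D_jw=\sum_ie^{-2(1-p_i)\tau}\partial_i^2w_j+2p_je^{-(1-p_j)\tau}\partial_jw_0 .$$ Functions $u_{\mu,\pm}$ ($\mu=0,\dots,3$) are the asymptotic data of $\omega$ if there are functions $c_{n,\mu,\pm}\in C^\infty(\mathbb T^3)$, $n\ge1$, with $c_{n,\mu,\pm}=0$ whenever $\lambda_{\mu,\pm}\le-n(1-p_3)$, such that, with $F_0=0$ and $$F_{n,\mu}(\tau)=e^{A_\mu\tau}\sum_\pm c_{n,\mu,\pm}v_{\mu,\pm}+\int_0^\tau e^{A_\mu(\tau-r)}\begin{pmatrix}0\\ D_\mu(\pi F_{n-1}(r))\end{pmatrix}dr$$ ($D_\mu$ taken at time $r$, and $\pi$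 taking the first component of each $F_{n-1,\nu}$), for each $n\ge1$ there is an $N$ with $(\widehat\omega_\mu,\partial_\tau\widehat\omega_\mu)-F_{n,\mu}=O(\langle\tau\rangle^Ne^{-n(1-p_3)\tau})$ for all $\mu$, and $u_{\mu,\pm}=c_{m,\mu,\pm}$ for the positive integer $m$ with $\lambda_{\mu,\pm}\in(-m(1-p_3),-(m-1)(1-p_3)]$. **Theorem.** There are non-negative integers $q_{\mu n}$, non-decreasing in $n$, with $q_{\mu1}=0$; real numbers $a_{\mu k}$ ($k\ge1$), strictly increasing in $k$; non-negative integers $N=N_n$; and linear differential operators with constant coefficients on $\mathbb T^3$ (those described below), all depending only on the $p_i$, such that $$a_{01}=a_{21}=a_{31}=2(1-p_3),\qquad a_{11}=\min\{2p_1+2(1-p_3),0\},$$ $a_{\mu k}>0$ for $\mu=0,2,3$, $a_{1k}>2p_1$, and the following holds. Every smooth real solution $\omega=\omega_\tau d\tau+\omega_jdx^j$ of $\square_g\omega=0$ on $(0,\infty)\times\mathbb T^3$ has asymptotic data $u_{\mu,\pm}\in C^\infty(\mathbb T^3)$, and there are $u_1,u_2,u_3\in C^\infty(\mathbb T^3)$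 such that for every integer $n\ge1$ $$\begin{pmatrix}\omega_\tau\\\partial_\tau\omega_\tau\end{pmatrix}=u_{0,+}\begin{pmatrix}1\\0\end{pmatrix}+\sum_{k=1}^{q_{0n}}P_{0k}(\tau)e^{-a_{0k}\tau}+O(\langle\tau\rangle^Ne^{-n(1-p_3)\tau}),$$ $$\begin{pmatrix}\omega_1\\\partial_\tau\omega_1\end{pmatrix}=u_1e^{-2p_1\tau}\begin{pmatrix}1\\-2p_1\end{pmatrix}+\sum_{k=1}^{q_{1n}}P_{1k}(\tau)e^{-a_{1k}\tau}+O(\langle\tau\rangle^Ne^{[1-p_1-n(1-p_3)]\tau}),$$ $$\begin{pmatrix}\omega_i\\\partial_\tau\omega_i\end{pmatrix}=\begin{pmatrix}u_i+\partial_iu_{0,+}\tau\\\partial_iu_{0,+}\end{pmatrix}+\sum_{k=1}^{q_{in}}P_{ik}(\tau)e^{-a_{ik}\tau}+O(\langle\tau\rangle^Ne^{[1-p_i-n(1-p_3)]\tau}),\quad i=2,3.$$ Here the $P_{\mu k}$ do not depend on $n$ and are polynomials in $\tau$ with coefficients in $C^\infty(\mathbb T^3,\mathbb R^2)$, whose components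 are sums of constant coefficient linear differential operators (depending only on the $p_i$) applied to $u_1,u_2,u_3,u_{0,\pm},u_{1,+},u_{2,-},u_{3,-}$. Moreover $u_1-u_{1,-}$, $u_2-u_{2,+}$ and $u_3-u_{3,+}$ are sums of constant coefficient linear differential operators (depending only on the $p_i$) applied to those asymptotic data $u_{\nu,\pm}$ whose eigenvalue $\lambda_{\nu,\pm}$ is larger than $\lambda_{1,-}$, $\lambda_{2,+}$ and $\lambda_{3,+}$, respectively. -/

import Mathlib

open scoped BigOperators ENNReal

noncomputable section

namespace Kasner

/-! ### Coordinate calculus and the wave operator on one-forms -/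

/-- The partial derivative `∂_i f` at `x`. -/
def pd {m : ℕ} (i : Fin m) (f : (Fin m → ℝ) → ℝ) (x : Fin m → ℝ) : ℝ :=
  fderiv ℝ f x (Pi.single i 1)

/-- Christoffel symbols `Γ^k_{ij}` of a metric given by its coordinate matrix. -/
def christoffel {m : ℕ} (g : (Fin m → ℝ) → Matrix (Fin m) (Fin m) ℝ) (k i j : Fin m)
    (x : Fin m → ℝ) : ℝ :=
  (1 / 2) * ∑ l, (g x)⁻¹ k l *
    (pd i (fun y => g y j l) x + pd j (fun y => g y i l) x - pd l (fun y => g y i j) x)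

/-- `∇_i ω_j`, that is `(∇_{∂_i} ω)(∂_j)`. -/
def covDeriv {m : ℕ} (g : (Fin m → ℝ) → Matrix (Fin m) (Fin m) ℝ)
    (ω : (Fin m → ℝ) → Fin m → ℝ) (i j : Fin m) (x : Fin m → ℝ) : ℝ :=
  pd i (fun y => ω y j) x - ∑ k, christoffel g k i j x * ω x k

/-- The components `∇_i ∇_j ω_k` of the second covariant derivative `∇²ω`. -/
def covDeriv₂ {m : ℕ} (g : (Fin m → ℝ) → Matrix (Fin m) (Fin m) ℝ)
    (ω : (Fin m → ℝ) → Fin m → ℝ) (i j k : Fin m) (x : Fin m → ℝ) : ℝ :=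
  pd i (covDeriv g ω j k) x
    - ∑ l, christoffel g l i j x * covDeriv g ω l k x
    - ∑ l, christoffel g l i k x * covDeriv g ω j l x

/-- The `k`-th component of `□_g ω = tr_g ∇²ω`. -/
def boxOneForm {m : ℕ} (g : (Fin m → ℝ) → Matrix (Fin m) (Fin m) ℝ)
    (ω : (Fin m → ℝ) → Fin m → ℝ) (k : Fin m) (x : Fin m → ℝ) : ℝ :=
  ∑ i, ∑ j, (g x)⁻¹ i j * covDeriv₂ g ω i j k x

/-! ### Kasner spacetimes -/

/-- The Kasner metric `-dt² + ∑ t^{2 p_i} (dx^i)²`; the coordinates are `x 0 = t` and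
`x 1, x 2, x 3`. -/
def metric (p : Fin 3 → ℝ) (x : Fin 4 → ℝ) : Matrix (Fin 4) (Fin 4) ℝ :=
  Matrix.diagonal (Fin.cons (-1) fun i => x 0 ^ (2 * p i))

/-- Smooth functions on `𝕋³ = (ℝ/2πℤ)³`, as smooth functions on `ℝ³` that are `2π`-periodic
in each variable. -/
def SmoothTorus (f : (Fin 3 → ℝ) → ℝ) : Prop :=
  ContDiff ℝ ((⊤ : ℕ∞) : WithTop ℕ∞) f ∧ ∀ (i : Fin 3) x, f (x + Pi.single i (2 * Real.pi)) = f x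

/-- `ω = ω_t dt + ω_j dx^j` is a smooth one-form on `(0, ∞) × 𝕋³` with `□_g ω = 0`, where `g` is
the Kasner metric. The values of `ω` at points with `x 0 ≤ 0` are irrelevant. -/
structure IsWaveSolution (p : Fin 3 → ℝ) (ω : (Fin 4 → ℝ) → Fin 4 → ℝ) : Prop where
  smooth : ContDiffOn ℝ ((⊤ : ℕ∞) : WithTop ℕ∞) ω {x | 0 < x 0}
  periodic : ∀ (i : Fin 3) x, 0 < x 0 → ω (x + Pi.single i.succ (2 * Real.pi)) = ω x
  wave : ∀ k x, 0 < x 0 → boxOneForm (metric p) ω k x = 0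

/-- The components of `ω = ω_τ dτ + ω_j dx^j` in the coordinates `(τ, x)` with `τ = -ln t`, as
functions of `τ` and `x`; since `dt = -e^{-τ} dτ`, one has `ω_τ = -e^{-τ} ω_t`. -/
def tauComp (ω : (Fin 4 → ℝ) → Fin 4 → ℝ) (μ : Fin 4) (τ : ℝ) (x : Fin 3 → ℝ) : ℝ :=
  (Fin.cons (-Real.exp (-τ) * ω (Fin.cons (Real.exp (-τ)) x) 0)
    (fun j : Fin 3 => ω (Fin.cons (Real.exp (-τ)) x) j.succ) : Fin 4 → ℝ) μ

/-- The pair `(w, ∂_τ w)`. -/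
def withDeriv (w : ℝ → (Fin 3 → ℝ) → ℝ) (τ : ℝ) (x : Fin 3 → ℝ) : Fin 2 → ℝ :=
  ![w τ x, deriv (fun r => w r x) τ]

/-! ### Sobolev norms on the torus -/

/-- `⟨u, φ_n⟩` with `φ_n(x) = (2π)^{-3/2} e^{i n·x}`. -/
def torusCoeff (u : (Fin 3 → ℝ) → ℝ) (n : Fin 3 → ℤ) : ℂ :=
  ∫ x in Set.Icc (0 : Fin 3 → ℝ) (fun _ => 2 * Real.pi),
    (u x : ℂ) * (((2 * Real.pi) ^ (-(3 / 2) : ℝ) : ℝ) *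
      Complex.exp (-Complex.I * ((∑ i, (n i : ℝ) * x i : ℝ) : ℂ)))

/-- The Sobolev norm `‖u‖_{(s)}` of an `ℝ^m`-valued function on the torus,
`(∑_n ⟨n⟩^{2s} |û(n)|²)^{1/2}` with `⟨n⟩ = (1 + |n|²)^{1/2}`. -/
def sobolevNorm {m : ℕ} (s : ℝ) (u : (Fin 3 → ℝ) → Fin m → ℝ) : ℝ≥0∞ :=
  (∑' n : Fin 3 → ℤ, ENNReal.ofReal ((1 + ∑ i, (n i : ℝ) ^ 2) ^ s *
    ∑ c, ‖torusCoeff (fun x => u x c) n‖ ^ 2)) ^ (1 / 2 : ℝ)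

/-- `R = O(f(τ))`: for every `s` there is `C` with `‖R(τ)‖_{(s)} ≤ C |f(τ)|` for all `τ ≥ 0`. -/
def SobolevO {m : ℕ} (R : ℝ → (Fin 3 → ℝ) → Fin m → ℝ) (f : ℝ → ℝ) : Prop :=
  ∀ s : ℝ, ∃ C : ℝ, ∀ τ, 0 ≤ τ → sobolevNorm s (R τ) ≤ ENNReal.ofReal (C * |f τ|)

/-- `⟨τ⟩ = (1 + τ²)^{1/2}`. -/
def bracket (τ : ℝ) : ℝ := Real.sqrt (1 + τ ^ 2)

/-! ### Asymptotic data

The rescaled components `ω̂_0 = ω_τ`, `ω̂_j = e^{-(1 - p_j) τ} ω_j` satisfy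
`∂_τ² ω̂_μ + 2 ∂_τ ω̂_μ + (1 - e_μ²) ω̂_μ = D_μ ω̂` with `e_0 = 1`, `e_j = p_j`. -/

/-- `e_0 = 1` and `e_j = p_j`. -/
def wt (p : Fin 3 → ℝ) : Fin 4 → ℝ := Fin.cons 1 p

/-- The rescaled components `ω̂_μ`. -/
def hatComp (p : Fin 3 → ℝ) (ω : (Fin 4 → ℝ) → Fin 4 → ℝ) (μ : Fin 4) (τ : ℝ)
    (x : Fin 3 → ℝ) : ℝ :=
  Real.exp (-(1 - wt p μ) * τ) * tauComp ω μ τ x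

/-- The block `A_μ` of the coefficient matrix of the first order model system. -/
def blockA (p : Fin 3 → ℝ) (μ : Fin 4) : Matrix (Fin 2) (Fin 2) ℝ :=
  !![0, 1; wt p μ ^ 2 - 1, -2]

/-- The index set of the eigenvectors `v_{μ,±}`: `(μ, true)` is `(μ, +)` and `(μ, false)`
is `(μ, -)`. -/
abbrev DataIndex : Type := Fin 4 × Bool

/-- The eigenvalues `-1 ± e_μ` of `A_μ`, that is `0, -2` for `μ = 0` and `-1 ± p_i`
for `μ = i`. -/
def eig (p : Fin 3 → ℝ) (κ : DataIndex) : ℝ :=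
  if κ.2 then -1 + wt p κ.1 else -1 - wt p κ.1

/-- The eigenvector `(1, λ)` of `A_μ` for the eigenvalue `λ`. -/
def eigVec (p : Fin 3 → ℝ) (κ : DataIndex) : Fin 2 → ℝ := ![1, eig p κ]

/-- The spatial derivative terms `D_μ u` of the system for `ω̂`, at time `τ`. -/
def spatialOp (p : Fin 3 → ℝ) (τ : ℝ) (u : Fin 4 → (Fin 3 → ℝ) → ℝ) (μ : Fin 4)
    (x : Fin 3 → ℝ) : ℝ :=
  (∑ i, Real.exp (-2 * (1 - p i) * τ) * pd i (pd i (u μ)) x) +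
    (Fin.cons (∑ i : Fin 3, 2 * p i * Real.exp (-(1 - p i) * τ) * pd i (u i.succ) x)
      (fun j : Fin 3 => 2 * p j * Real.exp (-(1 - p j) * τ) * pd j (u 0) x) : Fin 4 → ℝ) μ

/-- The approximations `F_{∞,n}`, with `F_{∞,0} = 0` and
`F_{∞,n}(τ) = e^{A τ} V_n + ∫_0^τ e^{A (τ - r)} (0, D π F_{∞,n-1}(r)) dr`,
where `V_n = ∑_{μ,±} c_{n,μ,±} v_{μ,±}` and `π` is the projection onto the first components. -/
def approx (p : Fin 3 → ℝ) (c : ℕ → DataIndex → (Fin 3 → ℝ) → ℝ) :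
    ℕ → Fin 4 → ℝ → (Fin 3 → ℝ) → Fin 2 → ℝ
  | 0 => fun _ _ _ => 0
  | n + 1 => fun μ τ x =>
      (NormedSpace.exp (τ • blockA p μ)).mulVec (∑ σ : Bool, c (n + 1) (μ, σ) x • eigVec p (μ, σ))
      + ∫ r in (0 : ℝ)..τ, (NormedSpace.exp ((τ - r) • blockA p μ)).mulVec
          ![0, spatialOp p r (fun ν y => approx p c n ν r y 0) μ x]

/-- The unique positive integer `n` with `λ ∈ (-n (1 - p_3), -(n - 1) (1 - p_3)]`, for the
eigenvalue `λ ≤ 0` with index `κ`. -/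
def level (p : Fin 3 → ℝ) (κ : DataIndex) : ℕ := ⌊-eig p κ / (1 - p 2)⌋₊ + 1

/-- `u_{μ,±}` are the components, with respect to the eigenvectors `v_{μ,±}`, of the asymptotic
data of `ω̂`. Here `V_n = ∑ c_{n,κ} v_κ` is smooth, has values in the sum of the eigenspaces
with eigenvalue in `(-n (1 - p_3), 0]`, and `(ω̂, ∂_τ ω̂) - F_{∞,n}` is of order
`⟨τ⟩^N e^{-n (1 - p_3) τ}`; the asymptotic data collects from each `V_n` the components which
belong to eigenvalues in `(-n (1 - p_3), -(n - 1) (1 - p_3)]`. -/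
def IsAsymptoticData (p : Fin 3 → ℝ) (ω : (Fin 4 → ℝ) → Fin 4 → ℝ)
    (u : DataIndex → (Fin 3 → ℝ) → ℝ) : Prop :=
  ∃ c : ℕ → DataIndex → (Fin 3 → ℝ) → ℝ,
    (∀ n κ, SmoothTorus (c n κ)) ∧
    (∀ (n : ℕ) κ, 1 ≤ n → eig p κ ≤ -(n : ℝ) * (1 - p 2) → c n κ = 0) ∧
    (∀ n : ℕ, 1 ≤ n → ∃ N : ℕ, ∀ μ,
      SobolevO (fun τ x => withDeriv (hatComp p ω μ) τ x - approx p c n μ τ x)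
        (fun τ => bracket τ ^ N * Real.exp (-(n : ℝ) * (1 - p 2) * τ))) ∧
    ∀ κ, u κ = c (level p κ) κ

/-! ### Linear dependence on functions and their derivatives -/

/-- `∂_1^{α_1} ∂_2^{α_2} ∂_3^{α_3} f`. -/
def iterPd (α : Fin 3 →₀ ℕ) (f : (Fin 3 → ℝ) → ℝ) : (Fin 3 → ℝ) → ℝ :=
  (pd 0)^[α 0] ((pd 1)^[α 1] ((pd 2)^[α 2] f))

/-- The linear differential operator with constant coefficients `∑_α L_α ∂^α`, applied to `f`. -/
def diffOp (L : MvPolynomial (Fin 3) ℝ) (f : (Fin 3 → ℝ) → ℝ) (x : Fin 3 → ℝ) : ℝ :=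
  ∑ α ∈ L.support, L.coeff α * iterPd α f x

/-- The polynomial in `τ` whose coefficient of `τ^d` is the function `∑_κ (L κ)_d (f κ)`,
each `(L κ)_d` being a linear differential operator with constant coefficients. -/
def opPoly (L : DataIndex → Polynomial (MvPolynomial (Fin 3) ℝ))
    (f : DataIndex → (Fin 3 → ℝ) → ℝ) (τ : ℝ) (x : Fin 3 → ℝ) : ℝ :=
  ∑ κ, ∑ d ∈ (L κ).support, τ ^ d * diffOp ((L κ).coeff d) (f κ) x

/-- The index of the component of the asymptotic data which is replaced by `u_i`, namely
`u_{1,-}` for `i = 1` and `u_{i,+}` for `i = 2, 3`. (The number `i` is `0, 1, 2` here.) -/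
def leadIndex (i : Fin 3) : DataIndex := (i.succ, if i = 0 then false else true)

/-- The family consisting of `u_1, u_2, u_3` (given by `v`) and of
`u_{0,+}, u_{0,-}, u_{1,+}, u_{2,-}, u_{3,-}`. -/
def replaceData (u : DataIndex → (Fin 3 → ℝ) → ℝ) (v : Fin 3 → (Fin 3 → ℝ) → ℝ)
    (κ : DataIndex) : (Fin 3 → ℝ) → ℝ :=
  if κ = leadIndex 0 then v 0 else if κ = leadIndex 1 then v 1
  else if κ = leadIndex 2 then v 2 else u κ

/-- The correction `∑_{k=1}^{q} P_k(τ) e^{-a_k τ}`, where the two components of `P_k` are the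
polynomials given by `L k 0` and `L k 1`. -/
def correction (q : ℕ) (a : ℕ → ℝ)
    (L : ℕ → Fin 2 → DataIndex → Polynomial (MvPolynomial (Fin 3) ℝ))
    (f : DataIndex → (Fin 3 → ℝ) → ℝ) (τ : ℝ) (x : Fin 3 → ℝ) : Fin 2 → ℝ :=
  ∑ k ∈ Finset.Icc 1 q, Real.exp (-a k * τ) • fun c => opPoly (L k c) f τ x

end Kasner

end

noncomputable section
namespace Kasner

/-! The rescaled components solve ∂²ω̂_μ + 2∂ω̂_μ + (1 - e_μ²)ω̂_μ = D_μ ω̂ in τ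
(`IsWaveSolution.hat_equation`). The left side has constant coefficients and factors as (∂ -
λ_{μ,+})(∂ - λ_{μ,-}), while every coefficient of D decays at least like e^{-(1-p_3)τ}. So D is a
perturbation, and each time it is treated as a source the rate 1 - p_3 is gained.

Formal side. On finite sums of terms τ^d e^{-bτ} L, with L a constant coefficient operator on the
torus, the left side has a right inverse `solve`. Iterating from the homogeneous solution e^{λ_κ τ}
gives `series`; its coefficients stabilise (`series_sub_mem`) and its exponents lie in an explicit
discrete set (`series_mem_expSet`).

Analytic side. An energy estimate bounds the Fourier coefficients exponentially in τ, uniformly in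
the frequency (`ModeSolution.rapidO`). If the solution minus the series with coefficients d_κ decays
with some rate, then D of this difference decays with a better one, and the asymptotics of scalar
equations (`RapidO.asymptotics`) improve the rate after a correction of d (`ModeSolution.improve`).
All eigenvalues are at least -2, so d is final once the rate exceeds 2. This produces eight smooth
real functions f_κ, the data at infinity, whose series describe the solution to every order
(`IsWaveSolution.exists_data`).

Comparison with the asymptotic data. The functions F_n are formal sums of the same kind
(`approx_eq`), with different homogeneous parts because their integrals start at τ = 0. Matching the
two shows that u_κ is f_κ plus operators applied to those f with larger eigenvalue
(`dataMatrix_eq`), a unipotent triangular system which can be inverted (`IsUnitri.exists_inverse`).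
The functions u_1, u_2, u_3 are the data at infinity with indices (1,-), (2,+), (3,+); the inverse
system gives their relation to the asymptotic data, and rewriting all f_κ through the modified
family gives the expansions (`exists_expansion`). The leading terms belong to the smallest
exponents. The term τ ∂_i u_{0,+} is a resonance between λ_{i,+} and the derivative of ω_τ in D_i
(`series_succ_lead`). -/

/-- Linear differential operators with constant coefficients on the torus. -/
abbrev Op : Type := MvPolynomial (Fin 3) ℝ

/-- Formal finite sums of terms `τ^d e^{-bτ} L` with `L` a differential operator. -/
abbrev ExpPoly : Type := (ℝ × ℕ) →₀ Op

/-! ### Formal exponential polynomials with operator coefficients -/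

namespace ExpPoly

/-- The term `τ^d e^{-bτ}`. -/
def mono (b : ℝ) (d : ℕ) : ExpPoly := Finsupp.single (b, d) 1

lemma single_eq (x : ℝ × ℕ) (r : Op) : (Finsupp.single x r : ExpPoly) = r • mono x.1 x.2 := by
  simp [mono]

lemma induction_mono {P : ExpPoly → Prop} (Z : ExpPoly) (h0 : P 0)
    (hadd : ∀ Y Z, P Y → P Z → P (Y + Z)) (hmono : ∀ (r : Op) b d, P (r • mono b d)) : P Z := by
  refine Finsupp.induction_linear Z h0 hadd fun x r => ?_
  rw [single_eq]; exact hmono r x.1 x.2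

lemma linearMap_ext_mono {M : Type*} [AddCommMonoid M] [Module Op M] {f g : ExpPoly →ₗ[Op] M}
    (h : ∀ b d, f (mono b d) = g (mono b d)) : f = g := by
  refine LinearMap.ext fun Z => ?_
  induction Z using induction_mono with
  | h0 => simp
  | hadd Y Z hY hZ => simp only [map_add, hY, hZ]
  | hmono r b d => simp only [map_smul, h]

/-- The linear map with given values on the terms `τ^d e^{-bτ}`. -/
def ofMono {M : Type*} [AddCommMonoid M] [Module Op M] (f : ℝ → ℕ → M) : ExpPoly →ₗ[Op] M :=
  Finsupp.linearCombination Op fun x : ℝ × ℕ => f x.1 x.2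

@[simp] lemma ofMono_mono {M : Type*} [AddCommMonoid M] [Module Op M] (f : ℝ → ℕ → M) (b : ℝ)
    (d : ℕ) : ofMono f (mono b d) = f b d := by
  simp [ofMono, mono]

/-- Exponential polynomials with exponents `-b`, `b ∈ S`. -/
def expIn (S : Set ℝ) : Submodule Op ExpPoly := Finsupp.supported Op Op {x | x.1 ∈ S}

lemma mono_mem_expIn {S : Set ℝ} {b : ℝ} (hb : b ∈ S) (d : ℕ) : mono b d ∈ expIn S :=
  Finsupp.single_mem_supported Op (1 : Op) (by exact hb)

lemma mem_expIn {S : Set ℝ} {Z : ExpPoly} : Z ∈ expIn S ↔ ∀ b d, Z (b, d) ≠ 0 → b ∈ S := by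
  rw [expIn, Finsupp.mem_supported]
  constructor
  · intro h b d hz
    exact h (by simpa using hz)
  · rintro h ⟨b, d⟩ hx
    exact h b d (by simpa using hx)

lemma expIn_mono {S T : Set ℝ} (h : S ⊆ T) : expIn S ≤ expIn T :=
  Finsupp.supported_mono fun _ hx => h hx

lemma ofMono_mem {N : Submodule Op ExpPoly} {f : ℝ → ℕ → ExpPoly} {S : Set ℝ}
    (h : ∀ b ∈ S, ∀ d, f b d ∈ N) {Z : ExpPoly} (hZ : Z ∈ expIn S) : ofMono f Z ∈ N := by
  rw [ofMono, Finsupp.linearCombination_apply, Finsupp.sum]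
  refine N.sum_mem fun x hx => N.smul_mem _ (h _ ?_ _)
  exact mem_expIn.1 hZ x.1 x.2 (by simpa using hx)

/-- The derivative in `τ`. -/
def dτ : ExpPoly →ₗ[Op] ExpPoly := ofMono fun b d => (-b) • mono b d + (d : ℝ) • mono b (d - 1)

/-- Multiplication with `e^{-cτ}`. -/
def shift (c : ℝ) : ExpPoly →ₗ[Op] ExpPoly := ofMono fun b d => mono (b + c) d

@[simp] lemma dτ_mono (b : ℝ) (d : ℕ) :
    dτ (mono b d) = (-b) • mono b d + (d : ℝ) • mono b (d - 1) := by simp [dτ]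

@[simp] lemma shift_mono (c b : ℝ) (d : ℕ) : shift c (mono b d) = mono (b + c) d := by simp [shift]

lemma dτ_mem {S : Set ℝ} {Z : ExpPoly} (hZ : Z ∈ expIn S) : dτ Z ∈ expIn S :=
  ofMono_mem (fun _ hb _ => add_mem
    (Submodule.smul_of_tower_mem _ _ (mono_mem_expIn hb _))
    (Submodule.smul_of_tower_mem _ _ (mono_mem_expIn hb _))) hZ

lemma shift_mem {S T : Set ℝ} {c : ℝ} (h : ∀ b ∈ S, b + c ∈ T) {Z : ExpPoly} (hZ : Z ∈ expIn S) :
    shift c Z ∈ expIn T :=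
  ofMono_mem (fun _ hb _ => mono_mem_expIn (h _ hb) _) hZ

/-- The antiderivative for `∂ - λ` of `τ^d e^{-bτ}`. -/
def primMono (lam b : ℝ) : ℕ → ExpPoly
  | 0 => if b + lam = 0 then mono b 1 else (-(b + lam)⁻¹) • mono b 0
  | d + 1 => if b + lam = 0 then ((d : ℝ) + 2)⁻¹ • mono b (d + 2)
      else (-(b + lam)⁻¹) • (mono b (d + 1) - ((d : ℝ) + 1) • primMono lam b d)

/-- A right inverse of `∂ - λ`. -/
def prim (lam : ℝ) : ExpPoly →ₗ[Op] ExpPoly := ofMono (primMono lam)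

lemma primMono_mem (lam : ℝ) {S : Set ℝ} {b : ℝ} (hb : b ∈ S) (d : ℕ) :
    primMono lam b d ∈ expIn S := by
  induction d with
  | zero =>
    rw [primMono]; split_ifs
    · exact mono_mem_expIn hb _
    · exact Submodule.smul_of_tower_mem _ _ (mono_mem_expIn hb _)
  | succ d ih =>
    rw [primMono]; split_ifs
    · exact Submodule.smul_of_tower_mem _ _ (mono_mem_expIn hb _)
    · exact Submodule.smul_of_tower_mem _ _ (sub_mem (mono_mem_expIn hb _)
        (Submodule.smul_of_tower_mem _ _ ih))

lemma prim_mem (lam : ℝ) {S : Set ℝ} {Z : ExpPoly} (hZ : Z ∈ expIn S) : prim lam Z ∈ expIn S :=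
  ofMono_mem (fun _ hb _ => primMono_mem lam hb _) hZ

/-- The operator `∂ - λ`. -/
def dSub (lam : ℝ) : ExpPoly →ₗ[Op] ExpPoly := dτ - lam • LinearMap.id

lemma dSub_apply (lam : ℝ) (Z : ExpPoly) : dSub lam Z = dτ Z - lam • Z := rfl

/-- If b = -λ, then ∂ - λ only differentiates the power of τ, so the degree goes up by one.
Otherwise (∂ - λ)(τ^{d+1} e^{-bτ}) = -(b + λ) τ^{d+1} e^{-bτ} + (d + 1) τ^d e^{-bτ}, which is the
recursion in the degree. -/
lemma dSub_primMono (lam b : ℝ) (d : ℕ) : dSub lam (primMono lam b d) = mono b d := by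
  induction d with
  | zero =>
    rw [primMono]; split_ifs with h
    · have : lam = -b := by linarith
      simp [dSub_apply, this]
    · rw [LinearMap.map_smul_of_tower, dSub_apply]
      simp only [dτ_mono, Nat.cast_zero, zero_smul, add_zero]
      rw [← sub_smul, smul_smul]
      convert one_smul ℝ (mono b 0) using 2
      field_simp; ring
  | succ d ih =>
    rw [primMono]; split_ifs with h
    · have : lam = -b := by linarith
      rw [LinearMap.map_smul_of_tower, dSub_apply, this]
      have h2 : ((d : ℝ) + 2) ≠ 0 := by positivity
      simp only [dτ_mono, Nat.cast_add, Nat.cast_ofNat, add_sub_cancel_left, smul_smul]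
      rw [show d + 2 - 1 = d + 1 by omega, inv_mul_cancel₀ h2, one_smul]
    · rw [LinearMap.map_smul_of_tower, map_sub, LinearMap.map_smul_of_tower, ih, dSub_apply,
        dτ_mono]
      simp only [Nat.cast_add, Nat.cast_one, Nat.add_sub_cancel]
      have : (-b) • mono b (d + 1) + ((d : ℝ) + 1) • mono b d - lam • mono b (d + 1)
          - ((d : ℝ) + 1) • mono b d = (-(b + lam)) • mono b (d + 1) := by module
      rw [this, smul_smul]
      convert one_smul ℝ (mono b (d + 1)) using 2
      field_simp

lemma dSub_prim (lam : ℝ) (Z : ExpPoly) : dSub lam (prim lam Z) = Z := by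
  have : (dSub lam).comp (prim lam) = LinearMap.id :=
    linearMap_ext_mono fun b d => by simp [prim, dSub_primMono]
  exact LinearMap.congr_fun this Z

lemma dSub_comm (l m : ℝ) (Z : ExpPoly) : dSub l (dSub m Z) = dSub m (dSub l Z) := by
  simp only [dSub_apply, map_sub, LinearMap.map_smul_of_tower, smul_sub, smul_smul, mul_comm l m]
  abel

/-- The resonant case, from which the factor τ in the leading terms of ω_2 and ω_3 arises. -/
lemma prim_resonant_const (lam : ℝ) : prim lam (mono (-lam) 0) = mono (-lam) 1 := by
  simp [prim, primMono]

lemma prim_const {lam b : ℝ} (h : b + lam ≠ 0) :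
    prim lam (mono b 0) = (-(b + lam)⁻¹) • mono b 0 := by
  simp [prim, primMono, h]

/-! ### Evaluation -/

variable {E : Type*} [NormedAddCommGroup E] [NormedSpace ℝ E]

/-- The value at `τ`, when the operators are evaluated by `θ`. -/
def ev (θ : Op →ₗ[ℝ] E) (τ : ℝ) : ExpPoly →ₗ[ℝ] E :=
  Finsupp.lsum ℝ fun x => (Real.exp (-x.1 * τ) * τ ^ x.2) • θ

lemma ev_smul_mono (θ : Op →ₗ[ℝ] E) (τ : ℝ) (r : Op) (b : ℝ) (d : ℕ) :
    ev θ τ (r • mono b d) = (Real.exp (-b * τ) * τ ^ d) • θ r := by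
  simp [ev, mono]

lemma ev_eq_sum (θ : Op →ₗ[ℝ] E) (τ : ℝ) (Z : ExpPoly) :
    ev θ τ Z = ∑ x ∈ Z.support, (Real.exp (-x.1 * τ) * τ ^ x.2) • θ (Z x) := by
  simp [ev, Finsupp.sum]

lemma ev_shift (θ : Op →ₗ[ℝ] E) (τ c : ℝ) (Z : ExpPoly) :
    ev θ τ (shift c Z) = Real.exp (-c * τ) • ev θ τ Z := by
  induction Z using induction_mono with
  | h0 => simp
  | hadd Y Z hY hZ => simp only [smul_add, map_add, hY, hZ]
  | hmono s b d =>
    rw [map_smul, shift_mono, ev_smul_mono, ev_smul_mono, smul_smul]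
    congr 1
    rw [show -(b + c) * τ = -c * τ + -b * τ by ring, Real.exp_add]; ring

lemma hasDerivAt_ev (θ : Op →ₗ[ℝ] E) (τ : ℝ) (Z : ExpPoly) :
    HasDerivAt (fun s => ev θ s Z) (ev θ τ (dτ Z)) τ := by
  induction Z using induction_mono with
  | h0 => simpa using hasDerivAt_const τ (0 : E)
  | hadd Y Z hY hZ => simp only [map_add]; exact hY.add hZ
  | hmono r b d =>
    rw [map_smul, dτ_mono, smul_add]
    rw [smul_comm r (-b), smul_comm r (d : ℝ), map_add, (ev θ τ).map_smul, (ev θ τ).map_smul,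
      ev_smul_mono, ev_smul_mono]
    have h1 : HasDerivAt (fun s => Real.exp (-b * s) * s ^ d)
        (Real.exp (-b * τ) * (-b) * τ ^ d + Real.exp (-b * τ) * (d * τ ^ (d - 1))) τ := by
      refine (((hasDerivAt_id τ).const_mul (-b)).exp.mul (hasDerivAt_pow d τ)).congr_deriv ?_
      simp
    have h2 := h1.smul_const (θ r)
    simp only [ev_smul_mono]
    convert h2 using 1
    rw [add_smul, smul_smul, smul_smul]
    congr 2 <;> ring

/-- The value at `τ = 0`. -/
def atZero : ExpPoly →ₗ[Op] Op := ofMono fun _ d => if d = 0 then 1 else 0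

lemma ev_zero (θ : Op →ₗ[ℝ] E) (Z : ExpPoly) : ev θ 0 Z = θ (atZero Z) := by
  induction Z using induction_mono with
  | h0 => simp
  | hadd Y Z hY hZ => simp only [map_add, hY, hZ]
  | hmono r b d =>
    rw [ev_smul_mono, map_smul]
    by_cases hd : d = 0 <;> simp [atZero, hd]

/-! ### Grouping by exponents -/

/-- The polynomial in `τ` which is the factor of `e^{-bτ}`. -/
def polyAt (Z : ExpPoly) (b : ℝ) : Polynomial Op :=
  Z.sum fun x r => if x.1 = b then Polynomial.monomial x.2 r else 0

lemma coeff_polyAt (Z : ExpPoly) (b : ℝ) (d : ℕ) : (polyAt Z b).coeff d = Z (b, d) := by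
  rw [polyAt, Finsupp.sum, Polynomial.finsetSum_coeff, Finset.sum_eq_single (b, d)]
  · simp
  · rintro ⟨b', d'⟩ _ hne
    by_cases hb : b' = b
    · have : d' ≠ d := fun h => hne (by rw [hb, h])
      simp [hb, Polynomial.coeff_monomial, this]
    · simp [hb]
  · intro h
    have : Z (b, d) = 0 := by simpa using h
    simp [this]

/-- This turns the formal terms with one fixed exponent into a product P(τ) e^{-bτ} of the shape
used in `correction`. -/
lemma ev_filter (θ : Op →ₗ[ℝ] E) (τ : ℝ) (Z : ExpPoly) (b : ℝ) :
    ev θ τ (Z.filter fun x => x.1 = b) =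
      Real.exp (-b * τ) • ∑ d ∈ (polyAt Z b).support, τ ^ d • θ ((polyAt Z b).coeff d) := by
  rw [ev_eq_sum, Finset.smul_sum]
  symm
  refine Finset.sum_bij (fun d _ => (b, d)) ?_ ?_ ?_ ?_
  · intro d hd
    simpa [coeff_polyAt] using hd
  · intro d _ d' _ h
    exact (Prod.mk.inj h).2
  · rintro ⟨b', d⟩ h
    obtain ⟨h1, h2⟩ : ¬ Z (b', d) = 0 ∧ b' = b := by simpa using h
    subst h2
    exact ⟨d, by simpa [coeff_polyAt] using h1, rfl⟩
  · intro d _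
    rw [coeff_polyAt, Finsupp.filter_apply_pos (fun x : ℝ × ℕ => x.1 = b) _ rfl, smul_smul]

end ExpPoly
open MeasureTheory

/-! ### Smooth functions on the torus -/

lemma SmoothTorus.differentiable {f : (Fin 3 → ℝ) → ℝ} (hf : SmoothTorus f) :
    Differentiable ℝ f := hf.1.differentiable (by simp)

lemma SmoothTorus.continuous {f : (Fin 3 → ℝ) → ℝ} (hf : SmoothTorus f) : Continuous f :=
  hf.1.continuous

lemma SmoothTorus.pd {f : (Fin 3 → ℝ) → ℝ} (hf : SmoothTorus f) (i : Fin 3) :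
    SmoothTorus (pd i f) := by
  refine ⟨(hf.1.fderiv_right (by simp)).clm_apply contDiff_const, fun j x => ?_⟩
  have h : (fun y => f (y + Pi.single j (2 * Real.pi))) = f := funext fun y => hf.2 j y
  unfold Kasner.pd
  rw [← fderiv_comp_add_right, h]

lemma smoothTorus_zero : SmoothTorus (fun _ => 0) := ⟨contDiff_const, fun _ _ => rfl⟩

lemma SmoothTorus.add {f g : (Fin 3 → ℝ) → ℝ} (hf : SmoothTorus f) (hg : SmoothTorus g) :
    SmoothTorus (fun x => f x + g x) :=
  ⟨hf.1.add hg.1, fun i x => by simp only [hf.2 i x, hg.2 i x]⟩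

lemma SmoothTorus.const_mul {f : (Fin 3 → ℝ) → ℝ} (hf : SmoothTorus f) (c : ℝ) :
    SmoothTorus (fun x => c * f x) :=
  ⟨contDiff_const.mul hf.1, fun i x => by simp only [hf.2 i x]⟩

lemma smoothTorus_sum {ι : Type*} (s : Finset ι) {f : ι → (Fin 3 → ℝ) → ℝ}
    (hf : ∀ i ∈ s, SmoothTorus (f i)) : SmoothTorus (fun x => ∑ i ∈ s, f i x) :=
  ⟨ContDiff.sum fun i hi => (hf i hi).1, fun j x =>
    Finset.sum_congr rfl fun i hi => (hf i hi).2 j x⟩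

lemma pd_add {f g : (Fin 3 → ℝ) → ℝ} (hf : SmoothTorus f) (hg : SmoothTorus g) (i : Fin 3)
    (x : Fin 3 → ℝ) : pd i (fun x => f x + g x) x = pd i f x + pd i g x := by
  unfold pd
  rw [fderiv_fun_add (hf.differentiable x) (hg.differentiable x)]; rfl

lemma pd_const_mul {f : (Fin 3 → ℝ) → ℝ} (hf : SmoothTorus f) (c : ℝ) (i : Fin 3)
    (x : Fin 3 → ℝ) : pd i (fun x => c * f x) x = c * pd i f x := by
  unfold pd
  rw [fderiv_const_mul (hf.differentiable x)]; rfl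

lemma pd_sum {ι : Type*} (s : Finset ι) {f : ι → (Fin 3 → ℝ) → ℝ}
    (hf : ∀ j ∈ s, SmoothTorus (f j)) (i : Fin 3) (x : Fin 3 → ℝ) :
    pd i (fun x => ∑ j ∈ s, f j x) x = ∑ j ∈ s, pd i (f j) x := by
  unfold pd
  rw [fderiv_fun_sum fun j hj => (hf j hj).differentiable x]
  simp

lemma pd_comm {f : (Fin 3 → ℝ) → ℝ} (hf : SmoothTorus f) (i j : Fin 3) :
    pd i (pd j f) = pd j (pd i f) := by
  have hd : Differentiable ℝ (fderiv ℝ f) :=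
    (hf.1.fderiv_right (m := ((⊤ : ℕ∞) : WithTop ℕ∞)) (by simp)).differentiable (by simp)
  have key : ∀ a b x, pd a (pd b f) x = fderiv ℝ (fderiv ℝ f) x (Pi.single a 1) (Pi.single b 1) := by
    intro a b x
    unfold pd
    rw [fderiv_clm_apply (hd x) (by fun_prop)]
    simp
  funext x
  rw [key, key]
  exact (hf.1.contDiffAt (x := x)).isSymmSndFDerivAt
    (by rw [minSmoothness_of_isRCLikeNormedField]; exact (WithTop.coe_le_coe.2 le_top : ((2 : ℕ∞) : WithTop ℕ∞) ≤ _)) _ _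

lemma SmoothTorus.iterate_pd {f : (Fin 3 → ℝ) → ℝ} (hf : SmoothTorus f) (i : Fin 3) (n : ℕ) :
    SmoothTorus ((Kasner.pd i)^[n] f) := by
  induction n with
  | zero => exact hf
  | succ n ih => rw [Function.iterate_succ_apply']; exact ih.pd i

lemma SmoothTorus.iterPd {f : (Fin 3 → ℝ) → ℝ} (hf : SmoothTorus f) (α : Fin 3 →₀ ℕ) :
    SmoothTorus (iterPd α f) := ((hf.iterate_pd 2 _).iterate_pd 1 _).iterate_pd 0 _

lemma SmoothTorus.diffOp {f : (Fin 3 → ℝ) → ℝ} (hf : SmoothTorus f) (L : Op) :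
    SmoothTorus (diffOp L f) := smoothTorus_sum _ fun α _ => (hf.iterPd α).const_mul _

lemma pd_iterate_comm {f : (Fin 3 → ℝ) → ℝ} (hf : SmoothTorus f) (i j : Fin 3) (n : ℕ) :
    pd i ((pd j)^[n] f) = (pd j)^[n] (pd i f) := by
  induction n with
  | zero => rfl
  | succ n ih =>
    rw [Function.iterate_succ_apply', Function.iterate_succ_apply', ← ih,
      pd_comm (hf.iterate_pd j n)]

lemma pd_iterPd {f : (Fin 3 → ℝ) → ℝ} (hf : SmoothTorus f) (i : Fin 3) (α : Fin 3 →₀ ℕ) :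
    pd i (iterPd α f) = iterPd (α + Finsupp.single i 1) f := by
  unfold iterPd
  fin_cases i
  · simp [Function.iterate_succ_apply']
  · simp only [Fin.mk_one, Fin.isValue, Finsupp.add_apply]
    rw [pd_iterate_comm ((hf.iterate_pd 2 _).iterate_pd 1 _)]
    simp [Function.iterate_succ_apply']
  · simp only [Fin.reduceFinMk, Fin.isValue, Finsupp.add_apply]
    rw [pd_iterate_comm ((hf.iterate_pd 2 _).iterate_pd 1 _), pd_iterate_comm (hf.iterate_pd 2 _)]
    simp [Function.iterate_succ_apply']

/-! ### The action of differential operators -/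

lemma diffOp_eq_sum (L : Op) (f : (Fin 3 → ℝ) → ℝ) (x : Fin 3 → ℝ) {s : Finset (Fin 3 →₀ ℕ)}
    (hs : L.support ⊆ s) : diffOp L f x = ∑ α ∈ s, L.coeff α * iterPd α f x :=
  Finset.sum_subset hs fun α _ h => by
    rw [MvPolynomial.notMem_support_iff.1 h, zero_mul]

/-- The value at `x` of a differential operator applied to `f`, as a function of the operator. -/
def opAt (f : (Fin 3 → ℝ) → ℝ) (x : Fin 3 → ℝ) : Op →ₗ[ℝ] ℝ where
  toFun L := diffOp L f x
  map_add' L M := by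
    classical
    rw [diffOp_eq_sum (L + M) f x MvPolynomial.support_add,
      diffOp_eq_sum L f x Finset.subset_union_left,
      diffOp_eq_sum M f x Finset.subset_union_right, ← Finset.sum_add_distrib]
    exact Finset.sum_congr rfl fun α _ => by rw [MvPolynomial.coeff_add]; ring
  map_smul' c L := by
    rw [diffOp_eq_sum (c • L) f x MvPolynomial.support_smul]
    simp only [diffOp, MvPolynomial.coeff_smul, smul_eq_mul, Finset.mul_sum, RingHom.id_apply,
      mul_assoc]

lemma opAt_apply (f : (Fin 3 → ℝ) → ℝ) (x : Fin 3 → ℝ) (L : Op) : opAt f x L = diffOp L f x := rfl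

lemma diffOp_monomial (α : Fin 3 →₀ ℕ) (c : ℝ) (f : (Fin 3 → ℝ) → ℝ) (x : Fin 3 → ℝ) :
    diffOp (MvPolynomial.monomial α c) f x = c * iterPd α f x := by
  rw [diffOp_eq_sum _ f x MvPolynomial.support_monomial_subset]
  simp

lemma diffOp_one (f : (Fin 3 → ℝ) → ℝ) (x : Fin 3 → ℝ) : diffOp 1 f x = f x := by
  have := diffOp_monomial 0 1 f x
  simpa [iterPd] using this

/-- Partial derivatives of smooth functions commute, so multiplication of polynomials corresponds to
composition of operators. -/
lemma diffOp_X_mul {f : (Fin 3 → ℝ) → ℝ} (hf : SmoothTorus f) (i : Fin 3) (L : Op)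
    (x : Fin 3 → ℝ) : diffOp (MvPolynomial.X i * L) f x = pd i (diffOp L f) x := by
  induction L using MvPolynomial.induction_on' generalizing x with
  | monomial α c =>
    have h : diffOp (MvPolynomial.monomial α c) f = fun x => c * iterPd α f x :=
      funext fun x => diffOp_monomial α c f x
    rw [h, pd_const_mul (hf.iterPd α), pd_iterPd hf, mul_comm, MvPolynomial.X,
      MvPolynomial.monomial_mul, mul_one, diffOp_monomial]
  | add L M hL hM =>
    have h : diffOp (L + M) f = fun x => diffOp L f x + diffOp M f x :=
      funext fun x => (opAt f x).map_add L M
    rw [h, pd_add (hf.diffOp L) (hf.diffOp M), ← hL, ← hM, mul_add]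
    exact (opAt f x).map_add _ _

lemma diffOp_add (L M : Op) (f : (Fin 3 → ℝ) → ℝ) (x : Fin 3 → ℝ) :
    diffOp (L + M) f x = diffOp L f x + diffOp M f x := (opAt f x).map_add L M

lemma diffOp_smul (c : ℝ) (L : Op) (f : (Fin 3 → ℝ) → ℝ) (x : Fin 3 → ℝ) :
    diffOp (c • L) f x = c * diffOp L f x := (opAt f x).map_smul c L

lemma diffOp_zero (f : (Fin 3 → ℝ) → ℝ) (x : Fin 3 → ℝ) : diffOp 0 f x = 0 := (opAt f x).map_zero

lemma diffOp_X (i : Fin 3) {f : (Fin 3 → ℝ) → ℝ} (hf : SmoothTorus f) (x : Fin 3 → ℝ) :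
    diffOp (MvPolynomial.X i) f x = pd i f x := by
  have := diffOp_X_mul hf i 1 x
  rwa [mul_one, show diffOp 1 f = f from funext (diffOp_one f)] at this

lemma diffOp_sum {ι : Type*} (s : Finset ι) (L : ι → Op) (f : (Fin 3 → ℝ) → ℝ) (x : Fin 3 → ℝ) :
    diffOp (∑ i ∈ s, L i) f x = ∑ i ∈ s, diffOp (L i) f x := map_sum (opAt f x) L s

/-! ### Fourier coefficients -/

/-- The fundamental domain of the torus. -/
abbrev box : Set (Fin 3 → ℝ) := Set.Icc (0 : Fin 3 → ℝ) (fun _ => 2 * Real.pi)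

/-- The normalized character `(2π)^{-3/2} e^{-i n·x}`. -/
def chr (n : Fin 3 → ℤ) (x : Fin 3 → ℝ) : ℂ :=
  (((2 * Real.pi) ^ (-(3 / 2) : ℝ) : ℝ) : ℂ) *
    Complex.exp (-Complex.I * ((∑ i, (n i : ℝ) * x i : ℝ) : ℂ))

lemma torusCoeff_eq (u : (Fin 3 → ℝ) → ℝ) (n : Fin 3 → ℤ) :
    torusCoeff u n = ∫ x in box, (u x : ℂ) * chr n x := rfl

lemma contDiff_chr (n : Fin 3 → ℤ) {m : WithTop ℕ∞} : ContDiff ℝ m (chr n) := by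
  unfold chr
  have h : ContDiff ℝ m fun x : Fin 3 → ℝ => ∑ i, (n i : ℝ) * x i :=
    ContDiff.sum fun i _ => contDiff_const.mul (contDiff_apply ℝ ℝ i)
  exact contDiff_const.mul (Complex.contDiff_exp.comp
    (contDiff_const.mul (Complex.ofRealCLM.contDiff.comp h)))

lemma integrableOn_box {E : Type*} [NormedAddCommGroup E] {f : (Fin 3 → ℝ) → E}
    (hf : Continuous f) : IntegrableOn f box := hf.continuousOn.integrableOn_compact isCompact_Icc

lemma integrable_mul_chr {u : (Fin 3 → ℝ) → ℝ} (hu : Continuous u) (n : Fin 3 → ℤ) :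
    IntegrableOn (fun x => (u x : ℂ) * chr n x) box :=
  integrableOn_box ((Complex.continuous_ofReal.comp hu).mul (contDiff_chr n (m := 0)).continuous)

lemma torusCoeff_add {u v : (Fin 3 → ℝ) → ℝ} (hu : Continuous u) (hv : Continuous v)
    (n : Fin 3 → ℤ) : torusCoeff (fun x => u x + v x) n = torusCoeff u n + torusCoeff v n := by
  simp only [torusCoeff_eq]
  rw [← integral_add (integrable_mul_chr hu n) (integrable_mul_chr hv n)]
  simp only [Complex.ofReal_add, add_mul]

lemma torusCoeff_const_mul (c : ℝ) (u : (Fin 3 → ℝ) → ℝ) (n : Fin 3 → ℤ) :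
    torusCoeff (fun x => c * u x) n = c * torusCoeff u n := by
  simp only [torusCoeff_eq]
  rw [← integral_const_mul]
  simp only [Complex.ofReal_mul, mul_assoc]

lemma torusCoeff_sub {u v : (Fin 3 → ℝ) → ℝ} (hu : Continuous u) (hv : Continuous v)
    (n : Fin 3 → ℤ) : torusCoeff (fun x => u x - v x) n = torusCoeff u n - torusCoeff v n := by
  simp only [torusCoeff_eq]
  rw [← integral_sub (integrable_mul_chr hu n) (integrable_mul_chr hv n)]
  simp only [Complex.ofReal_sub, sub_mul]

lemma torusCoeff_zero (n : Fin 3 → ℤ) : torusCoeff (fun _ => 0) n = 0 := by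
  simp [torusCoeff_eq]

lemma torusCoeff_sum {ι : Type*} (s : Finset ι) {f : ι → (Fin 3 → ℝ) → ℝ}
    (hf : ∀ i ∈ s, Continuous (f i)) (n : Fin 3 → ℤ) :
    torusCoeff (fun x => ∑ i ∈ s, f i x) n = ∑ i ∈ s, torusCoeff (f i) n := by
  simp only [torusCoeff_eq]
  rw [← integral_finsetSum s fun i hi => integrable_mul_chr (hf i hi) n]
  simp only [Complex.ofReal_sum, Finset.sum_mul]

lemma norm_chr (n : Fin 3 → ℤ) (x : Fin 3 → ℝ) :
    ‖chr n x‖ = (2 * Real.pi) ^ (-(3 / 2) : ℝ) := by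
  unfold chr
  rw [norm_mul, Complex.norm_real, Complex.norm_exp, Real.norm_of_nonneg (by positivity)]
  simp

lemma norm_torusCoeff_le (u : (Fin 3 → ℝ) → ℝ) :
    ∃ C, ∀ n, ‖torusCoeff u n‖ ≤ C := by
  refine ⟨∫ x in box, ‖u x‖ * (2 * Real.pi) ^ (-(3 / 2) : ℝ), fun n => ?_⟩
  rw [torusCoeff_eq]
  refine (norm_integral_le_integral_norm _).trans (le_of_eq ?_)
  simp only [norm_mul, norm_chr, Complex.norm_real]

/-- The divergence theorem for the field whose only component is G in direction j: the two opposite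
faces cancel by periodicity. -/
lemma integral_fderiv_single_eq_zero (j : Fin 3) {G : (Fin 3 → ℝ) → ℂ} (hG : ContDiff ℝ 1 G)
    (hper : ∀ x, G (x + Pi.single j (2 * Real.pi)) = G x) :
    ∫ x in box, fderiv ℝ G x (Pi.single j 1) = 0 := by
  have h := integral_divergence_of_hasFDerivAt_off_countable' (E := ℂ) (n := 2)
    (0 : Fin 3 → ℝ) (fun _ => 2 * Real.pi) (fun _ => by simp [Real.pi_pos.le])
    (fun i x => if i = j then G x else 0) (fun i x => if i = j then fderiv ℝ G x else 0) ∅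
    Set.countable_empty ?_ ?_ ?_
  · have e1 : ∀ x, ∑ i, (if i = j then fderiv ℝ G x else 0) (Pi.single i (1 : ℝ)) =
        fderiv ℝ G x (Pi.single j 1) := by
      intro x
      rw [Finset.sum_eq_single j]
      · simp
      · intro i _ hi; simp [hi]
      · simp
    simp only [e1] at h
    rw [h]
    refine Finset.sum_eq_zero fun i _ => ?_
    by_cases hi : i = j
    · subst hi
      simp only [if_true]
      rw [sub_eq_zero]
      congr 1
      funext x
      rw [← hper (i.insertNth ((0 : Fin 3 → ℝ) i) x)]
      congr 1
      refine (Fin.insertNth_eq_iff).2 ⟨by simp, ?_⟩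
      funext k
      simp [Fin.removeNth]
    · simp [hi]
  · intro i
    by_cases hi : i = j
    · simpa [hi] using hG.continuous.continuousOn
    · simpa [hi] using continuousOn_const
  · intro x _ i
    by_cases hi : i = j
    · simpa [hi] using (hG.differentiable (by simp) x).hasFDerivAt
    · simpa [hi] using hasFDerivAt_const (0 : ℂ) x
  · refine integrableOn_box (continuous_finsetSum _ fun i _ => ?_)
    by_cases hi : i = j
    · simpa [hi] using (hG.continuous_fderiv (by simp)).clm_apply continuous_const
    · simpa [hi] using continuous_const

lemma hasFDerivAt_chr_single (n : Fin 3 → ℤ) (x : Fin 3 → ℝ) (j : Fin 3) :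
    fderiv ℝ (chr n) x (Pi.single j 1) = -Complex.I * n j * chr n x := by
  have h1 : HasFDerivAt (fun x : Fin 3 → ℝ => ∑ i, (n i : ℝ) * x i)
      (∑ i, (n i : ℝ) • ContinuousLinearMap.proj (R := ℝ) i) x :=
    HasFDerivAt.fun_sum fun i _ => (hasFDerivAt_apply i x).const_mul _
  have h2 := ((Complex.ofRealCLM.hasFDerivAt.comp x h1).const_mul (-Complex.I)).cexp.const_mul
    (((2 * Real.pi) ^ (-(3 / 2) : ℝ) : ℝ) : ℂ)
  have h3 : HasFDerivAt (chr n) _ x := h2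
  rw [h3.fderiv]
  simp [chr, Pi.single_apply]
  ring

lemma chr_periodic (n : Fin 3 → ℤ) (j : Fin 3) (x : Fin 3 → ℝ) :
    chr n (x + Pi.single j (2 * Real.pi)) = chr n x := by
  unfold chr
  congr 1
  rw [Complex.exp_eq_exp_iff_exists_int]
  refine ⟨-n j, ?_⟩
  simp only [Pi.add_apply, mul_add, Finset.sum_add_distrib, Pi.single_apply, mul_ite, mul_zero,
    Finset.sum_ite_eq', Finset.mem_univ, if_true]
  push_cast
  ring

/-- Integration by parts: the derivative of u times the character has integral zero. -/
lemma torusCoeff_pd {u : (Fin 3 → ℝ) → ℝ} (hu : SmoothTorus u) (j : Fin 3) (n : Fin 3 → ℤ) :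
    torusCoeff (pd j u) n = Complex.I * n j * torusCoeff u n := by
  have hu1 : ContDiff ℝ 1 fun x => (u x : ℂ) :=
    Complex.ofRealCLM.contDiff.comp (hu.1.of_le (by simp))
  have h := integral_fderiv_single_eq_zero (G := fun x => (u x : ℂ) * chr n x) j
    (hu1.mul (contDiff_chr n))
    (fun x => by simp only [chr_periodic, hu.2])
  have e : ∀ x, fderiv ℝ (fun x => (u x : ℂ) * chr n x) x (Pi.single j 1) =
      (pd j u x : ℂ) * chr n x - (Complex.I * n j) * ((u x : ℂ) * chr n x) := by
    intro x
    have hd : HasFDerivAt (fun x => (u x : ℂ)) (Complex.ofRealCLM.comp (fderiv ℝ u x)) x :=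
      Complex.ofRealCLM.hasFDerivAt.comp x (hu.differentiable x).hasFDerivAt
    rw [fderiv_fun_mul hd.differentiableAt ((contDiff_chr n (m := 1)).differentiable (by simp) x),
      hd.fderiv]
    simp only [add_apply, smul_apply,
      hasFDerivAt_chr_single, ContinuousLinearMap.comp_apply, Complex.ofRealCLM_apply, pd,
      smul_eq_mul]
    ring
  simp only [e] at h
  rw [integral_sub (integrable_mul_chr (hu.pd j).continuous n)
    ((integrable_mul_chr hu.continuous n).const_mul _), integral_const_mul, sub_eq_zero] at h
  exact h

/-- The symbol of a differential operator at the frequency `n`. -/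
def symbol (n : Fin 3 → ℤ) : Op →ₐ[ℝ] ℂ := MvPolynomial.aeval fun j => Complex.I * n j

lemma torusCoeff_iterate_pd {u : (Fin 3 → ℝ) → ℝ} (hu : SmoothTorus u) (j : Fin 3) (m : ℕ)
    (n : Fin 3 → ℤ) : torusCoeff ((pd j)^[m] u) n = (Complex.I * n j) ^ m * torusCoeff u n := by
  induction m with
  | zero => simp
  | succ m ih =>
    rw [Function.iterate_succ_apply', torusCoeff_pd (hu.iterate_pd j m), ih]; ring

lemma torusCoeff_diffOp {u : (Fin 3 → ℝ) → ℝ} (hu : SmoothTorus u) (L : Op) (n : Fin 3 → ℤ) :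
    torusCoeff (diffOp L u) n = symbol n L * torusCoeff u n := by
  unfold diffOp
  rw [torusCoeff_sum _ fun α _ => ((hu.iterPd α).const_mul _).continuous, symbol,
    MvPolynomial.aeval_def, MvPolynomial.eval₂_eq, Finset.sum_mul]
  refine Finset.sum_congr rfl fun α _ => ?_
  rw [torusCoeff_const_mul, iterPd, torusCoeff_iterate_pd ((hu.iterate_pd 2 _).iterate_pd 1 _),
    torusCoeff_iterate_pd (hu.iterate_pd 2 _), torusCoeff_iterate_pd hu, 
    Finset.prod_subset (Finset.subset_univ α.support) fun i _ hi => by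
      rw [Finsupp.notMem_support_iff.1 hi, pow_zero], Fin.prod_univ_three]
  simp only [Complex.coe_algebraMap]
  ring

/-- The weight `1 + |n|²`. -/
def wgt (n : Fin 3 → ℤ) : ℝ := 1 + ∑ i, (n i : ℝ) ^ 2

lemma one_le_wgt (n : Fin 3 → ℤ) : 1 ≤ wgt n := by
  unfold wgt
  have : 0 ≤ ∑ i, (n i : ℝ) ^ 2 := Finset.sum_nonneg fun _ _ => sq_nonneg _
  linarith

lemma wgt_pos (n : Fin 3 → ℤ) : 0 < wgt n := zero_lt_one.trans_le (one_le_wgt n)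

/-- Rapidly decreasing sequences. -/
def Rapid (a : (Fin 3 → ℤ) → ℂ) : Prop := ∀ m : ℕ, ∃ C, ∀ n, wgt n ^ m * ‖a n‖ ≤ C

/-- The operator (1 - Δ)^m has symbol (1 + |n|²)^m, and the Fourier coefficients of the function it
produces are bounded. -/
lemma rapid_torusCoeff {u : (Fin 3 → ℝ) → ℝ} (hu : SmoothTorus u) : Rapid (torusCoeff u) := by
  intro m
  obtain ⟨C, hC⟩ := norm_torusCoeff_le
    (diffOp ((1 - ∑ i, MvPolynomial.X i ^ 2) ^ m) u)
  refine ⟨C, fun n => (le_of_eq ?_).trans (hC n)⟩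
  rw [torusCoeff_diffOp hu, norm_mul]
  congr 1
  have : symbol n ((1 - ∑ i, MvPolynomial.X i ^ 2) ^ m) = ((wgt n ^ m : ℝ) : ℂ) := by
    rw [map_pow, map_sub, map_one, map_sum]
    simp only [symbol, map_pow, MvPolynomial.aeval_X, mul_pow, Complex.I_sq, wgt]
    push_cast
    congr 1
    rw [← Finset.mul_sum]
    ring
  rw [this, Complex.norm_real, Real.norm_of_nonneg (pow_nonneg (wgt_pos n).le m)]

/-! ### Differentiation under the integral -/

/-- Dominated convergence: the τ-derivative is bounded on the compact product of [τ - 1, τ + 1] with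
the fundamental domain. -/
lemma hasDerivAt_torusCoeff {w : ℝ × (Fin 3 → ℝ) → ℝ} (hw : ContDiff ℝ 1 w) (n : Fin 3 → ℤ)
    (τ : ℝ) : HasDerivAt (fun s => torusCoeff (fun x => w (s, x)) n)
      (torusCoeff (fun x => fderiv ℝ w (τ, x) (1, 0)) n) τ := by
  have hc : Continuous fun q : ℝ × (Fin 3 → ℝ) => fderiv ℝ w q (1, 0) :=
    (hw.continuous_fderiv (by simp)).clm_apply continuous_const
  obtain ⟨C, hC⟩ := ((isCompact_Icc (a := τ - 1) (b := τ + 1)).prod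
    (isCompact_Icc (a := (0 : Fin 3 → ℝ)) (b := fun _ => 2 * Real.pi))).exists_bound_of_continuousOn
      hc.continuousOn
  have hsl : ∀ s : ℝ, Continuous fun x : Fin 3 → ℝ => (s, x) := fun s => by fun_prop
  simp only [torusCoeff_eq]
  refine (hasDerivAt_integral_of_dominated_loc_of_deriv_le (s := Set.Icc (τ - 1) (τ + 1))
    (bound := fun _ => C * (2 * Real.pi) ^ (-(3 / 2) : ℝ))
    (F' := fun s x => ((fderiv ℝ w (s, x) (1, 0) : ℝ) : ℂ) * chr n x)
    (Icc_mem_nhds (by linarith) (by linarith)) ?_ ?_ ?_ ?_ ?_ ?_).2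
  · exact Filter.Eventually.of_forall fun s =>
      (integrable_mul_chr (hw.continuous.comp (hsl s)) n).aestronglyMeasurable
  · exact integrable_mul_chr (hw.continuous.comp (hsl τ)) n
  · exact (integrable_mul_chr (hc.comp (hsl τ)) n).aestronglyMeasurable
  · refine (ae_restrict_iff' measurableSet_Icc).2 (Filter.Eventually.of_forall fun x hx s hs => ?_)
    rw [norm_mul, norm_chr, Complex.norm_real]
    exact mul_le_mul_of_nonneg_right (hC (s, x) ⟨hs, hx⟩) (by positivity)
  · exact integrableOn_box continuous_const
  · refine Filter.Eventually.of_forall fun x s _ => ?_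
    have h1 : HasDerivAt (fun s => w (s, x)) (fderiv ℝ w (s, x) (1, 0)) s :=
      (hw.differentiable (by simp) (s, x)).hasFDerivAt.comp_hasDerivAt s
        ((hasDerivAt_id s).prodMk (hasDerivAt_const s x))
    exact (h1.ofReal_comp).mul_const _

open MeasureTheory

/-! ### Summability of rapidly decreasing sequences -/

lemma summable_int_inv_one_add_sq : Summable fun k : ℤ => (1 + (k : ℝ) ^ 2)⁻¹ := by
  have h1 : Summable fun k : ℤ => 1 / (k : ℝ) ^ 2 := Real.summable_one_div_int_pow.2 (by norm_num)
  have h2 : Summable fun k : ℤ => if k = 0 then (1 : ℝ) else 0 :=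
    (hasSum_ite_eq (0 : ℤ) (1 : ℝ)).summable
  refine Summable.of_nonneg_of_le (fun k => by positivity) (fun k => ?_) (h1.add h2)
  by_cases hk : k = 0
  · simp [hk]
  · have : 0 < (k : ℝ) ^ 2 := by positivity
    simp only [hk, if_false, add_zero, one_div]
    exact inv_anti₀ this (by linarith)

/-- The cube of 1 + |n|² dominates the product of the three factors 1 + n_i², whose inverses are
summable separately. -/
lemma summable_wgt : Summable fun n : Fin 3 → ℤ => (wgt n ^ 3)⁻¹ := by
  have h2 := (summable_int_inv_one_add_sq.mul_of_nonneg (summable_int_inv_one_add_sq.mul_of_nonneg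
    summable_int_inv_one_add_sq (fun k => by positivity) (fun k => by positivity))
    (fun k => by positivity) (fun k => by simp only [Pi.zero_apply]; positivity))
  let e : (Fin 3 → ℤ) → ℤ × ℤ × ℤ := fun n => (n 0, n 1, n 2)
  have he : Function.Injective e := by
    intro n m h
    simp only [e, Prod.mk.injEq] at h
    funext i
    fin_cases i
    exacts [h.1, h.2.1, h.2.2]
  refine Summable.of_nonneg_of_le (fun n => by have := wgt_pos n; positivity) (fun n => ?_)
    (h2.comp_injective he)
  simp only [Function.comp, e]
  rw [← mul_inv, ← mul_inv]
  refine inv_anti₀ (by positivity) ?_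
  have hw : wgt n = 1 + ((n 0 : ℝ) ^ 2 + (n 1 : ℝ) ^ 2 + (n 2 : ℝ) ^ 2) := by
    simp [wgt, Fin.sum_univ_three]
  have key : ∀ i, 1 + (n i : ℝ) ^ 2 ≤ wgt n := by
    intro i
    rw [hw]
    have := sq_nonneg (n 0 : ℝ); have := sq_nonneg (n 1 : ℝ); have := sq_nonneg (n 2 : ℝ)
    fin_cases i <;> simp <;> linarith
  calc (1 + (n 0 : ℝ) ^ 2) * ((1 + (n 1 : ℝ) ^ 2) * (1 + (n 2 : ℝ) ^ 2))
      ≤ wgt n * (wgt n * wgt n) := by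
        have := (wgt_pos n).le
        gcongr <;> exact key _
    _ = wgt n ^ 3 := by ring

lemma Rapid.summable_mul {a : (Fin 3 → ℤ) → ℂ} (ha : Rapid a) (m : ℕ) :
    Summable fun n => wgt n ^ m * ‖a n‖ := by
  obtain ⟨C, hC⟩ := ha (m + 3)
  refine Summable.of_nonneg_of_le (fun n => by have := wgt_pos n; positivity) (fun n => ?_)
    (summable_wgt.mul_left C)
  have := wgt_pos n
  rw [← div_eq_mul_inv, le_div_iff₀ (by positivity)]
  refine le_trans (le_of_eq ?_) (hC n)
  rw [pow_add]; ring

/-! ### Functions with given Fourier coefficients -/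

lemma iteratedDeriv_mul_cexp (c d : ℂ) (k : ℕ) :
    iteratedDeriv k (fun t : ℝ => c * Complex.exp (d * t)) =
      fun t : ℝ => d ^ k * (c * Complex.exp (d * t)) := by
  induction k with
  | zero => simp
  | succ k ih =>
    rw [iteratedDeriv_succ, ih]
    funext t
    have : HasDerivAt (fun t : ℝ => d ^ k * (c * Complex.exp (d * t))) _ t :=
      (((Complex.ofRealCLM.hasDerivAt (x := t)).const_mul d).cexp.const_mul c).const_mul (d ^ k)
    rw [this.deriv]
    simp only [Complex.ofRealCLM_apply, Complex.ofReal_one]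
    ring

/-- The character is a one-variable exponential composed with a linear form of norm at most 3(1 +
|n|²), so each derivative costs one such factor. -/
lemma norm_iteratedFDeriv_mul_chr (c : ℂ) (n : Fin 3 → ℤ) (k : ℕ) (x : Fin 3 → ℝ) :
    ‖iteratedFDeriv ℝ k (fun x => c * chr n x) x‖ ≤
      (2 * Real.pi) ^ (-(3 / 2) : ℝ) * 3 ^ k * (wgt n ^ k * ‖c‖) := by
  let ℓ : (Fin 3 → ℝ) →L[ℝ] ℝ := ∑ i, (n i : ℝ) • ContinuousLinearMap.proj (R := ℝ) i
  let b : ℂ := c * (((2 * Real.pi) ^ (-(3 / 2) : ℝ) : ℝ) : ℂ)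
  have hg : ContDiff ℝ k (fun t : ℝ => b * Complex.exp (-Complex.I * t)) :=
    contDiff_const.mul (Complex.contDiff_exp.comp
      (contDiff_const.mul Complex.ofRealCLM.contDiff))
  have hfun : (fun x => c * chr n x) = (fun t : ℝ => b * Complex.exp (-Complex.I * t)) ∘ ℓ := by
    funext x
    simp [chr, ℓ, b, mul_assoc]
  have hℓ : ‖ℓ‖ ≤ 3 * wgt n := by
    refine (norm_sum_le _ _).trans ?_
    have h1 : ∀ i ∈ (Finset.univ : Finset (Fin 3)),
        ‖(n i : ℝ) • ContinuousLinearMap.proj (R := ℝ) (φ := fun _ : Fin 3 => ℝ) i‖ ≤ wgt n := by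
      intro i _
      rw [norm_smul]
      have h2 : ‖ContinuousLinearMap.proj (R := ℝ) (φ := fun _ : Fin 3 => ℝ) i‖ ≤ 1 :=
        ContinuousLinearMap.opNorm_le_bound _ zero_le_one fun y => by
          simpa using norm_le_pi_norm y i
      have h3 : ‖(n i : ℝ)‖ ≤ wgt n := by
        have h4 : (n i : ℝ) ^ 2 ≤ ∑ i, (n i : ℝ) ^ 2 :=
          Finset.single_le_sum (f := fun i => (n i : ℝ) ^ 2) (fun _ _ => sq_nonneg _)
            (Finset.mem_univ i)
        rw [Real.norm_eq_abs, wgt]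
        nlinarith [sq_abs (n i : ℝ), sq_nonneg (|(n i : ℝ)| - 1)]
      calc _ ≤ ‖(n i : ℝ)‖ * 1 := by gcongr
        _ ≤ wgt n := by rw [mul_one]; exact h3
    refine (Finset.sum_le_sum h1).trans ?_
    simp
  rw [hfun, ℓ.iteratedFDeriv_comp_right hg x le_rfl]
  refine (ContinuousMultilinearMap.norm_compContinuousLinearMap_le _ _).trans ?_
  rw [norm_iteratedFDeriv_eq_norm_iteratedDeriv, iteratedDeriv_mul_cexp]
  have h5 : ‖Complex.exp (-Complex.I * (ℓ x : ℂ))‖ = 1 := by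
    rw [Complex.norm_exp]; simp
  simp only [norm_mul, norm_pow, norm_neg, Complex.norm_I, one_pow, one_mul, h5, mul_one, b,
    Complex.norm_real, Finset.prod_const, Finset.card_univ, Fintype.card_fin]
  rw [Real.norm_of_nonneg (by positivity)]
  calc ‖c‖ * (2 * Real.pi) ^ (-(3 / 2) : ℝ) * ‖ℓ‖ ^ k
      ≤ ‖c‖ * (2 * Real.pi) ^ (-(3 / 2) : ℝ) * (3 * wgt n) ^ k := by gcongr
    _ = _ := by rw [mul_pow]; ring

lemma contDiff_tsum_chr {a : (Fin 3 → ℤ) → ℂ} (ha : Rapid a) :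
    ContDiff ℝ ((⊤ : ℕ∞) : WithTop ℕ∞) fun x => ∑' n, a n * chr (-n) x := by
  have hw : ∀ n, wgt (-n) = wgt n := fun n => by simp [wgt]
  refine contDiff_tsum (v := fun k n => (2 * Real.pi) ^ (-(3 / 2) : ℝ) * 3 ^ k *
    (wgt n ^ k * ‖a n‖)) (fun n => contDiff_const.mul (contDiff_chr _))
    (fun k _ => (ha.summable_mul k).mul_left _) fun k n x _ => ?_
  rw [← hw n]
  exact norm_iteratedFDeriv_mul_chr _ _ _ _

lemma chr_mul (m n : Fin 3 → ℤ) (x : Fin 3 → ℝ) :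
    chr m x * chr n x = (((2 * Real.pi) ^ (-(3 / 2) : ℝ) : ℝ) : ℂ) * chr (m + n) x := by
  unfold chr
  rw [mul_mul_mul_comm, ← Complex.exp_add, mul_assoc]
  congr 3
  rw [← mul_add, ← Complex.ofReal_add, ← Finset.sum_add_distrib]
  simp only [Pi.add_apply, Int.cast_add, add_mul]

lemma integral_chr (n : Fin 3 → ℤ) :
    ∫ x in box, chr n x = if n = 0 then (((2 * Real.pi) ^ (3 / 2 : ℝ) : ℝ) : ℂ) else 0 := by
  split_ifs with h
  · subst h
    have h0 : ∀ x, chr 0 x = (((2 * Real.pi) ^ (-(3 / 2) : ℝ) : ℝ) : ℂ) := fun x => by simp [chr]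
    simp only [h0]
    rw [setIntegral_const, measureReal_def, Real.volume_Icc_pi_toReal (fun _ => by
      simp [Real.pi_pos.le])]
    simp only [Pi.zero_apply, sub_zero, Finset.prod_const, Finset.card_univ, Fintype.card_fin]
    rw [Complex.real_smul, ← Complex.ofReal_mul, ← Real.rpow_natCast, ← Real.rpow_add (by positivity)]
    norm_num
  · obtain ⟨j, hj⟩ : ∃ j, n j ≠ 0 := by
      by_contra hne
      push Not at hne
      exact h (funext hne)
    have := integral_fderiv_single_eq_zero j (contDiff_chr n) (chr_periodic n j)
    simp only [hasFDerivAt_chr_single] at this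
    rw [integral_const_mul] at this
    refine (mul_eq_zero.1 this).resolve_left ?_
    simp [hj, Complex.I_ne_zero]

lemma conj_chr (n : Fin 3 → ℤ) (x : Fin 3 → ℝ) : starRingEnd ℂ (chr n x) = chr (-n) x := by
  unfold chr
  rw [map_mul, Complex.conj_ofReal, ← Complex.exp_conj]
  simp only [map_mul, map_neg, Complex.conj_I, Complex.conj_ofReal, Pi.neg_apply, Int.cast_neg,
    neg_mul, Finset.sum_neg_distrib, Complex.ofReal_neg, neg_neg, mul_neg]

/-- A rapidly decreasing sequence is summed to a Fourier series that converges with all derivatives.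
Taking the real part is what symmetrizes the coefficients under n ↦ -n and conjugation. -/
lemma exists_smoothTorus {a : (Fin 3 → ℤ) → ℂ} (ha : Rapid a) :
    ∃ f, SmoothTorus f ∧ ∀ n, torusCoeff f n = (a n + starRingEnd ℂ (a (-n))) / 2 := by
  have hw : ∀ n, wgt (-n) = wgt n := fun n => by simp [wgt]
  set b : (Fin 3 → ℤ) → ℂ := fun n => (a n + starRingEnd ℂ (a (-n))) / 2 with hb
  have hsum0 : ∀ {c : (Fin 3 → ℤ) → ℂ}, Rapid c → Summable fun n => ‖c n‖ := fun hc => by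
    simpa using hc.summable_mul 0
  have hsum : ∀ {c : (Fin 3 → ℤ) → ℂ}, Rapid c → ∀ x, Summable fun n => c n * chr (-n) x := by
    intro c hc x
    refine Summable.of_norm ?_
    simp only [norm_mul, norm_chr]
    exact (hsum0 hc).mul_right _
  have ha' : Rapid fun n => starRingEnd ℂ (a (-n)) := by
    intro m
    obtain ⟨C, hC⟩ := ha m
    exact ⟨C, fun n => by rw [RCLike.norm_conj, ← hw n]; exact hC (-n)⟩
  have hbR : Rapid b := by
    intro m
    obtain ⟨C, hC⟩ := ha m
    obtain ⟨C', hC'⟩ := ha' m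
    refine ⟨(C + C') / 2, fun n => ?_⟩
    have h1 : ‖b n‖ ≤ (‖a n‖ + ‖starRingEnd ℂ (a (-n))‖) / 2 := by
      rw [hb]; simp only [norm_div, Complex.norm_ofNat]
      gcongr
      exact norm_add_le _ _
    have h2 := mul_le_mul_of_nonneg_left h1 (pow_nonneg (wgt_pos n).le m)
    have := hC n
    have := hC' n
    nlinarith
  have hre : ∀ x, (((∑' n, a n * chr (-n) x).re : ℝ) : ℂ) = ∑' n, b n * chr (-n) x := by
    intro x
    rw [Complex.re_eq_add_conj, Complex.conj_tsum]
    have e1 : ∑' n, starRingEnd ℂ (a n * chr (-n) x) =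
        ∑' n, starRingEnd ℂ (a (-n)) * chr (-n) x := by
      rw [← (Equiv.neg (Fin 3 → ℤ)).tsum_eq]
      refine tsum_congr fun n => ?_
      simp [conj_chr]
    rw [e1, ← (hsum ha x).tsum_add (hsum ha' x), ← tsum_div_const]
    refine tsum_congr fun n => ?_
    rw [hb]; ring
  refine ⟨fun x => (∑' n, a n * chr (-n) x).re, ⟨?_, ?_⟩, fun n => ?_⟩
  · exact Complex.reCLM.contDiff.comp (contDiff_tsum_chr ha)
  · intro i x
    simp only [chr_periodic]
  · rw [torusCoeff_eq]
    simp only [hre]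
    have h1 : ∀ x, (∑' m, b m * chr (-m) x) * chr n x = ∑' m, b m * chr (-m) x * chr n x :=
      fun x => tsum_mul_right.symm
    have hcont : ∀ m, Continuous fun x => b m * chr (-m) x * chr n x := fun m =>
      (continuous_const.mul (contDiff_chr (-m) (m := 0)).continuous).mul
        (contDiff_chr n (m := 0)).continuous
    have h2 := hasSum_integral_of_summable_integral_norm
      (F := fun m x => b m * chr (-m) x * chr n x) (μ := volume.restrict box)
      (fun m => integrableOn_box (hcont m)) (by
        simp only [norm_mul, norm_chr, integral_const, smul_eq_mul]
        exact (((hsum0 hbR).mul_right _).mul_right _).mul_left _)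
    have h3 : ∀ m, ∫ x in box, b m * chr (-m) x * chr n x = if m = n then b n else 0 := by
      intro m
      have : ∀ x, b m * chr (-m) x * chr n x =
          b m * (((2 * Real.pi) ^ (-(3 / 2) : ℝ) : ℝ) : ℂ) * chr (-m + n) x := fun x => by
        rw [mul_assoc, chr_mul]; ring
      simp only [this]
      rw [integral_const_mul, integral_chr]
      by_cases hmn : m = n
      · subst hmn
        simp only [neg_add_cancel, if_true]
        rw [mul_assoc, ← Complex.ofReal_mul, ← Real.rpow_add (by positivity)]
        norm_num
      · have : -m + n ≠ 0 := fun h => hmn (neg_add_eq_zero.1 h)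
        simp [hmn, this]
    simp only [h1]
    rw [← h2.tsum_eq]
    simp only [h3]
    rw [tsum_ite_eq]

/-! ### Uniform bounds on Fourier coefficients -/

/-- Bounds, with arbitrary polynomial weights in the frequency, by a function of time. -/
def RapidO (g : (Fin 3 → ℤ) → ℝ → ℂ) (h : ℝ → ℝ) : Prop :=
  ∀ m : ℕ, ∃ C, ∀ n τ, 0 ≤ τ → wgt n ^ m * ‖g n τ‖ ≤ C * h τ

lemma RapidO.add {f g : (Fin 3 → ℤ) → ℝ → ℂ} {h : ℝ → ℝ} (hf : RapidO f h) (hg : RapidO g h) :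
    RapidO (fun n τ => f n τ + g n τ) h := by
  intro m
  obtain ⟨C, hC⟩ := hf m
  obtain ⟨D, hD⟩ := hg m
  refine ⟨C + D, fun n τ hτ => ?_⟩
  have := mul_le_mul_of_nonneg_left (norm_add_le (f n τ) (g n τ)) (pow_nonneg (wgt_pos n).le m)
  linarith [hC n τ hτ, hD n τ hτ]

lemma rapidO_zero {h : ℝ → ℝ} : RapidO (fun _ _ => 0) h := fun _ => ⟨0, by simp⟩

lemma RapidO.sum {ι : Type*} {s : Finset ι} {f : ι → (Fin 3 → ℤ) → ℝ → ℂ} {h : ℝ → ℝ}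
    (hf : ∀ i ∈ s, RapidO (f i) h) : RapidO (fun n τ => ∑ i ∈ s, f i n τ) h := by
  classical
  induction s using Finset.induction_on with
  | empty => simpa using rapidO_zero
  | insert i s hi ih =>
    simp only [Finset.sum_insert hi]
    exact (hf i (Finset.mem_insert_self _ _)).add
      (ih fun j hj => hf j (Finset.mem_insert_of_mem hj))

/-- A polynomial loss in the frequency is harmless because bounds with every weight are available.
Symbols of differential operators are absorbed in this way. -/
lemma RapidO.mul {f : (Fin 3 → ℤ) → ℝ → ℂ} {h h' : ℝ → ℝ} (hf : RapidO f h)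
    {φ : (Fin 3 → ℤ) → ℝ → ℂ} {r : ℕ} {K : ℝ} {ψ : ℝ → ℝ}
    (hφ : ∀ n τ, 0 ≤ τ → ‖φ n τ‖ ≤ K * wgt n ^ r * ψ τ) (hK : 0 ≤ K)
    (hψ : ∀ τ, 0 ≤ τ → 0 ≤ ψ τ) (hh : ∀ τ, 0 ≤ τ → ψ τ * h τ = h' τ) :
    RapidO (fun n τ => φ n τ * f n τ) h' := by
  intro m
  obtain ⟨C, hC⟩ := hf (m + r)
  refine ⟨K * C, fun n τ hτ => ?_⟩
  have hw := (wgt_pos n).le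
  have hψ' := hψ τ hτ
  rw [norm_mul, ← hh τ hτ]
  calc wgt n ^ m * (‖φ n τ‖ * ‖f n τ‖)
      ≤ wgt n ^ m * ((K * wgt n ^ r * ψ τ) * ‖f n τ‖) := by gcongr; exact hφ n τ hτ
    _ = K * ψ τ * (wgt n ^ (m + r) * ‖f n τ‖) := by rw [pow_add]; ring
    _ ≤ K * ψ τ * (C * h τ) := mul_le_mul_of_nonneg_left (hC n τ hτ) (by positivity)
    _ = K * C * (ψ τ * h τ) := by ring

lemma RapidO.const_mul {f : (Fin 3 → ℤ) → ℝ → ℂ} {h : ℝ → ℝ} (hf : RapidO f h) (c : ℂ) :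
    RapidO (fun n τ => c * f n τ) h :=
  hf.mul (K := ‖c‖) (r := 0) (ψ := fun _ => 1) (fun _ _ _ => by simp) (norm_nonneg _)
    (fun _ _ => zero_le_one) fun _ _ => one_mul _

lemma RapidO.sub {f g : (Fin 3 → ℤ) → ℝ → ℂ} {h : ℝ → ℝ} (hf : RapidO f h) (hg : RapidO g h) :
    RapidO (fun n τ => f n τ - g n τ) h := by
  simpa [sub_eq_add_neg] using hf.add (hg.const_mul (-1))

lemma RapidO.congr {f g : (Fin 3 → ℤ) → ℝ → ℂ} {h : ℝ → ℝ} (hf : RapidO f h)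
    (hfg : ∀ n τ, 0 ≤ τ → g n τ = f n τ) : RapidO g h := fun m => by
  obtain ⟨C, hC⟩ := hf m
  exact ⟨C, fun n τ hτ => by rw [hfg n τ hτ]; exact hC n τ hτ⟩

lemma RapidO.mono {f : (Fin 3 → ℤ) → ℝ → ℂ} {h h' : ℝ → ℝ} (hf : RapidO f h) (K : ℝ)
    (hh : ∀ τ, 0 ≤ τ → 0 ≤ h τ ∧ h τ ≤ K * h' τ) : RapidO f h' := fun m => by
  obtain ⟨C, hC⟩ := hf m
  refine ⟨|C| * K, fun n τ hτ => (hC n τ hτ).trans ?_⟩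
  obtain ⟨h1, h2⟩ := hh τ hτ
  rw [mul_assoc]
  exact (mul_le_mul_of_nonneg_right (le_abs_self C) h1).trans
    (mul_le_mul_of_nonneg_left h2 (abs_nonneg C))

lemma Rapid.rapidO {a : (Fin 3 → ℤ) → ℂ} (ha : Rapid a) : RapidO (fun n _ => a n) fun _ => 1 :=
  fun m => by
    obtain ⟨C, hC⟩ := ha m
    exact ⟨C, fun n _ _ => by rw [mul_one]; exact hC n⟩

lemma sobolevO_of_rapidO {l : ℕ} {R : ℝ → (Fin 3 → ℝ) → Fin l → ℝ} {f : ℝ → ℝ}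
    (h : ∀ c, RapidO (fun n τ => torusCoeff (fun x => R τ x c) n) f) : SobolevO R f := by
  intro s
  -- With this j one has s + 3 ≤ 2j, which leaves the summable factor (1 + |n|²)^{-3}.
  let j : ℕ := ⌈|s|⌉₊ + 3
  choose C hC using fun c => h c j
  let S : ℝ := ∑' n : Fin 3 → ℤ, (wgt n ^ 3)⁻¹
  have hS : 0 ≤ S := tsum_nonneg fun n => by have := wgt_pos n; positivity
  let K : ℝ := (∑ c, C c ^ 2) * S
  have hK : 0 ≤ K := mul_nonneg (Finset.sum_nonneg fun _ _ => sq_nonneg _) hS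
  refine ⟨Real.sqrt K, fun τ hτ => ?_⟩
  have key : ∀ n : Fin 3 → ℤ, wgt n ^ s * ∑ c, ‖torusCoeff (fun x => R τ x c) n‖ ^ 2 ≤
      (∑ c, C c ^ 2) * f τ ^ 2 * (wgt n ^ 3)⁻¹ := by
    intro n
    have hw := wgt_pos n
    have h1 : wgt n ^ s * wgt n ^ 3 ≤ wgt n ^ (2 * j) := by
      rw [← Real.rpow_natCast, ← Real.rpow_natCast, ← Real.rpow_add hw]
      refine Real.rpow_le_rpow_of_exponent_le (one_le_wgt n) ?_
      have h2 := Nat.le_ceil |s|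
      have h3 := le_abs_self s
      have h4 := abs_nonneg s
      simp only [j]
      push_cast
      linarith
    have h5 : (wgt n ^ s * ∑ c, ‖torusCoeff (fun x => R τ x c) n‖ ^ 2) * wgt n ^ 3 ≤
        (∑ c, C c ^ 2) * f τ ^ 2 := by
      calc _ = (wgt n ^ s * wgt n ^ 3) * ∑ c, ‖torusCoeff (fun x => R τ x c) n‖ ^ 2 := by ring
        _ ≤ wgt n ^ (2 * j) * ∑ c, ‖torusCoeff (fun x => R τ x c) n‖ ^ 2 := by
            refine mul_le_mul_of_nonneg_right h1 (Finset.sum_nonneg fun _ _ => sq_nonneg _)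
        _ = ∑ c, (wgt n ^ j * ‖torusCoeff (fun x => R τ x c) n‖) ^ 2 := by
            rw [Finset.mul_sum]
            refine Finset.sum_congr rfl fun c _ => ?_
            rw [mul_pow, ← pow_mul, mul_comm j 2]
        _ ≤ ∑ c, (C c * f τ) ^ 2 := by
            refine Finset.sum_le_sum fun c _ => ?_
            exact pow_le_pow_left₀ (by positivity) (hC c n τ hτ) 2
        _ = _ := by rw [Finset.sum_mul]; simp only [mul_pow]
    rw [← div_eq_mul_inv, le_div_iff₀ (by positivity)]
    exact h5
  unfold sobolevNorm
  have h6 : (∑' n : Fin 3 → ℤ, ENNReal.ofReal ((1 + ∑ i, (n i : ℝ) ^ 2) ^ s *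
      ∑ c, ‖torusCoeff (fun x => R τ x c) n‖ ^ 2)) ≤ ENNReal.ofReal (K * f τ ^ 2) := by
    refine (ENNReal.tsum_le_tsum fun n => ENNReal.ofReal_le_ofReal (key n)).trans (le_of_eq ?_)
    rw [← ENNReal.ofReal_tsum_of_nonneg (fun n => ?_) (summable_wgt.mul_left _), tsum_mul_left]
    · congr 1
      simp only [K, S]; ring
    · have := wgt_pos n
      exact mul_nonneg (mul_nonneg (Finset.sum_nonneg fun _ _ => sq_nonneg _) (sq_nonneg _))
        (by positivity)
  refine (ENNReal.rpow_le_rpow h6 (by norm_num)).trans (le_of_eq ?_)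
  rw [ENNReal.ofReal_rpow_of_nonneg (mul_nonneg hK (sq_nonneg _)) (by norm_num),
    ← Real.sqrt_eq_rpow, Real.sqrt_mul hK, Real.sqrt_sq_eq_abs]

/-! ### The wave operator in coordinates -/

/-- The domain `t > 0`. -/
abbrev dom : Set (Fin 4 → ℝ) := {y | 0 < y 0}

lemma isOpen_dom : IsOpen dom := isOpen_lt continuous_const (continuous_apply 0)

/-- Smooth functions on the domain `t > 0`. -/
abbrev SmoothDom (h : (Fin 4 → ℝ) → ℝ) : Prop := ContDiffOn ℝ ((⊤ : ℕ∞) : WithTop ℕ∞) h dom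

lemma SmoothDom.differentiableAt {h : (Fin 4 → ℝ) → ℝ} (hh : SmoothDom h) {y : Fin 4 → ℝ}
    (hy : 0 < y 0) : DifferentiableAt ℝ h y :=
  (hh.contDiffAt (isOpen_dom.mem_nhds hy)).differentiableAt (by simp)

lemma SmoothDom.pd {h : (Fin 4 → ℝ) → ℝ} (hh : SmoothDom h) (i : Fin 4) : SmoothDom (pd i h) :=
  (hh.fderiv_of_isOpen isOpen_dom (by simp)).clm_apply contDiffOn_const

/-- The formulas for the covariant derivative hold only for t > 0. This set is open, so they may be
differentiated there. -/
lemma pd_congr {f g : (Fin 4 → ℝ) → ℝ} (h : Set.EqOn f g dom) {y : Fin 4 → ℝ} (hy : 0 < y 0)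
    (i : Fin 4) : pd i f y = pd i g y := by
  unfold pd
  rw [(Filter.eventuallyEq_of_mem (isOpen_dom.mem_nhds hy) h).fderiv_eq]

/-- The half `p_a t^{2 p_a - 1}` of the derivative of the metric coefficients. -/
def dmet (p : Fin 3 → ℝ) (t : ℝ) : Fin 4 → ℝ := Fin.cons 0 fun a => p a * t ^ (2 * p a) / t

/-- The diagonal of the inverse metric. -/
def invMet (p : Fin 3 → ℝ) (t : ℝ) : Fin 4 → ℝ := Fin.cons (-1) fun a => (t ^ (2 * p a))⁻¹

lemma metric_inv (p : Fin 3 → ℝ) {y : Fin 4 → ℝ} (hy : 0 < y 0) :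
    (metric p y)⁻¹ = Matrix.diagonal (invMet p (y 0)) := by
  refine Matrix.inv_eq_right_inv ?_
  rw [metric, Matrix.diagonal_mul_diagonal, ← Matrix.diagonal_one]
  congr 1
  funext i
  refine Fin.cases ?_ (fun a => ?_) i
  · simp [invMet]
  · simp only [invMet, Fin.cons_succ]
    exact mul_inv_cancel₀ (Real.rpow_pos_of_pos hy _).ne'

lemma pd_coord_zero_comp {φ : ℝ → ℝ} {φ' : ℝ} {y : Fin 4 → ℝ} (h : HasDerivAt φ φ' (y 0))
    (i : Fin 4) : pd i (fun z => φ (z 0)) y = if i = 0 then φ' else 0 := by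
  have h1 : HasFDerivAt (fun z : Fin 4 → ℝ => z 0)
      (ContinuousLinearMap.proj (R := ℝ) (φ := fun _ : Fin 4 => ℝ) 0) y := hasFDerivAt_apply 0 y
  have h2 := h.comp_hasFDerivAt y h1
  unfold pd
  rw [show (fun z : Fin 4 → ℝ => φ (z 0)) = φ ∘ fun z => z 0 from rfl, h2.fderiv]
  by_cases hi : i = 0
  · subst hi; simp
  · simp [hi, Ne.symm hi]

lemma pd_metric (p : Fin 3 → ℝ) {y : Fin 4 → ℝ} (hy : 0 < y 0) (i j l : Fin 4) :
    pd i (fun z => metric p z j l) y = if i = 0 ∧ j = l then 2 * dmet p (y 0) j else 0 := by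
  by_cases hjl : j = l
  · subst hjl
    simp only [and_true]
    refine Fin.cases ?_ (fun a => ?_) j
    · simp only [metric, Matrix.diagonal_apply_eq, Fin.cons_zero, dmet, mul_zero, ite_self]
      simp [pd]
    · simp only [metric, Matrix.diagonal_apply_eq, Fin.cons_succ, dmet]
      rw [pd_coord_zero_comp (Real.hasDerivAt_rpow_const (p := 2 * p a) (Or.inl hy.ne')),
        Real.rpow_sub_one hy.ne']
      congr 1; ring
  · simp only [metric, Matrix.diagonal_apply_ne _ hjl, hjl, and_false, if_false]
    simp [pd]

/-- The metric is diagonal with entries depending on t alone. The sum over l collapses, and only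
t-derivatives of diagonal entries survive. -/
lemma christoffel_eq (p : Fin 3 → ℝ) {y : Fin 4 → ℝ} (hy : 0 < y 0) (k i j : Fin 4) :
    christoffel (metric p) k i j y = invMet p (y 0) k *
      ((if i = 0 ∧ j = k then dmet p (y 0) j else 0) + (if j = 0 ∧ i = k then dmet p (y 0) i else 0)
        - (if k = 0 ∧ i = j then dmet p (y 0) i else 0)) := by
  unfold christoffel
  rw [metric_inv p hy, Finset.sum_eq_single k]
  · simp only [Matrix.diagonal_apply_eq, pd_metric p hy]
    split_ifs <;> ring
  · intro l _ hl
    rw [Matrix.diagonal_apply_ne _ (Ne.symm hl), zero_mul]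
  · simp

lemma christoffel_zero_zero (p : Fin 3 → ℝ) {y : Fin 4 → ℝ} (hy : 0 < y 0) (k : Fin 4) :
    christoffel (metric p) k 0 0 y = 0 := by
  rw [christoffel_eq p hy]
  simp [dmet]

lemma christoffel_zero_succ (p : Fin 3 → ℝ) {y : Fin 4 → ℝ} (hy : 0 < y 0) (k : Fin 4)
    (b : Fin 3) : christoffel (metric p) k 0 b.succ y = if k = b.succ then p b / y 0 else 0 := by
  rw [christoffel_eq p hy]
  have h := (Real.rpow_pos_of_pos hy (2 * p b)).ne'
  have h0 := hy.ne'
  by_cases hk : k = b.succ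
  · subst hk
    simp [dmet, invMet, Fin.succ_ne_zero]
    field_simp
  · have h1 : ¬ b.succ = k := fun h => hk h.symm
    have h2 : ¬ (0 : Fin 4) = b.succ := (Fin.succ_ne_zero b).symm
    simp [hk, h1, h2, Fin.succ_ne_zero]

lemma christoffel_succ_zero (p : Fin 3 → ℝ) {y : Fin 4 → ℝ} (hy : 0 < y 0) (k : Fin 4)
    (b : Fin 3) : christoffel (metric p) k b.succ 0 y = if k = b.succ then p b / y 0 else 0 := by
  rw [← christoffel_zero_succ p hy, christoffel_eq p hy, christoffel_eq p hy]
  have h2 : ¬ (0 : Fin 4) = b.succ := (Fin.succ_ne_zero b).symm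
  simp [h2, Fin.succ_ne_zero]

lemma christoffel_succ_succ (p : Fin 3 → ℝ) {y : Fin 4 → ℝ} (hy : 0 < y 0) (k : Fin 4)
    (a b : Fin 3) : christoffel (metric p) k a.succ b.succ y =
      if k = 0 ∧ a = b then p a * y 0 ^ (2 * p a) / y 0 else 0 := by
  rw [christoffel_eq p hy]
  by_cases hk : k = 0
  · subst hk
    by_cases hab : a = b <;> simp [hab, dmet, invMet, Fin.succ_ne_zero]
  · simp [hk, Fin.succ_ne_zero]

section

variable {p : Fin 3 → ℝ} {ω : (Fin 4 → ℝ) → Fin 4 → ℝ} {y : Fin 4 → ℝ}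

lemma covDeriv_zero_zero (hy : 0 < y 0) :
    covDeriv (metric p) ω 0 0 y = pd 0 (fun z => ω z 0) y := by
  simp [covDeriv, christoffel_zero_zero p hy]

lemma covDeriv_zero_succ (hy : 0 < y 0) (b : Fin 3) :
    covDeriv (metric p) ω 0 b.succ y =
      pd 0 (fun z => ω z b.succ) y - p b / y 0 * ω y b.succ := by
  simp [covDeriv, christoffel_zero_succ p hy]

lemma covDeriv_succ_zero (hy : 0 < y 0) (a : Fin 3) :
    covDeriv (metric p) ω a.succ 0 y =
      pd a.succ (fun z => ω z 0) y - p a / y 0 * ω y a.succ := by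
  simp [covDeriv, christoffel_succ_zero p hy]

lemma covDeriv_succ_succ (hy : 0 < y 0) (a b : Fin 3) :
    covDeriv (metric p) ω a.succ b.succ y = pd a.succ (fun z => ω z b.succ) y -
      if a = b then p a * y 0 ^ (2 * p a) / y 0 * ω y 0 else 0 := by
  simp only [covDeriv, christoffel_succ_succ p hy]
  congr 1
  rw [Finset.sum_eq_single 0]
  · by_cases hab : a = b <;> simp [hab]
  · intro k _ hk; simp [hk]
  · simp

lemma pd_sub_coord_mul {f g : (Fin 4 → ℝ) → ℝ} {φ : ℝ → ℝ} {φ' : ℝ} (hf : SmoothDom f)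
    (hg : SmoothDom g) (hy : 0 < y 0) (hφ : HasDerivAt φ φ' (y 0)) (i : Fin 4) :
    pd i (fun z => f z - φ (z 0) * g z) y =
      pd i f y - ((if i = 0 then φ' else 0) * g y + φ (y 0) * pd i g y) := by
  have h1 : HasFDerivAt (fun z : Fin 4 → ℝ => z 0)
      (ContinuousLinearMap.proj (R := ℝ) (φ := fun _ : Fin 4 => ℝ) 0) y := hasFDerivAt_apply 0 y
  have h2 := hφ.comp_hasFDerivAt y h1
  have h3 := (hf.differentiableAt hy).hasFDerivAt.sub (h2.mul (hg.differentiableAt hy).hasFDerivAt)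
  have h4 : HasFDerivAt (fun z => f z - φ (z 0) * g z) _ y := h3
  unfold pd
  rw [h4.fderiv]
  by_cases hi : i = 0
  · subst hi; simp; ring
  · simp [hi, Ne.symm hi]

lemma boxOneForm_eq (hy : 0 < y 0) (k : Fin 4) : boxOneForm (metric p) ω k y =
    -covDeriv₂ (metric p) ω 0 0 k y +
      ∑ a : Fin 3, (y 0 ^ (2 * p a))⁻¹ * covDeriv₂ (metric p) ω a.succ a.succ k y := by
  unfold boxOneForm
  rw [metric_inv p hy]
  have : ∀ i, ∑ j, Matrix.diagonal (invMet p (y 0)) i j * covDeriv₂ (metric p) ω i j k y =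
      invMet p (y 0) i * covDeriv₂ (metric p) ω i i k y := by
    intro i
    rw [Finset.sum_eq_single i]
    · simp
    · intro j _ hj; rw [Matrix.diagonal_apply_ne _ (Ne.symm hj), zero_mul]
    · simp
  simp only [this]
  rw [Fin.sum_univ_succ]
  simp [invMet]

lemma sum_christoffel_succ_succ (hy : 0 < y 0) (a b : Fin 3) (F : Fin 4 → ℝ) :
    ∑ l, christoffel (metric p) l a.succ b.succ y * F l =
      if a = b then p a * y 0 ^ (2 * p a) / y 0 * F 0 else 0 := by
  simp only [christoffel_succ_succ p hy]
  rw [Finset.sum_eq_single 0]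
  · by_cases hab : a = b <;> simp [hab]
  · intro k _ hk; simp [hk]
  · simp

lemma hasDerivAt_div_coord (c : ℝ) {t : ℝ} (ht : 0 < t) :
    HasDerivAt (fun s => c / s) (-c / t ^ 2) t := by
  have := (hasDerivAt_inv ht.ne').const_mul c
  simpa [div_eq_mul_inv] using this

/-- Everything besides second derivatives comes from Γ^a_{0a} = p_a / t and Γ^0_{aa} = p_a t^{2p_a -
1}. The sum over a is kept unevaluated; the relations between the exponents are used only in
`IsWaveSolution.hat_equation`. -/
lemma boxOneForm_zero (hω : ∀ k, SmoothDom fun z => ω z k) (hy : 0 < y 0) :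
    boxOneForm (metric p) ω 0 y = -pd 0 (pd 0 fun z => ω z 0) y +
      ∑ a : Fin 3, (y 0 ^ (2 * p a))⁻¹ * (pd a.succ (pd a.succ fun z => ω z 0) y
        - 2 * (p a / y 0) * pd a.succ (fun z => ω z a.succ) y
        - p a * y 0 ^ (2 * p a) / y 0 * pd 0 (fun z => ω z 0) y
        + p a / y 0 * (p a * y 0 ^ (2 * p a) / y 0) * ω y 0) := by
  rw [boxOneForm_eq hy]
  congr 1
  · simp only [covDeriv₂, christoffel_zero_zero p hy, zero_mul, Finset.sum_const_zero, sub_zero]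
    rw [pd_congr (fun z hz => covDeriv_zero_zero hz) hy]
  · refine Finset.sum_congr rfl fun a _ => ?_
    congr 1
    simp only [covDeriv₂]
    rw [pd_congr (fun z hz => covDeriv_succ_zero hz a) hy,
      pd_sub_coord_mul (φ := fun s => p a / s) ((hω 0).pd _) (hω _) hy (hasDerivAt_div_coord _ hy),
      sum_christoffel_succ_succ hy]
    simp only [christoffel_succ_zero p hy, ite_mul, zero_mul, Finset.sum_ite_eq', Finset.mem_univ,
      if_true, covDeriv_zero_zero hy, covDeriv_succ_succ hy, Fin.succ_ne_zero, if_false]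
    ring

lemma boxOneForm_succ (hω : ∀ k, SmoothDom fun z => ω z k) (hy : 0 < y 0) (b : Fin 3) :
    boxOneForm (metric p) ω b.succ y = -(pd 0 (pd 0 fun z => ω z b.succ) y
        - 2 * (p b / y 0) * pd 0 (fun z => ω z b.succ) y
        + (p b / y 0 ^ 2 + (p b / y 0) ^ 2) * ω y b.succ) +
      ∑ a : Fin 3, (y 0 ^ (2 * p a))⁻¹ * (pd a.succ (pd a.succ fun z => ω z b.succ) y
        - p a * y 0 ^ (2 * p a) / y 0 *
          (pd 0 (fun z => ω z b.succ) y - p b / y 0 * ω y b.succ)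
        - if a = b then p a * y 0 ^ (2 * p a) / y 0 *
          (2 * pd a.succ (fun z => ω z 0) y - p a / y 0 * ω y a.succ) else 0) := by
  rw [boxOneForm_eq hy]
  congr 1
  · simp only [covDeriv₂, christoffel_zero_zero p hy, zero_mul, Finset.sum_const_zero, sub_zero]
    rw [pd_congr (fun z hz => covDeriv_zero_succ hz b) hy,
      pd_sub_coord_mul (φ := fun s => p b / s) ((hω _).pd _) (hω _) hy (hasDerivAt_div_coord _ hy)]
    simp only [christoffel_zero_succ p hy, ite_mul, zero_mul, Finset.sum_ite_eq', Finset.mem_univ,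
      if_true, covDeriv_zero_succ hy]
    ring
  · refine Finset.sum_congr rfl fun a _ => ?_
    congr 1
    simp only [covDeriv₂]
    rw [sum_christoffel_succ_succ hy, sum_christoffel_succ_succ hy, if_pos rfl,
      covDeriv_zero_succ hy, covDeriv_succ_zero hy]
    by_cases hab : a = b
    · subst hab
      have e : Set.EqOn (covDeriv (metric p) ω a.succ a.succ) (fun z =>
          pd a.succ (fun z => ω z a.succ) z - (p a * z 0 ^ (2 * p a) / z 0) * ω z 0) dom :=
        fun z hz => by
          have := covDeriv_succ_succ (p := p) (ω := ω) hz a a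
          simpa using this
      have hφ : DifferentiableAt ℝ (fun s => p a * s ^ (2 * p a) / s) (y 0) :=
        ((Real.hasDerivAt_rpow_const (p := 2 * p a) (Or.inl hy.ne')).differentiableAt.const_mul
          _).div differentiableAt_id hy.ne'
      rw [pd_congr e hy, pd_sub_coord_mul (φ := fun s => p a * s ^ (2 * p a) / s)
        ((hω _).pd _) (hω _) hy hφ.hasDerivAt]
      simp only [Fin.succ_ne_zero, if_false, if_true]
      ring
    · have e : Set.EqOn (covDeriv (metric p) ω a.succ b.succ) (pd a.succ fun z => ω z b.succ)
          dom := fun z hz => by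
        have := covDeriv_succ_succ (p := p) (ω := ω) hz a b
        simpa [hab] using this
      rw [pd_congr e hy]
      simp only [hab, if_false]

end

/-! ### The system for the rescaled components -/

/-- The point with coordinates `t = e^{-τ}` and `x`. -/
def pt (τ : ℝ) (x : Fin 3 → ℝ) : Fin 4 → ℝ := Fin.cons (Real.exp (-τ)) x

@[simp] lemma pt_zero (τ : ℝ) (x : Fin 3 → ℝ) : pt τ x 0 = Real.exp (-τ) := rfl

lemma pt_pos (τ : ℝ) (x : Fin 3 → ℝ) : 0 < pt τ x 0 := Real.exp_pos _

lemma hasDerivAt_pt {h : (Fin 4 → ℝ) → ℝ} (hh : SmoothDom h) (τ : ℝ) (x : Fin 3 → ℝ) :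
    HasDerivAt (fun s => h (pt s x)) (-Real.exp (-τ) * pd 0 h (pt τ x)) τ := by
  have h1 : HasDerivAt (fun s => pt s x) (-Real.exp (-τ) • Pi.single 0 1) τ := by
    rw [hasDerivAt_pi]
    intro i
    refine Fin.cases ?_ (fun a => ?_) i
    · simpa [pt] using (hasDerivAt_neg τ).exp
    · simpa [pt] using hasDerivAt_const τ (x a)
  have h2 := (hh.differentiableAt (pt_pos τ x)).hasFDerivAt.comp_hasDerivAt τ h1
  refine h2.congr_deriv ?_
  simp [pd]

lemma hasFDerivAt_pt {h : (Fin 4 → ℝ) → ℝ} (hh : SmoothDom h) (τ : ℝ) (x : Fin 3 → ℝ)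
    (i : Fin 3) : pd i (fun z => h (pt τ z)) x = pd i.succ h (pt τ x) := by
  have h1 : HasFDerivAt (fun z => pt τ z) (ContinuousLinearMap.pi (Fin.cons 0 fun a =>
      ContinuousLinearMap.proj a) : (Fin 3 → ℝ) →L[ℝ] (Fin 4 → ℝ)) x := by
    rw [hasFDerivAt_pi]
    intro j
    refine Fin.cases ?_ (fun a => ?_) j
    · simpa [pt] using hasFDerivAt_const (Real.exp (-τ)) x
    · simpa [pt] using hasFDerivAt_apply a x
  have h2 := (hh.differentiableAt (pt_pos τ x)).hasFDerivAt.comp x h1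
  have h3 : HasFDerivAt (fun z => h (pt τ z)) _ x := h2
  unfold pd
  rw [h3.fderiv]
  simp only [ContinuousLinearMap.comp_apply]
  congr 1
  funext j
  refine Fin.cases ?_ (fun a => ?_) j
  · simp [(Fin.succ_ne_zero i).symm]
  · simp [Pi.single_apply]

/-- A function of `(τ, x)` on the product space. -/
def dt (w : ℝ × (Fin 3 → ℝ) → ℝ) (q : ℝ × (Fin 3 → ℝ)) : ℝ := fderiv ℝ w q (1, 0)

/-- Smooth functions of `(τ, x)` which are periodic in `x`. -/
def SmoothFamily (w : ℝ × (Fin 3 → ℝ) → ℝ) : Prop :=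
  ContDiff ℝ ((⊤ : ℕ∞) : WithTop ℕ∞) w ∧
    ∀ (i : Fin 3) τ x, w (τ, x + Pi.single i (2 * Real.pi)) = w (τ, x)

lemma SmoothFamily.hasDerivAt {w : ℝ × (Fin 3 → ℝ) → ℝ} (hw : SmoothFamily w) (τ : ℝ)
    (x : Fin 3 → ℝ) : HasDerivAt (fun s => w (s, x)) (dt w (τ, x)) τ :=
  (hw.1.differentiable (by simp) (τ, x)).hasFDerivAt.comp_hasDerivAt τ
    ((hasDerivAt_id τ).prodMk (hasDerivAt_const τ x))

lemma SmoothFamily.dt {w : ℝ × (Fin 3 → ℝ) → ℝ} (hw : SmoothFamily w) : SmoothFamily (dt w) := by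
  refine ⟨(hw.1.fderiv_right (by simp)).clm_apply contDiff_const, fun i τ x => ?_⟩
  refine (hw.hasDerivAt τ _).unique ?_
  simp only [hw.2 i]
  exact hw.hasDerivAt τ x

lemma SmoothFamily.slice {w : ℝ × (Fin 3 → ℝ) → ℝ} (hw : SmoothFamily w) (τ : ℝ) :
    SmoothTorus fun x => w (τ, x) :=
  ⟨hw.1.comp (contDiff_const.prodMk contDiff_id), fun i x => hw.2 i τ x⟩

section

variable {p : Fin 3 → ℝ} {ω : (Fin 4 → ℝ) → Fin 4 → ℝ}

/-- The rescaled components as functions on the product space. -/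
def hatFam (p : Fin 3 → ℝ) (ω : (Fin 4 → ℝ) → Fin 4 → ℝ) (μ : Fin 4) (q : ℝ × (Fin 3 → ℝ)) : ℝ :=
  hatComp p ω μ q.1 q.2

lemma hatComp_zero (τ : ℝ) (x : Fin 3 → ℝ) :
    hatComp p ω 0 τ x = -Real.exp (-1 * τ) * ω (pt τ x) 0 := by
  simp [hatComp, tauComp, wt, pt]

lemma hatComp_succ (b : Fin 3) (τ : ℝ) (x : Fin 3 → ℝ) :
    hatComp p ω b.succ τ x = Real.exp (-(1 - p b) * τ) * ω (pt τ x) b.succ := by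
  simp [hatComp, tauComp, wt, pt]

lemma IsWaveSolution.smoothDom (hω : IsWaveSolution p ω) (k : Fin 4) :
    SmoothDom fun z => ω z k := contDiffOn_pi.1 hω.smooth k

lemma IsWaveSolution.smoothFamily (hω : IsWaveSolution p ω) (μ : Fin 4) :
    SmoothFamily (hatFam p ω μ) := by
  have hpt : ContDiff ℝ ((⊤ : ℕ∞) : WithTop ℕ∞) fun q : ℝ × (Fin 3 → ℝ) => pt q.1 q.2 := by
    rw [contDiff_pi]
    intro j
    refine Fin.cases ?_ (fun a => ?_) j
    · exact Real.contDiff_exp.comp contDiff_fst.neg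
    · exact (contDiff_apply ℝ ℝ a).comp contDiff_snd
  have hc : ContDiff ℝ ((⊤ : ℕ∞) : WithTop ℕ∞) fun q : ℝ × (Fin 3 → ℝ) => ω (pt q.1 q.2) μ :=
    contDiffOn_univ.1 ((hω.smoothDom μ).comp hpt.contDiffOn fun q _ => pt_pos q.1 q.2)
  have hper : ∀ (i : Fin 3) τ x, ω (pt τ (x + Pi.single i (2 * Real.pi))) = ω (pt τ x) := by
    intro i τ x
    rw [← hω.periodic i (pt τ x) (pt_pos τ x)]
    congr 1
    funext j
    refine Fin.cases ?_ (fun a => ?_) j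
    · simp [pt, (Fin.succ_ne_zero i).symm]
    · simp [pt, Pi.single_apply]
  have hexp : ∀ c : ℝ, ContDiff ℝ ((⊤ : ℕ∞) : WithTop ℕ∞)
      fun q : ℝ × (Fin 3 → ℝ) => Real.exp (c * q.1) := fun c =>
    Real.contDiff_exp.comp (contDiff_const.mul contDiff_fst)
  constructor
  · revert hc
    refine Fin.cases (fun hc => ?_) (fun b hc => ?_) μ
    · exact (funext fun q => hatComp_zero q.1 q.2 : hatFam p ω 0 = _) ▸ (hexp _).neg.mul hc
    · exact (funext fun q => hatComp_succ b q.1 q.2 : hatFam p ω b.succ = _) ▸ (hexp _).mul hc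
  · intro i τ x
    refine Fin.cases ?_ (fun b => ?_) μ
    · simp only [hatFam, hatComp_zero, hper]
    · simp only [hatFam, hatComp_succ, hper]

lemma hasDerivAt_exp_mul_pt {h : (Fin 4 → ℝ) → ℝ} (hh : SmoothDom h) (m τ : ℝ) (x : Fin 3 → ℝ) :
    HasDerivAt (fun s => Real.exp (-m * s) * h (pt s x))
      (-m * (Real.exp (-m * τ) * h (pt τ x)) - Real.exp (-(m + 1) * τ) * pd 0 h (pt τ x)) τ := by
  have h1 := (((hasDerivAt_id τ).const_mul (-m)).exp).mul (hasDerivAt_pt hh τ x)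
  refine h1.congr_deriv ?_
  rw [show -(m + 1) * τ = -m * τ + -τ by ring, Real.exp_add]
  simp only [id]
  ring

/-- With t = e^{-τ} one has ∂_τ = -t ∂_t. Each τ-derivative therefore either multiplies by -m or
differentiates h in t and adds a factor -e^{-τ}. -/
lemma dt_of_eq_exp_mul {w : ℝ × (Fin 3 → ℝ) → ℝ} (hw : SmoothFamily w) {h : (Fin 4 → ℝ) → ℝ}
    (hh : SmoothDom h) (σ m : ℝ)
    (hwh : ∀ τ x, w (τ, x) = σ * (Real.exp (-m * τ) * h (pt τ x))) (τ : ℝ) (x : Fin 3 → ℝ) :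
    dt w (τ, x) = σ * (-m * (Real.exp (-m * τ) * h (pt τ x))
      - Real.exp (-(m + 1) * τ) * pd 0 h (pt τ x)) ∧
    dt (dt w) (τ, x) = σ * (m ^ 2 * (Real.exp (-m * τ) * h (pt τ x))
      + (2 * m + 1) * (Real.exp (-(m + 1) * τ) * pd 0 h (pt τ x))
      + Real.exp (-(m + 2) * τ) * pd 0 (pd 0 h) (pt τ x)) := by
  have h1 : ∀ τ, dt w (τ, x) = σ * (-m * (Real.exp (-m * τ) * h (pt τ x))
      - Real.exp (-(m + 1) * τ) * pd 0 h (pt τ x)) := by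
    intro τ
    refine (hw.hasDerivAt τ x).unique ?_
    simp only [hwh]
    exact (hasDerivAt_exp_mul_pt hh m τ x).const_mul σ
  refine ⟨h1 τ, (hw.dt.hasDerivAt τ x).unique ?_⟩
  simp only [h1]
  refine ((((hasDerivAt_exp_mul_pt hh m τ x).const_mul (-m)).sub
    (hasDerivAt_exp_mul_pt (hh.pd 0) (m + 1) τ x)).const_mul σ).congr_deriv ?_
  rw [show m + 1 + 1 = m + 2 by ring]
  ring

lemma pd_exp_mul_pt {h : (Fin 4 → ℝ) → ℝ} (hh : SmoothDom h) (c τ : ℝ) (i : Fin 3)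
    (x : Fin 3 → ℝ) : pd i (fun z => c * h (pt τ z)) x = c * pd i.succ h (pt τ x) := by
  rw [← hasFDerivAt_pt hh]
  unfold pd
  rw [fderiv_const_mul]
  · rfl
  · have h1 : DifferentiableAt ℝ (fun z => pt τ z) x := by
      rw [differentiableAt_pi]
      intro j
      refine Fin.cases ?_ (fun a => ?_) j
      · exact differentiableAt_const _
      · exact differentiableAt_apply a x
    exact (hh.differentiableAt (pt_pos τ x)).comp x h1

/-- The rescaled components satisfy `∂_τ² ω̂ + 2 ∂_τ ω̂ + (1 - e²) ω̂ = D ω̂`. -/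
lemma IsWaveSolution.hat_equation (hω : IsWaveSolution p ω) (hsum : ∑ i, p i = 1)
    (hsq : ∑ i, p i ^ 2 = 1) (μ : Fin 4) (τ : ℝ) (x : Fin 3 → ℝ) :
    dt (dt (hatFam p ω μ)) (τ, x) + 2 * dt (hatFam p ω μ) (τ, x)
      + (1 - wt p μ ^ 2) * hatFam p ω μ (τ, x) =
      spatialOp p τ (fun ν z => hatFam p ω ν (τ, z)) μ x := by
  set t := Real.exp (-τ) with ht
  have htpos : 0 < t := Real.exp_pos _
  have hexp2 : ∀ a : ℝ, Real.exp (-2 * (1 - a) * τ) = t ^ 2 * (t ^ (2 * a))⁻¹ := by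
    intro a
    rw [← Real.rpow_neg htpos.le, ← Real.rpow_natCast, ← Real.rpow_add htpos, ht, ← Real.exp_mul]
    congr 1; push_cast; ring
  have hexp1 : ∀ m : ℝ, Real.exp (-(m + 1) * τ) = Real.exp (-m * τ) * t := fun m => by
    rw [ht, ← Real.exp_add]; congr 1; ring
  have hexp1' : ∀ m : ℝ, Real.exp (-(m + 2) * τ) = Real.exp (-m * τ) * t ^ 2 := fun m => by
    rw [ht, ← Real.exp_nat_mul, ← Real.exp_add]; congr 1; push_cast; ring
  have hpd0 : ∀ i, pd i (fun z => hatFam p ω 0 (τ, z)) =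
      fun z => -Real.exp (-1 * τ) * pd i.succ (fun z => ω z 0) (pt τ z) := fun i => by
    funext z
    simp only [hatFam, hatComp_zero]
    exact pd_exp_mul_pt (hω.smoothDom 0) _ τ i z
  have hpds : ∀ i b, pd i (fun z => hatFam p ω (Fin.succ b) (τ, z)) = fun z =>
      Real.exp (-(1 - p b) * τ) * pd i.succ (fun z => ω z b.succ) (pt τ z) := fun i b => by
    funext z
    simp only [hatFam, hatComp_succ]
    exact pd_exp_mul_pt (hω.smoothDom _) _ τ i z
  have hpos : ∀ a, 0 < t ^ (2 * p a) := fun a => Real.rpow_pos_of_pos htpos _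
  have hE1 : Real.exp (-1 * τ) = t := by rw [ht]; congr 1; ring
  have hE : ∀ a, Real.exp (-(1 - p a) * τ) * Real.exp (-(1 - p a) * τ) =
      t ^ 2 * (t ^ (2 * p a))⁻¹ := fun a => by
    rw [← Real.exp_add, ← hexp2]; congr 1; ring
  revert μ
  refine Fin.cases ?_ fun b => ?_
  · obtain ⟨h1, h2⟩ := dt_of_eq_exp_mul (hω.smoothFamily 0) (hω.smoothDom 0) (-1) 1
      (fun τ x => by rw [hatFam, hatComp_zero]; ring) τ x
    have hbox := hω.wave 0 (pt τ x) (pt_pos τ x)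
    rw [boxOneForm_zero hω.smoothDom (pt_pos τ x)] at hbox
    rw [h1, h2]
    simp only [spatialOp, hpd0, hpds, wt, Fin.cons_zero]
    simp only [pd_exp_mul_pt ((hω.smoothDom 0).pd _), hexp1, hexp1', hE1, hatFam, hatComp_zero]
    simp only [pt_zero, ← ht] at hbox
    have hs : ∀ (a : Fin 3) (A B C F : ℝ), (t ^ (2 * p a))⁻¹ * (A - 2 * (p a / t) * B
        - p a * t ^ (2 * p a) / t * C + p a / t * (p a * t ^ (2 * p a) / t) * F) =
        (t ^ (2 * p a))⁻¹ * A - 2 / t * (p a * (t ^ (2 * p a))⁻¹ * B) - p a * (C / t)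
          + p a ^ 2 * (F / t ^ 2) := fun a A B C F => by
      have := (hpos a).ne'
      field_simp
    -- Both Kasner relations enter: the sum of the p_a gives the first order term, the sum of the
    -- p_a² the zeroth order term.
    simp only [hs, Finset.sum_add_distrib, Finset.sum_sub_distrib, ← Finset.mul_sum,
      ← Finset.sum_mul, hsum, hsq] at hbox
    have e1 : ∀ a (B : ℝ), 2 * p a * Real.exp (-(1 - p a) * τ) *
        (Real.exp (-(1 - p a) * τ) * B) = 2 * t ^ 2 * (p a * (t ^ (2 * p a))⁻¹ * B) :=
      fun a B => by linear_combination 2 * p a * B * hE a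
    have e2 : ∀ a (A : ℝ), Real.exp (-2 * (1 - p a) * τ) * (-t * A) =
        -t ^ 3 * ((t ^ (2 * p a))⁻¹ * A) := fun a A => by rw [hexp2]; ring
    simp only [e1, e2, ← Finset.mul_sum]
    generalize ∑ i, (t ^ (2 * p i))⁻¹ * pd i.succ (pd i.succ fun z => ω z 0) (pt τ x) = A at *
    generalize ∑ i, p i * (t ^ (2 * p i))⁻¹ * pd i.succ (fun z => ω z i.succ) (pt τ x) = B at *
    field_simp at hbox
    linear_combination t * hbox
  · obtain ⟨h1, h2⟩ := dt_of_eq_exp_mul (hω.smoothFamily b.succ) (hω.smoothDom b.succ) 1 (1 - p b)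
      (fun τ x => by rw [hatFam, hatComp_succ]; ring) τ x
    have hbox := hω.wave b.succ (pt τ x) (pt_pos τ x)
    rw [boxOneForm_succ hω.smoothDom (pt_pos τ x)] at hbox
    rw [h1, h2]
    simp only [spatialOp, hpd0, hpds, wt, Fin.cons_succ]
    simp only [pd_exp_mul_pt ((hω.smoothDom _).pd _), hexp1, hexp1', hE1, hatFam, hatComp_succ]
    simp only [pt_zero, ← ht] at hbox
    have hs : ∀ (a : Fin 3) (A C G : ℝ), (t ^ (2 * p a))⁻¹ * (A - p a * t ^ (2 * p a) / t * C
        - if a = b then p a * t ^ (2 * p a) / t * G else 0) =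
        (t ^ (2 * p a))⁻¹ * A - p a * (C / t) - if a = b then p a / t * G else 0 :=
      fun a A C G => by
        have := (hpos a).ne'
        split_ifs
        · field_simp
        · field_simp; ring
    simp only [hs, Finset.sum_sub_distrib, ← Finset.sum_mul, hsum, Finset.sum_ite_eq',
      Finset.mem_univ, if_true] at hbox
    have e2 : ∀ a (A : ℝ), Real.exp (-2 * (1 - p a) * τ) * (Real.exp (-(1 - p b) * τ) * A) =
        t ^ 2 * Real.exp (-(1 - p b) * τ) * ((t ^ (2 * p a))⁻¹ * A) := fun a A => by
      rw [hexp2]; ring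
    simp only [e2, ← Finset.mul_sum]
    generalize ∑ i, (t ^ (2 * p i))⁻¹ * pd i.succ (pd i.succ fun z => ω z b.succ) (pt τ x) = A at *
    field_simp at hbox
    linear_combination (-Real.exp (-(1 - p b) * τ)) * hbox

end

/-! ### Asymptotics of scalar equations -/

/-- The right-hand side is the integral of B e^{-cx} from σ to τ; both signs of c are needed later.
-/
lemma norm_sub_le_of_deriv_bound {u v : ℝ → ℂ} {c B : ℝ} (hc : c ≠ 0)
    (hu : ∀ τ, 0 ≤ τ → HasDerivAt u (v τ) τ) (hv : ∀ τ, 0 ≤ τ → ‖v τ‖ ≤ B * Real.exp (-c * τ))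
    {σ τ : ℝ} (hσ : 0 ≤ σ) (hστ : σ ≤ τ) :
    ‖u τ - u σ‖ ≤ B / c * (Real.exp (-c * σ) - Real.exp (-c * τ)) := by
  have hB : ∀ x, HasDerivAt (fun x => B / c * (Real.exp (-c * σ) - Real.exp (-c * x)))
      (B * Real.exp (-c * x)) x := fun x => by
    refine ((((hasDerivAt_id x).const_mul (-c)).exp.const_sub (Real.exp (-c * σ))).const_mul
      (B / c)).congr_deriv ?_
    simp only [id]
    field_simp
  refine image_norm_le_of_norm_deriv_right_le_deriv_boundary (f := fun x => u x - u σ) (f' := v)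
    (a := σ) (b := τ) (fun x hx => ?_) (fun x hx => ?_) ?_ hB
    (fun x hx => hv x (hσ.trans hx.1)) ⟨hστ, le_rfl⟩
  · exact ((hu x (hσ.trans hx.1)).sub_const _).continuousAt.continuousWithinAt
  · exact ((hu x (hσ.trans hx.1)).sub_const _).hasDerivWithinAt
  · simp

/-- Solutions of `y' = λ y + s` with `s = O(e^{-βτ})` are `d e^{λτ} + O(e^{-βτ})`. -/
lemma exists_asymptotics {lam β : ℝ} (h : lam + β ≠ 0) (y s : ℝ → ℂ)
    (hy : ∀ τ, 0 ≤ τ → HasDerivAt y (lam * y τ + s τ) τ) :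
    ∃ d : ℂ, (lam + β < 0 → d = 0) ∧ ∀ B, ‖y 0‖ ≤ B →
      (∀ τ, 0 ≤ τ → ‖s τ‖ ≤ B * Real.exp (-β * τ)) →
      ‖d‖ ≤ (1 + |lam + β|⁻¹) * B ∧ ∀ τ, 0 ≤ τ →
        ‖y τ - d * Real.exp (lam * τ)‖ ≤ (1 + |lam + β|⁻¹) * B * Real.exp (-β * τ) := by
  set c := lam + β with hc
  -- Variation of constants: u' = e^{-λτ} s is of order e^{-cτ}.
  let u : ℝ → ℂ := fun τ => (Real.exp (-lam * τ) : ℂ) * y τ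
  have hu : ∀ τ, 0 ≤ τ → HasDerivAt u ((Real.exp (-lam * τ) : ℂ) * s τ) τ := fun τ hτ => by
    have h1 : HasDerivAt (fun τ : ℝ => Real.exp (-lam * τ)) (Real.exp (-lam * τ) * (-lam)) τ := by
      simpa using ((hasDerivAt_id τ).const_mul (-lam)).exp
    refine (h1.ofReal_comp.mul (hy τ hτ)).congr_deriv ?_
    push_cast; ring
  have hyu : ∀ τ, y τ = (Real.exp (lam * τ) : ℂ) * u τ := fun τ => by
    simp only [u]
    rw [← mul_assoc, ← Complex.ofReal_mul, ← Real.exp_add]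
    simp
  have hv : ∀ B, (∀ τ, 0 ≤ τ → ‖s τ‖ ≤ B * Real.exp (-β * τ)) → ∀ τ, 0 ≤ τ →
      ‖(Real.exp (-lam * τ) : ℂ) * s τ‖ ≤ B * Real.exp (-c * τ) := fun B hB τ hτ => by
    rw [norm_mul, Complex.norm_real, Real.norm_of_nonneg (Real.exp_pos _).le]
    calc _ ≤ Real.exp (-lam * τ) * (B * Real.exp (-β * τ)) := by gcongr; exact hB τ hτ
      _ = B * (Real.exp (-lam * τ) * Real.exp (-β * τ)) := by ring
      _ = _ := by rw [← Real.exp_add, hc]; congr 2; ring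
  have hu0 : u 0 = y 0 := by simp [u]
  have hexp : ∀ τ, Real.exp (lam * τ) * Real.exp (-c * τ) = Real.exp (-β * τ) := fun τ => by
    rw [← Real.exp_add, hc]; congr 1; ring
  have hnorm : ∀ τ (d : ℂ), ‖y τ - d * Real.exp (lam * τ)‖ = Real.exp (lam * τ) * ‖u τ - d‖ :=
    fun τ d => by
      rw [hyu, mul_comm d, ← mul_sub, norm_mul, Complex.norm_real,
        Real.norm_of_nonneg (Real.exp_pos _).le]
  -- For c < 0 the homogeneous solution is itself of the order of the error, so d = 0 suffices. For
  -- c > 0 the function u converges, and d is its limit.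
  rcases lt_or_gt_of_ne h with hneg | hpos
  · refine ⟨0, fun _ => rfl, fun B hB0 hB => ?_⟩
    have hB' : 0 ≤ B := (norm_nonneg _).trans hB0
    refine ⟨by rw [norm_zero]; positivity, fun τ hτ => ?_⟩
    have h1 := norm_sub_le_of_deriv_bound h hu (hv B hB) le_rfl hτ
    have h2 : ‖u τ‖ ≤ (1 + |c|⁻¹) * B * Real.exp (-c * τ) := by
      have h3 : ‖u τ‖ ≤ ‖u τ - u 0‖ + ‖u 0‖ := by
        simpa using norm_add_le (u τ - u 0) (u 0)
      have h4 : 1 ≤ Real.exp (-c * τ) := Real.one_le_exp (by nlinarith)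
      have h3' : ‖u 0‖ ≤ B := by rw [hu0]; exact hB0
      have h8 := mul_le_mul_of_nonneg_left h4 hB'
      have h5 : B / c * (Real.exp (-c * 0) - Real.exp (-c * τ)) ≤ |c|⁻¹ * B * Real.exp (-c * τ) := by
        rw [abs_of_neg hneg, div_eq_mul_inv, inv_neg]
        have h6 : c⁻¹ < 0 := inv_lt_zero.2 hneg
        have h7 : B * c⁻¹ ≤ 0 := mul_nonpos_of_nonneg_of_nonpos hB' h6.le
        simp only [mul_zero, Real.exp_zero]
        nlinarith
      linarith
    rw [hnorm, sub_zero, ← hexp]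
    calc _ ≤ Real.exp (lam * τ) * ((1 + |c|⁻¹) * B * Real.exp (-c * τ)) := by gcongr
      _ = _ := by ring
  -- The coefficient d is fixed before B, because one d has to satisfy the bounds for all frequency
  -- weights. If no B is admissible, the claim is vacuous.
  · by_cases hex : ∃ B, ‖y 0‖ ≤ B ∧ ∀ τ, 0 ≤ τ → ‖s τ‖ ≤ B * Real.exp (-β * τ)
    · have hbd : ∀ B, 0 ≤ B → (∀ τ, 0 ≤ τ → ‖s τ‖ ≤ B * Real.exp (-β * τ)) →
          ∀ σ τ, 0 ≤ σ → σ ≤ τ → ‖u τ - u σ‖ ≤ B / c * Real.exp (-c * σ) := by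
        intro B hB0 hB σ τ hσ hστ
        refine (norm_sub_le_of_deriv_bound h hu (hv B hB) hσ hστ).trans ?_
        have := Real.exp_pos (-c * τ)
        gcongr
        linarith
      have htend0 : ∀ B, Filter.Tendsto (fun n : ℕ => B / c * Real.exp (-c * (n : ℝ)))
          Filter.atTop (nhds 0) := fun B => by
        have : Filter.Tendsto (fun n : ℕ => -c * (n : ℝ)) Filter.atTop Filter.atBot :=
          tendsto_natCast_atTop_atTop.const_mul_atTop_of_neg (by linarith)
        simpa using (Real.tendsto_exp_atBot.comp this).const_mul (B / c)
      obtain ⟨d, hd⟩ : ∃ d, Filter.Tendsto (fun n : ℕ => u n) Filter.atTop (nhds d) := by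
        obtain ⟨B, hB0, hB⟩ := hex
        refine cauchySeq_tendsto_of_complete (cauchySeq_of_le_tendsto_0'
          (fun n : ℕ => B / c * Real.exp (-c * (n : ℝ))) (fun n m hnm => ?_) (htend0 B))
        rw [dist_comm, dist_eq_norm]
        exact hbd B ((norm_nonneg _).trans hB0) hB n m (Nat.cast_nonneg n) (by exact_mod_cast hnm)
      refine ⟨d, fun h' => absurd h' hpos.not_gt, fun B hB0 hB => ?_⟩
      have hB' : 0 ≤ B := (norm_nonneg _).trans hB0
      have hlim : ∀ τ, 0 ≤ τ → ‖u τ - d‖ ≤ B / c * Real.exp (-c * τ) := fun τ hτ => by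
        refine le_of_tendsto ((tendsto_const_nhds.sub hd).norm)
          ((Filter.eventually_ge_atTop ⌈τ⌉₊).mono fun n hn => ?_)
        rw [norm_sub_rev]
        exact hbd B hB' hB τ n hτ (Nat.ceil_le.1 hn)
      have hcinv : B / c ≤ (1 + |c|⁻¹) * B := by
        rw [abs_of_pos hpos, div_eq_mul_inv]; nlinarith
      constructor
      · have h1 := hlim 0 le_rfl
        simp only [mul_zero, Real.exp_zero, mul_one] at h1
        have h2 : ‖d‖ ≤ ‖u 0 - d‖ + ‖u 0‖ := by
          have := norm_sub_le (u 0) (u 0 - d)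
          rw [sub_sub_cancel] at this
          linarith
        rw [hu0] at h1 h2
        rw [abs_of_pos hpos]
        rw [div_eq_mul_inv] at h1
        linarith
      · intro τ hτ
        rw [hnorm, ← hexp]
        calc _ ≤ Real.exp (lam * τ) * (B / c * Real.exp (-c * τ)) := by
              gcongr; exact hlim τ hτ
          _ = B / c * (Real.exp (lam * τ) * Real.exp (-c * τ)) := by ring
          _ ≤ _ := by gcongr
    · exact ⟨0, fun _ => rfl, fun B h1 h2 => absurd ⟨B, h1, h2⟩ hex⟩

/-- The decay `e^{-βτ}`. -/
def decay (β τ : ℝ) : ℝ := Real.exp (-β * τ)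

lemma decay_pos (β τ : ℝ) : 0 < decay β τ := Real.exp_pos _

lemma decay_mul (β γ τ : ℝ) : decay β τ * decay γ τ = decay (β + γ) τ := by
  rw [decay, decay, decay, ← Real.exp_add]; congr 1; ring

lemma decay_anti {β γ τ : ℝ} (h : β ≤ γ) (hτ : 0 ≤ τ) : decay γ τ ≤ decay β τ :=
  Real.exp_le_exp.2 (by nlinarith)

lemma RapidO.decay_mono {f : (Fin 3 → ℤ) → ℝ → ℂ} {β γ : ℝ} (hf : RapidO f (decay γ))
    (h : β ≤ γ) : RapidO f (decay β) :=
  hf.mono 1 fun τ hτ => ⟨(decay_pos _ _).le, by rw [one_mul]; exact decay_anti h hτ⟩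

lemma RapidO.rapid_at {f : (Fin 3 → ℤ) → ℝ → ℂ} {h : ℝ → ℝ} (hf : RapidO f h) :
    Rapid fun n => f n 0 := fun m => by
  obtain ⟨C, hC⟩ := hf m
  exact ⟨C * h 0, fun n => hC n 0 le_rfl⟩

/-- Both bounds decay faster than e^{λτ}; dividing by it and letting τ → ∞ leaves no room for d. -/
lemma eq_zero_of_decay {lam β γ C C' : ℝ} {d : ℂ} {y : ℝ → ℂ} (hβ : 0 < lam + β)
    (hγ : 0 < lam + γ) (h1 : ∀ τ, 0 ≤ τ → ‖y τ - d * Real.exp (lam * τ)‖ ≤ C * decay β τ)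
    (h2 : ∀ τ, 0 ≤ τ → ‖y τ‖ ≤ C' * decay γ τ) : d = 0 := by
  have key : ∀ τ, 0 ≤ τ → ‖d‖ ≤ C * Real.exp (-(lam + β) * τ) + C' * Real.exp (-(lam + γ) * τ) := by
    intro τ hτ
    have e : ∀ b, Real.exp (-(lam + b) * τ) = decay b τ / Real.exp (lam * τ) := fun b => by
      rw [decay, ← Real.exp_sub]; congr 1; ring
    rw [e, e, ← mul_div_assoc, ← mul_div_assoc, ← add_div, le_div_iff₀ (Real.exp_pos _)]
    have h3 : ‖d‖ * Real.exp (lam * τ) = ‖d * Real.exp (lam * τ)‖ := by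
      rw [norm_mul, Complex.norm_real, Real.norm_of_nonneg (Real.exp_pos _).le]
    rw [h3]
    have h4 := norm_sub_le (y τ) (y τ - d * Real.exp (lam * τ))
    rw [sub_sub_cancel] at h4
    linarith [h1 τ hτ, h2 τ hτ]
  have ht : ∀ a : ℝ, 0 < a → Filter.Tendsto (fun τ : ℝ => Real.exp (-a * τ)) Filter.atTop
      (nhds 0) := fun a ha =>
    Real.tendsto_exp_atBot.comp (Filter.tendsto_id.const_mul_atTop_of_neg (by linarith))
  have h5 := ((ht _ hβ).const_mul C).add ((ht _ hγ).const_mul C')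
  have h6 : ‖d‖ ≤ 0 := by
    refine ge_of_tendsto (by simpa using h5)
      ((Filter.eventually_ge_atTop 0).mono fun τ hτ => key τ hτ)
  exact norm_le_zero_iff.1 h6

/-- The scalar result is applied at each frequency with B = C_m (1 + |n|²)^{-m}, for every m, which
makes d rapidly decreasing. The last clause says that a mode already known to decay faster than
e^{λτ} gets no new coefficient. -/
lemma RapidO.asymptotics {lam β : ℝ} (h : lam + β ≠ 0) {w s : (Fin 3 → ℤ) → ℝ → ℂ}
    (hw : ∀ n τ, 0 ≤ τ → HasDerivAt (w n) (lam * w n τ + s n τ) τ) (hs : RapidO s (decay β))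
    (h0 : Rapid fun n => w n 0) :
    ∃ d : (Fin 3 → ℤ) → ℂ, Rapid d ∧
      RapidO (fun n τ => w n τ - d n * Real.exp (lam * τ)) (decay β) ∧
      ∀ γ, RapidO w (decay γ) → 0 < lam + γ → ∀ n, d n = 0 := by
  choose d hd0 hd using fun n => exists_asymptotics h (w n) (s n) (hw n)
  have key : ∀ m : ℕ, ∃ C, ∀ n, ‖d n‖ ≤ (1 + |lam + β|⁻¹) * (C / wgt n ^ m) ∧ ∀ τ, 0 ≤ τ →
      ‖w n τ - d n * Real.exp (lam * τ)‖ ≤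
        (1 + |lam + β|⁻¹) * (C / wgt n ^ m) * Real.exp (-β * τ) := by
    intro m
    obtain ⟨C, hC⟩ := hs m
    obtain ⟨C', hC'⟩ := h0 m
    refine ⟨max C C', fun n => hd n _ ?_ fun τ hτ => ?_⟩
    · rw [le_div_iff₀ (pow_pos (wgt_pos n) m), mul_comm]
      exact (hC' n).trans (le_max_right _ _)
    · rw [div_mul_eq_mul_div, le_div_iff₀ (pow_pos (wgt_pos n) m), mul_comm]
      exact (hC n τ hτ).trans (mul_le_mul_of_nonneg_right (le_max_left _ _) (decay_pos β τ).le)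
  refine ⟨d, fun m => ?_, fun m => ?_, fun γ hγ hlam n => ?_⟩
  · obtain ⟨C, hC⟩ := key m
    refine ⟨(1 + |lam + β|⁻¹) * C, fun n => ?_⟩
    have := (hC n).1
    have hw := pow_pos (wgt_pos n) m
    rw [← mul_div_assoc, le_div_iff₀ hw] at this
    linarith
  · obtain ⟨C, hC⟩ := key m
    refine ⟨(1 + |lam + β|⁻¹) * C, fun n τ hτ => ?_⟩
    have := (hC n).2 τ hτ
    have hw := pow_pos (wgt_pos n) m
    rw [← mul_div_assoc, div_mul_eq_mul_div, le_div_iff₀ hw] at this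
    rw [decay]
    linarith
  · rcases lt_or_gt_of_ne h with hneg | hpos
    · exact hd0 n hneg
    · obtain ⟨C, hC⟩ := key 0
      obtain ⟨C', hC'⟩ := hγ 0
      exact eq_zero_of_decay hpos hlam (hC n).2 fun τ hτ => by
        simpa using hC' n τ hτ

/-! ### The equations for the Fourier coefficients -/

/-- The spatial derivative terms at the frequency `n`. -/
def modeOp (p : Fin 3 → ℝ) (n : Fin 3 → ℤ) (τ : ℝ) (z : Fin 4 → ℂ) (μ : Fin 4) : ℂ :=
  (∑ i, (Real.exp (-2 * (1 - p i) * τ) : ℂ) * ((Complex.I * n i) * ((Complex.I * n i) * z μ))) +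
    (Fin.cons (∑ i : Fin 3, ((2 * p i * Real.exp (-(1 - p i) * τ) : ℝ) : ℂ) *
        ((Complex.I * n i) * z i.succ))
      (fun j : Fin 3 => ((2 * p j * Real.exp (-(1 - p j) * τ) : ℝ) : ℂ) *
        ((Complex.I * n j) * z 0)) : Fin 4 → ℂ) μ

/-- The Fourier coefficients of a smooth solution of the system for the rescaled components. -/
structure ModeSolution (p : Fin 3 → ℝ) (z z' : Fin 4 → (Fin 3 → ℤ) → ℝ → ℂ) : Prop where
  hasDerivAt : ∀ μ n τ, HasDerivAt (z μ n) (z' μ n τ) τ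
  hasDerivAt' : ∀ μ n τ, HasDerivAt (z' μ n)
    (-2 * z' μ n τ - (1 - (wt p μ : ℂ) ^ 2) * z μ n τ + modeOp p n τ (fun ν => z ν n τ) μ) τ
  rapid : ∀ μ, Rapid fun n => z μ n 0
  rapid' : ∀ μ, Rapid fun n => z' μ n 0

section

variable {p : Fin 3 → ℝ}

lemma abs_le_one_of_sum_sq (hsq : ∑ i, p i ^ 2 = 1) (i : Fin 3) : |p i| ≤ 1 := by
  have : p i ^ 2 ≤ ∑ i, p i ^ 2 :=
    Finset.single_le_sum (f := fun i => p i ^ 2) (fun _ _ => sq_nonneg _) (Finset.mem_univ i)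
  exact abs_le_one_iff_mul_self_le_one.2 (by nlinarith)

/-- The coupling carries one derivative with weight e^{-(1-p_i)τ}, whose square is the weight of the
corresponding second derivative. So the energy controls it uniformly in n. The constant is 4 · 3,
from (2p_i)² ≤ 4 and from the three spatial indices. -/
lemma norm_off_sq_le (n : Fin 3 → ℤ) (τ : ℝ) (hsq : ∑ i, p i ^ 2 = 1) (z : Fin 4 → ℂ) :
    ∑ μ, ‖(Fin.cons (∑ i : Fin 3, ((2 * p i * Real.exp (-(1 - p i) * τ) : ℝ) : ℂ) *
        ((Complex.I * n i) * z i.succ))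
      (fun j : Fin 3 => ((2 * p j * Real.exp (-(1 - p j) * τ) : ℝ) : ℂ) *
        ((Complex.I * n j) * z 0)) : Fin 4 → ℂ) μ‖ ^ 2 ≤
      12 * (∑ i, (n i : ℝ) ^ 2 * Real.exp (-2 * (1 - p i) * τ)) * ∑ μ, ‖z μ‖ ^ 2 := by
  have hterm : ∀ (i : Fin 3) (c : ℂ), ‖((2 * p i * Real.exp (-(1 - p i) * τ) : ℝ) : ℂ) *
      ((Complex.I * n i) * c)‖ ^ 2 ≤
      4 * ((n i : ℝ) ^ 2 * Real.exp (-2 * (1 - p i) * τ)) * ‖c‖ ^ 2 := by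
    intro i c
    have h1 : p i ^ 2 ≤ 1 := by
      have := abs_le_one_of_sum_sq hsq i
      rw [← sq_abs]; nlinarith [abs_nonneg (p i)]
    have h2 : Real.exp (-2 * (1 - p i) * τ) = Real.exp (-(1 - p i) * τ) ^ 2 := by
      rw [← Real.exp_nat_mul]; congr 1; push_cast; ring
    rw [norm_mul, norm_mul, norm_mul, Complex.norm_I, one_mul, Complex.norm_real,
      Complex.norm_intCast, mul_pow, mul_pow, sq_abs, Real.norm_eq_abs, sq_abs, h2]
    have h3 : 0 ≤ Real.exp (-(1 - p i) * τ) ^ 2 * ((n i : ℝ) ^ 2 * ‖c‖ ^ 2) := by positivity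
    nlinarith
  have hV : ∀ i, (n i : ℝ) ^ 2 * Real.exp (-2 * (1 - p i) * τ) ≤
      ∑ i, (n i : ℝ) ^ 2 * Real.exp (-2 * (1 - p i) * τ) := fun i =>
    Finset.single_le_sum (f := fun i => (n i : ℝ) ^ 2 * Real.exp (-2 * (1 - p i) * τ))
      (fun _ _ => by positivity) (Finset.mem_univ i)
  set V := ∑ i, (n i : ℝ) ^ 2 * Real.exp (-2 * (1 - p i) * τ)
  rw [Fin.sum_univ_succ, Fin.sum_univ_succ (f := fun μ => ‖z μ‖ ^ 2)]
  simp only [Fin.cons_zero, Fin.cons_succ]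
  have h1 : ‖∑ i : Fin 3, ((2 * p i * Real.exp (-(1 - p i) * τ) : ℝ) : ℂ) *
      ((Complex.I * n i) * z i.succ)‖ ^ 2 ≤ 12 * V * ∑ i : Fin 3, ‖z i.succ‖ ^ 2 := by
    calc _ ≤ (∑ i : Fin 3, ‖((2 * p i * Real.exp (-(1 - p i) * τ) : ℝ) : ℂ) *
          ((Complex.I * n i) * z i.succ)‖) ^ 2 := by gcongr; exact norm_sum_le _ _
      _ ≤ 3 * ∑ i : Fin 3, ‖((2 * p i * Real.exp (-(1 - p i) * τ) : ℝ) : ℂ) *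
          ((Complex.I * n i) * z i.succ)‖ ^ 2 := by
        simpa using sq_sum_le_card_mul_sum_sq (s := (Finset.univ : Finset (Fin 3))) (f := fun i =>
          ‖((2 * p i * Real.exp (-(1 - p i) * τ) : ℝ) : ℂ) * ((Complex.I * n i) * z i.succ)‖)
      _ ≤ 3 * ∑ i : Fin 3, 4 * V * ‖z i.succ‖ ^ 2 := by
        gcongr with i
        exact (hterm i _).trans (by gcongr; exact hV i)
      _ = _ := by rw [← Finset.mul_sum]; ring
  have h2 : ∑ j : Fin 3, ‖((2 * p j * Real.exp (-(1 - p j) * τ) : ℝ) : ℂ) *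
      ((Complex.I * n j) * z 0)‖ ^ 2 ≤ 12 * V * ‖z 0‖ ^ 2 := by
    calc _ ≤ ∑ j : Fin 3, 4 * V * ‖z 0‖ ^ 2 := by
          gcongr with j
          exact (hterm j _).trans (by gcongr; exact hV j)
      _ = _ := by simp; ring
  linarith

/-- The energy at the frequency `n`. -/
def energy (p : Fin 3 → ℝ) (n : Fin 3 → ℤ) (z z' : Fin 4 → ℂ) (τ : ℝ) : ℝ :=
  ∑ μ, (‖z' μ‖ ^ 2 + (1 + ∑ i, (n i : ℝ) ^ 2 * Real.exp (-2 * (1 - p i) * τ)) * ‖z μ‖ ^ 2)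

/-- The products of z and z' weighted by 1 + V cancel, and V is non-increasing because p_i ≤ 1. What
remains costs 2E, and the coupling costs at most 12E, independently of the frequency. -/
lemma ModeSolution.exists_energy_deriv {z z' : Fin 4 → (Fin 3 → ℤ) → ℝ → ℂ}
    (hz : ModeSolution p z z') (hsq : ∑ i, p i ^ 2 = 1) (n : Fin 3 → ℤ) (τ : ℝ) :
    ∃ E', HasDerivAt (fun s => energy p n (fun μ => z μ n s) (fun μ => z' μ n s) s) E' τ ∧
      E' ≤ 14 * energy p n (fun μ => z μ n τ) (fun μ => z' μ n τ) τ := by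
  set V : ℝ → ℝ := fun s => ∑ i, (n i : ℝ) ^ 2 * Real.exp (-2 * (1 - p i) * s) with hV
  set V' : ℝ := ∑ i, (n i : ℝ) ^ 2 * (Real.exp (-2 * (1 - p i) * τ) * (-2 * (1 - p i)))
  have hVd : HasDerivAt V V' τ := by
    refine HasDerivAt.fun_sum fun i _ => HasDerivAt.const_mul _ ?_
    simpa using ((hasDerivAt_id τ).const_mul (-2 * (1 - p i))).exp
  have hV' : V' ≤ 0 := by
    refine Finset.sum_nonpos fun i _ => ?_
    have h1 := (abs_le.1 (abs_le_one_of_sum_sq hsq i)).2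
    have h2 : 0 ≤ (n i : ℝ) ^ 2 * Real.exp (-2 * (1 - p i) * τ) := by positivity
    nlinarith
  have hV0 : 0 ≤ V τ := Finset.sum_nonneg fun i _ => by positivity
  set off : Fin 4 → ℂ := (Fin.cons (∑ i : Fin 3, ((2 * p i * Real.exp (-(1 - p i) * τ) : ℝ) : ℂ) *
        ((Complex.I * n i) * z i.succ n τ))
      (fun j : Fin 3 => ((2 * p j * Real.exp (-(1 - p j) * τ) : ℝ) : ℂ) *
        ((Complex.I * n j) * z 0 n τ)) : Fin 4 → ℂ) with hoff
  have hmode : ∀ μ, modeOp p n τ (fun ν => z ν n τ) μ = -((V τ : ℝ) : ℂ) * z μ n τ + off μ := by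
    intro μ
    unfold modeOp
    congr 1
    simp only [hV]
    push_cast
    rw [← Finset.sum_neg_distrib, Finset.sum_mul]
    refine Finset.sum_congr rfl fun i _ => ?_
    linear_combination (Complex.exp (-2 * (1 - (p i : ℂ)) * τ) * n i ^ 2 * z μ n τ) * Complex.I_sq
  have hterm : ∀ μ, HasDerivAt (fun s => ‖z' μ n s‖ ^ 2 + (1 + V s) * ‖z μ n s‖ ^ 2)
      (2 * inner ℝ (z' μ n τ) (-2 * z' μ n τ - (1 - (wt p μ : ℂ) ^ 2) * z μ n τ
        + modeOp p n τ (fun ν => z ν n τ) μ) + (V' * ‖z μ n τ‖ ^ 2 +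
          (1 + V τ) * (2 * inner ℝ (z μ n τ) (z' μ n τ)))) τ := fun μ =>
    (hz.hasDerivAt' μ n τ).norm_sq.add ((hVd.const_add 1).mul (hz.hasDerivAt μ n τ).norm_sq)
  refine ⟨_, HasDerivAt.fun_sum fun μ _ => hterm μ, ?_⟩
  have hle : ∀ μ, (2 * inner ℝ (z' μ n τ) (-2 * z' μ n τ - (1 - (wt p μ : ℂ) ^ 2) * z μ n τ
        + modeOp p n τ (fun ν => z ν n τ) μ) + (V' * ‖z μ n τ‖ ^ 2 +
          (1 + V τ) * (2 * inner ℝ (z μ n τ) (z' μ n τ)))) ≤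
      2 * (‖z' μ n τ‖ ^ 2 + (1 + V τ) * ‖z μ n τ‖ ^ 2) + ‖off μ‖ ^ 2 := by
    intro μ
    have he : wt p μ ^ 2 ≤ 1 := by
      refine Fin.cases ?_ (fun i => ?_) μ
      · simp [wt]
      · have := abs_le_one_of_sum_sq hsq i
        simp only [wt, Fin.cons_succ]
        rw [← sq_abs]; nlinarith [abs_nonneg (p i)]
    have e1 : -2 * z' μ n τ - (1 - (wt p μ : ℂ) ^ 2) * z μ n τ
        + modeOp p n τ (fun ν => z ν n τ) μ =
        (-2 : ℝ) • z' μ n τ - (1 - wt p μ ^ 2 + V τ) • z μ n τ + off μ := by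
      rw [hmode]
      simp only [Complex.real_smul]
      push_cast; ring
    rw [e1, inner_add_right, inner_sub_right, real_inner_smul_right, real_inner_smul_right,
      real_inner_self_eq_norm_sq, real_inner_comm (z' μ n τ) (z μ n τ)]
    have h1 := abs_le.1 (abs_real_inner_le_norm (z' μ n τ) (z μ n τ))
    have h2 := (abs_le.1 (abs_real_inner_le_norm (z' μ n τ) (off μ))).2
    have h3 : wt p μ ^ 2 * inner ℝ (z' μ n τ) (z μ n τ) ≤ ‖z' μ n τ‖ * ‖z μ n τ‖ := by
      have h4 : 0 ≤ ‖z' μ n τ‖ * ‖z μ n τ‖ := by positivity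
      nlinarith [sq_nonneg (wt p μ)]
    have h5 : V' * ‖z μ n τ‖ ^ 2 ≤ 0 := mul_nonpos_of_nonpos_of_nonneg hV' (sq_nonneg _)
    have h6 : 0 ≤ V τ * ‖z μ n τ‖ ^ 2 := by positivity
    nlinarith [sq_nonneg (‖z' μ n τ‖ - ‖z μ n τ‖), sq_nonneg (‖z' μ n τ‖ - ‖off μ‖),
      sq_nonneg ‖z' μ n τ‖]
  refine (Finset.sum_le_sum fun μ _ => hle μ).trans ?_
  rw [Finset.sum_add_distrib, ← Finset.mul_sum]
  have h7 := norm_off_sq_le n τ hsq fun ν => z ν n τ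
  have h8 : V τ * ∑ μ, ‖z μ n τ‖ ^ 2 ≤ energy p n (fun μ => z μ n τ) (fun μ => z' μ n τ) τ := by
    rw [energy, Finset.mul_sum]
    exact Finset.sum_le_sum fun μ _ => by nlinarith [sq_nonneg ‖z' μ n τ‖, sq_nonneg ‖z μ n τ‖]
  have h9 : energy p n (fun μ => z μ n τ) (fun μ => z' μ n τ) τ =
    ∑ μ, (‖z' μ n τ‖ ^ 2 + (1 + V τ) * ‖z μ n τ‖ ^ 2) := rfl
  rw [← h9]
  have h10 : ∑ μ, ‖off μ‖ ^ 2 ≤ 12 * (V τ * ∑ μ, ‖z μ n τ‖ ^ 2) := by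
    rw [← mul_assoc]; exact h7
  linarith

lemma ModeSolution.energy_le {z z' : Fin 4 → (Fin 3 → ℤ) → ℝ → ℂ}
    (hz : ModeSolution p z z') (hsq : ∑ i, p i ^ 2 = 1) (n : Fin 3 → ℤ) {τ : ℝ} (hτ : 0 ≤ τ) :
    energy p n (fun μ => z μ n τ) (fun μ => z' μ n τ) τ ≤
      energy p n (fun μ => z μ n 0) (fun μ => z' μ n 0) 0 * Real.exp (14 * τ) := by
  choose E' hE hE' using hz.exists_energy_deriv hsq n
  set E : ℝ → ℝ := fun s => energy p n (fun μ => z μ n s) (fun μ => z' μ n s) s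
  have hd : ∀ s, HasDerivAt (fun s => E s * Real.exp (-14 * s))
      (E' s * Real.exp (-14 * s) + E s * (Real.exp (-14 * s) * (-14))) s := fun s => by
    have h1 : HasDerivAt (fun s : ℝ => Real.exp (-14 * s)) (Real.exp (-14 * s) * (-14)) s := by
      simpa using ((hasDerivAt_id s).const_mul (-14)).exp
    exact (hE s).mul h1
  have hanti : Antitone fun s => E s * Real.exp (-14 * s) :=
    antitone_of_hasDerivAt_nonpos hd fun s => by
      have := hE' s
      have := Real.exp_pos (-14 * s)
      simp only [Pi.zero_apply]
      nlinarith
  have h2 := hanti hτ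
  simp only [mul_zero, Real.exp_zero, mul_one] at h2
  have h3 : Real.exp (14 * τ) = (Real.exp (-14 * τ))⁻¹ := by rw [← Real.exp_neg]; congr 1; ring
  rw [h3, ← div_eq_mul_inv, le_div_iff₀ (Real.exp_pos _)]
  exact h2

/-- Energy growth e^{14τ} means growth e^{7τ} of the amplitudes. The rate is crude, but it is
uniform in the frequency and serves only as a starting point. At τ = 0 the energy contains (1 +
|n|²)|z|², which is why the data are used with weight m + 1. -/
lemma ModeSolution.rapidO {z z' : Fin 4 → (Fin 3 → ℤ) → ℝ → ℂ}
    (hz : ModeSolution p z z') (hsq : ∑ i, p i ^ 2 = 1) (μ : Fin 4) :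
    RapidO (z μ) (decay (-7)) ∧ RapidO (z' μ) (decay (-7)) := by
  have key : ∀ m : ℕ, ∃ C, 0 ≤ C ∧ ∀ n τ, 0 ≤ τ → wgt n ^ m * ‖z μ n τ‖ ≤ C * decay (-7) τ ∧
      wgt n ^ m * ‖z' μ n τ‖ ≤ C * decay (-7) τ := by
    intro m
    choose C hC using fun ν => hz.rapid ν (m + 1)
    choose C' hC' using fun ν => hz.rapid' ν (m + 1)
    set K := ∑ ν, (C' ν ^ 2 + C ν ^ 2)
    have hK : 0 ≤ K := Finset.sum_nonneg fun ν _ => by positivity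
    refine ⟨Real.sqrt K, Real.sqrt_nonneg _, fun n τ hτ => ?_⟩
    have hw := one_le_wgt n
    have hw0 := wgt_pos n
    have h0 : (wgt n ^ m) ^ 2 * energy p n (fun μ => z μ n 0) (fun μ => z' μ n 0) 0 ≤ K := by
      rw [energy, Finset.mul_sum]
      refine Finset.sum_le_sum fun ν _ => ?_
      have h1 : 1 + ∑ i, (n i : ℝ) ^ 2 * Real.exp (-2 * (1 - p i) * 0) = wgt n := by simp [wgt]
      rw [h1]
      have h2 : (wgt n ^ (m + 1) * ‖z ν n 0‖) ^ 2 ≤ C ν ^ 2 :=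
        pow_le_pow_left₀ (by positivity) (hC ν n) 2
      have h3 : (wgt n ^ (m + 1) * ‖z' ν n 0‖) ^ 2 ≤ C' ν ^ 2 :=
        pow_le_pow_left₀ (by positivity) (hC' ν n) 2
      have h4 : (wgt n ^ m) ^ 2 * wgt n ≤ (wgt n ^ (m + 1)) ^ 2 := by
        rw [show (wgt n ^ (m + 1)) ^ 2 = (wgt n ^ m) ^ 2 * wgt n * wgt n by ring]
        exact le_mul_of_one_le_right (by positivity) hw
      have h5 : (wgt n ^ m) ^ 2 ≤ (wgt n ^ (m + 1)) ^ 2 := by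
        exact pow_le_pow_left₀ (by positivity) (pow_le_pow_right₀ hw (Nat.le_succ m)) 2
      calc (wgt n ^ m) ^ 2 * (‖z' ν n 0‖ ^ 2 + wgt n * ‖z ν n 0‖ ^ 2)
          = (wgt n ^ m) ^ 2 * ‖z' ν n 0‖ ^ 2 + (wgt n ^ m) ^ 2 * wgt n * ‖z ν n 0‖ ^ 2 := by ring
        _ ≤ (wgt n ^ (m + 1)) ^ 2 * ‖z' ν n 0‖ ^ 2 + (wgt n ^ (m + 1)) ^ 2 * ‖z ν n 0‖ ^ 2 := by
          gcongr
        _ ≤ _ := by rw [← mul_pow, ← mul_pow]; linarith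
    have hbd : ∀ a : ℝ, 0 ≤ a →
        a ^ 2 ≤ energy p n (fun μ => z μ n τ) (fun μ => z' μ n τ) τ →
        wgt n ^ m * a ≤ Real.sqrt K * decay (-7) τ := by
      intro a ha hle
      have h6 := hle.trans (hz.energy_le hsq n hτ)
      have h7 : (wgt n ^ m * a) ^ 2 ≤ K * decay (-7) τ ^ 2 := by
        have h8 : decay (-7) τ ^ 2 = Real.exp (14 * τ) := by
          rw [sq, decay_mul, decay]; congr 1; ring
        rw [h8, mul_pow]
        calc _ ≤ (wgt n ^ m) ^ 2 * (energy p n (fun μ => z μ n 0) (fun μ => z' μ n 0) 0 *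
              Real.exp (14 * τ)) := by gcongr
          _ = (wgt n ^ m) ^ 2 * energy p n (fun μ => z μ n 0) (fun μ => z' μ n 0) 0 *
              Real.exp (14 * τ) := by ring
          _ ≤ _ := by gcongr
      have h9 := Real.sqrt_le_sqrt h7
      rwa [Real.sqrt_sq (by positivity), Real.sqrt_mul hK, Real.sqrt_sq (decay_pos _ _).le] at h9
    have hV0 : 0 ≤ ∑ i, (n i : ℝ) ^ 2 * Real.exp (-2 * (1 - p i) * τ) :=
      Finset.sum_nonneg fun i _ => by positivity
    have hsingle : ‖z' μ n τ‖ ^ 2 + (1 + ∑ i, (n i : ℝ) ^ 2 * Real.exp (-2 * (1 - p i) * τ)) *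
        ‖z μ n τ‖ ^ 2 ≤ energy p n (fun μ => z μ n τ) (fun μ => z' μ n τ) τ :=
      Finset.single_le_sum (f := fun μ => ‖z' μ n τ‖ ^ 2 +
        (1 + ∑ i, (n i : ℝ) ^ 2 * Real.exp (-2 * (1 - p i) * τ)) * ‖z μ n τ‖ ^ 2)
        (fun ν _ => by positivity) (Finset.mem_univ μ)
    constructor
    · refine hbd _ (norm_nonneg _) (le_trans ?_ hsingle)
      nlinarith [sq_nonneg ‖z' μ n τ‖, sq_nonneg ‖z μ n τ‖]
    · refine hbd _ (norm_nonneg _) (le_trans ?_ hsingle)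
      nlinarith [sq_nonneg ‖z' μ n τ‖, sq_nonneg ‖z μ n τ‖]
  constructor
  · intro m
    obtain ⟨C, _, h⟩ := key m
    exact ⟨C, fun n τ hτ => (h n τ hτ).1⟩
  · intro m
    obtain ⟨C, _, h⟩ := key m
    exact ⟨C, fun n τ hτ => (h n τ hτ).2⟩

end

open ExpPoly

/-! ### Kasner exponents -/

/-- Ordered exponents of a non-flat Kasner spacetime. -/
structure IsKasner (p : Fin 3 → ℝ) : Prop where
  mono : Monotone p
  sum : ∑ i, p i = 1
  sum_sq : ∑ i, p i ^ 2 = 1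
  lt_one : p 2 < 1

namespace IsKasner

variable {p : Fin 3 → ℝ} (hp : IsKasner p)

include hp

lemma sum' : p 0 + p 1 + p 2 = 1 := by simpa [Fin.sum_univ_three] using hp.sum

lemma sum_sq' : p 0 ^ 2 + p 1 ^ 2 + p 2 ^ 2 = 1 := by simpa [Fin.sum_univ_three] using hp.sum_sq

lemma le_two (i : Fin 3) : p i ≤ p 2 := hp.mono (Fin.le_last i)

lemma gap_pos : 0 < 1 - p 2 := by linarith [hp.lt_one]

/-- If `p 1 ≤ 0`, then also `p 0 ≤ 0`, and the sum condition forces `p 2 ≥ 1`. -/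
lemma one_lt : 0 < p 1 := by
  have h1 := hp.sum'
  have h2 := hp.sum_sq'
  have h3 := hp.lt_one
  have h4 : p 0 ≤ p 1 := hp.mono (by decide)
  nlinarith

/-- Otherwise all exponents lie in [0, 1) and, `p 1` being positive, the sum of the squares is
smaller than the sum. -/
lemma zero_neg : p 0 < 0 := by
  have h1 := hp.sum'
  have h2 := hp.sum_sq'
  have h3 := hp.lt_one
  have h5 := hp.one_lt
  have h4 : p 1 ≤ p 2 := hp.mono (by decide)
  nlinarith

lemma zero_add_two_pos : 0 < p 0 + p 2 := by
  have h1 := hp.sum'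
  have h3 := hp.lt_one
  have h4 : p 1 ≤ p 2 := hp.mono (by decide)
  linarith

lemma pos_of_ne {i : Fin 3} (hi : i ≠ 0) : 0 < p i :=
  hp.one_lt.trans_le (hp.mono (by omega))

lemma ne_zero (i : Fin 3) : p i ≠ 0 := by
  by_cases hi : i = 0
  · subst hi; exact hp.zero_neg.ne
  · exact (hp.pos_of_ne hi).ne'

lemma neg_one_lt (i : Fin 3) : -1 < p i := by
  have h1 : p 0 ≤ p i := hp.mono (Fin.zero_le i)
  have := hp.zero_add_two_pos
  have := hp.lt_one
  linarith

lemma lt_one' (i : Fin 3) : p i < 1 := (hp.le_two i).trans_lt hp.lt_one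

lemma eig_nonpos (κ : DataIndex) : eig p κ ≤ 0 := by
  obtain ⟨μ, σ⟩ := κ
  refine Fin.cases ?_ (fun i => ?_) μ
  · cases σ <;> simp [eig, wt]
  · have := hp.neg_one_lt i
    have := hp.lt_one' i
    cases σ <;> simp [eig, wt] <;> linarith

lemma neg_two_le_eig (κ : DataIndex) : -2 ≤ eig p κ := by
  obtain ⟨μ, σ⟩ := κ
  refine Fin.cases ?_ (fun i => ?_) μ
  · cases σ <;> simp only [eig, wt, Fin.cons_zero] <;> norm_num
  · have := hp.neg_one_lt i
    have := hp.lt_one' i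
    cases σ <;> simp [eig, wt] <;> linarith

/-- Twice this number is the difference of the two eigenvalues of the block, so every block is
diagonalizable. -/
lemma wt_ne_zero (μ : Fin 4) : wt p μ ≠ 0 := by
  refine Fin.cases ?_ (fun i => ?_) μ
  · simp [wt]
  · simpa [wt] using hp.ne_zero i

end IsKasner

lemma eig_true (p : Fin 3 → ℝ) (μ : Fin 4) : eig p (μ, true) = -1 + wt p μ := by simp [eig]

lemma eig_false (p : Fin 3 → ℝ) (μ : Fin 4) : eig p (μ, false) = -1 - wt p μ := by simp [eig]

/-! ### The formal equation -/

/-- The spatial derivative terms of the system, acting on formal series. -/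
def opD (p : Fin 3 → ℝ) (Z : Fin 4 → ExpPoly) (μ : Fin 4) : ExpPoly :=
  (∑ i, ((MvPolynomial.X i * MvPolynomial.X i : Op)) • shift (2 * (1 - p i)) (Z μ)) +
    (Fin.cons (∑ i : Fin 3, (2 * p i) • (MvPolynomial.X i : Op) • shift (1 - p i) (Z i.succ))
      (fun j : Fin 3 => (2 * p j) • (MvPolynomial.X j : Op) • shift (1 - p j) (Z 0)) :
        Fin 4 → ExpPoly) μ

lemma opD_zero_comp (p : Fin 3 → ℝ) (Z : Fin 4 → ExpPoly) : opD p Z 0 =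
    (∑ i, ((MvPolynomial.X i * MvPolynomial.X i : Op)) • shift (2 * (1 - p i)) (Z 0)) +
      ∑ i : Fin 3, (2 * p i) • (MvPolynomial.X i : Op) • shift (1 - p i) (Z i.succ) := rfl

lemma opD_succ_comp (p : Fin 3 → ℝ) (Z : Fin 4 → ExpPoly) (j : Fin 3) : opD p Z j.succ =
    (∑ i, ((MvPolynomial.X i * MvPolynomial.X i : Op)) • shift (2 * (1 - p i)) (Z j.succ)) +
      (2 * p j) • (MvPolynomial.X j : Op) • shift (1 - p j) (Z 0) := rfl

lemma opD_sub (p : Fin 3 → ℝ) (Y Z : Fin 4 → ExpPoly) (μ : Fin 4) :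
    opD p (Y - Z) μ = opD p Y μ - opD p Z μ := by
  refine Fin.cases ?_ (fun j => ?_) μ
  · simp only [opD_zero_comp, Pi.sub_apply, map_sub, smul_sub, Finset.sum_sub_distrib]
    abel
  · simp only [opD_succ_comp, Pi.sub_apply, map_sub, smul_sub, Finset.sum_sub_distrib]
    abel

lemma opD_zero (p : Fin 3 → ℝ) (μ : Fin 4) : opD p 0 μ = 0 := by
  have := opD_sub p 0 0 μ
  rwa [sub_self, sub_self] at this

lemma real_smul_mem {N : Submodule Op ExpPoly} (c : ℝ) {Z : ExpPoly} (hZ : Z ∈ N) : c • Z ∈ N :=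
  Submodule.smul_of_tower_mem N c hZ

lemma opD_mem_of {p : Fin 3 → ℝ} {S : Fin 4 → Set ℝ} {T : Set ℝ} {Z : Fin 4 → ExpPoly} {μ : Fin 4}
    (hZ : ∀ ν, Z ν ∈ expIn (S ν)) (hlap : ∀ i, ∀ b ∈ S μ, b + 2 * (1 - p i) ∈ T)
    (h0 : μ = 0 → ∀ i : Fin 3, ∀ b ∈ S i.succ, b + (1 - p i) ∈ T)
    (hs : ∀ j : Fin 3, μ = j.succ → ∀ b ∈ S 0, b + (1 - p j) ∈ T) : opD p Z μ ∈ expIn T := by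
  refine Submodule.add_mem _ (Submodule.sum_mem _ fun i _ => Submodule.smul_mem _ _
    (shift_mem (hlap i) (hZ μ))) ?_
  revert h0 hs
  refine Fin.cases (fun h0 _ => ?_) (fun j _ hs => ?_) μ
  · rw [Fin.cons_zero]
    exact Submodule.sum_mem _ fun i _ => real_smul_mem _ (Submodule.smul_mem _ _
      (shift_mem (h0 rfl i) (hZ _)))
  · rw [Fin.cons_succ]
    exact real_smul_mem _ (Submodule.smul_mem _ _ (shift_mem (hs j rfl) (hZ _)))

/-- Since `p 2` is the largest exponent, 1 - `p 2` is the slowest decay among the coefficients of D;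
this is the gain in each iteration. -/
lemma opD_mem_Ici {p : Fin 3 → ℝ} (hp : IsKasner p) {Z : Fin 4 → ExpPoly} {b : ℝ}
    (hZ : ∀ ν, Z ν ∈ expIn (Set.Ici b)) (μ : Fin 4) :
    opD p Z μ ∈ expIn (Set.Ici (b + (1 - p 2))) := by
  have h1 : ∀ i, ∀ c ∈ Set.Ici b, c + (1 - p i) ∈ Set.Ici (b + (1 - p 2)) := fun i c hc => by
    have := hp.le_two i
    simp only [Set.mem_Ici] at hc ⊢
    linarith
  refine opD_mem_of hZ (fun i c hc => ?_) (fun _ i => h1 i) (fun j _ => h1 j)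
  have := h1 i c hc
  have := hp.lt_one' i
  simp only [Set.mem_Ici] at *
  linarith

/-- A right inverse of `∂² + 2 ∂ + (1 - e_μ²) = (∂ - λ_{μ,+}) (∂ - λ_{μ,-})`. -/
def solve (p : Fin 3 → ℝ) (μ : Fin 4) : ExpPoly →ₗ[Op] ExpPoly :=
  (prim (eig p (μ, true))).comp (prim (eig p (μ, false)))

lemma solve_mem (p : Fin 3 → ℝ) (μ : Fin 4) {S : Set ℝ} {Z : ExpPoly} (hZ : Z ∈ expIn S) :
    solve p μ Z ∈ expIn S := by
  rw [solve, LinearMap.comp_apply]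
  exact prim_mem _ (prim_mem _ hZ)

lemma dSub_solve (p : Fin 3 → ℝ) (μ : Fin 4) (σ : Bool) (Z : ExpPoly) :
    dSub (eig p (μ, σ)) (dSub (eig p (μ, !σ)) (solve p μ Z)) = Z := by
  have h : dSub (eig p (μ, false)) (dSub (eig p (μ, true)) (solve p μ Z)) = Z := by
    simp only [solve, LinearMap.comp_apply, dSub_prim]
  cases σ
  · exact h
  · rw [dSub_comm]; exact h

lemma dSub_mono_zero (lam b : ℝ) : dSub lam (mono b 0) = (-b - lam) • mono b 0 := by
  rw [dSub_apply, dτ_mono, Nat.cast_zero, zero_smul, add_zero, ← sub_smul]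

/-- The homogeneous solution with index `κ`. -/
def homSol (p : Fin 3 → ℝ) (κ : DataIndex) (μ : Fin 4) : ExpPoly :=
  if μ = κ.1 then mono (-eig p κ) 0 else 0

lemma homSol_eq_sum (p : Fin 3 → ℝ) (κ : DataIndex) (μ : Fin 4) : homSol p κ μ =
    ∑ σ : Bool, (if (μ, σ) = κ then (1 : Op) else 0) • mono (-eig p (μ, σ)) 0 := by
  obtain ⟨ν, ρ⟩ := κ
  by_cases h : μ = ν
  · subst h
    cases ρ <;> simp [homSol]
  · simp [homSol, h]

lemma homSol_mem (p : Fin 3 → ℝ) (κ : DataIndex) (μ : Fin 4) :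
    homSol p κ μ ∈ expIn {-eig p κ} := by
  unfold homSol
  split_ifs
  · exact mono_mem_expIn (Set.mem_singleton _) 0
  · exact Submodule.zero_mem _

lemma dSub_homSol (p : Fin 3 → ℝ) (κ : DataIndex) (μ : Fin 4) (σ : Bool) :
    dSub (eig p (μ, σ)) (dSub (eig p (μ, !σ)) (homSol p κ μ)) = 0 := by
  have h : dSub (eig p (μ, false)) (dSub (eig p (μ, true)) (homSol p κ μ)) = 0 := by
    rw [homSol_eq_sum, Fintype.sum_bool]
    simp only [map_add, map_smul, dSub_mono_zero, LinearMap.map_smul_of_tower]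
    simp
  cases σ
  · exact h
  · rw [dSub_comm]; exact h

/-- The iterates of the formal equation, starting from the homogeneous solution `κ`. -/
def series (p : Fin 3 → ℝ) : ℕ → DataIndex → Fin 4 → ExpPoly
  | 0 => 0
  | n + 1 => fun κ μ => homSol p κ μ + solve p μ (opD p (series p n κ) μ)

lemma series_succ (p : Fin 3 → ℝ) (n : ℕ) (κ : DataIndex) (μ : Fin 4) :
    series p (n + 1) κ μ = homSol p κ μ + solve p μ (opD p (series p n κ) μ) := rfl

lemma dSub_series (p : Fin 3 → ℝ) (n : ℕ) (κ : DataIndex) (μ : Fin 4) (σ : Bool) :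
    dSub (eig p (μ, σ)) (dSub (eig p (μ, !σ)) (series p (n + 1) κ μ)) =
      opD p (series p n κ) μ := by
  rw [series_succ, map_add, map_add, dSub_homSol, dSub_solve, zero_add]

section

variable {p : Fin 3 → ℝ} (hp : IsKasner p)

include hp

lemma series_mem_Ici (n : ℕ) (κ : DataIndex) (μ : Fin 4) :
    series p n κ μ ∈ expIn (Set.Ici (-eig p κ)) := by
  induction n generalizing μ with
  | zero => exact Submodule.zero_mem _
  | succ n ih =>
    refine Submodule.add_mem _ (expIn_mono (by simp) (homSol_mem p κ μ)) (solve_mem _ _ ?_)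
    refine expIn_mono (Set.Ici_subset_Ici.2 ?_) (opD_mem_Ici hp ih μ)
    have := hp.gap_pos
    linarith

lemma series_sub_homSol_mem (n : ℕ) (κ : DataIndex) (μ : Fin 4) :
    series p (n + 1) κ μ - homSol p κ μ ∈ expIn (Set.Ici (-eig p κ + (1 - p 2))) := by
  rw [series_succ, add_sub_cancel_left]
  exact solve_mem _ _ (opD_mem_Ici hp (series_mem_Ici hp n κ) μ)

/-- Differences of consecutive iterates obey the recursion without the homogeneous term. Each step
raises the exponents by the gap, so the coefficient of a given exponent is eventually constant. -/
lemma series_succ_sub_mem (n : ℕ) (κ : DataIndex) (μ : Fin 4) :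
    series p (n + 1) κ μ - series p n κ μ ∈ expIn (Set.Ici (n * (1 - p 2))) := by
  induction n generalizing μ with
  | zero =>
    refine expIn_mono (Set.Ici_subset_Ici.2 ?_)
      (Submodule.sub_mem _ (series_mem_Ici hp 1 κ μ) (Submodule.zero_mem _))
    have := hp.eig_nonpos κ
    simp only [Nat.cast_zero, zero_mul]
    linarith
  | succ n ih =>
    rw [series_succ, series_succ p n, add_sub_add_left_eq_sub, ← map_sub, ← opD_sub]
    have := opD_mem_Ici hp (Z := series p (n + 1) κ - series p n κ) ih μ
    refine solve_mem _ _ (expIn_mono (Set.Ici_subset_Ici.2 (le_of_eq ?_)) this)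
    push_cast; ring

lemma series_sub_mem {n m : ℕ} (h : n ≤ m) (κ : DataIndex) (μ : Fin 4) :
    series p m κ μ - series p n κ μ ∈ expIn (Set.Ici (n * (1 - p 2))) := by
  induction m, h using Nat.le_induction with
  | base => rw [sub_self]; exact Submodule.zero_mem _
  | succ m hm ih =>
    rw [← sub_add_sub_cancel _ (series p m κ μ)]
    refine Submodule.add_mem _ (expIn_mono (Set.Ici_subset_Ici.2 ?_)
      (series_succ_sub_mem hp m κ μ)) ih
    have h1 : (n : ℝ) ≤ m := by exact_mod_cast hm
    exact mul_le_mul_of_nonneg_right h1 hp.gap_pos.le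

end

/-! ### Exponents and leading coefficients -/

/-- The exponents of the `μ`-th component. -/
def expSet (p : Fin 3 → ℝ) (μ : Fin 4) : Set ℝ :=
  {b | ∃ s ∈ ({1 - wt p μ, 1 + wt p μ, 3 - wt p μ} : Set ℝ), ∃ m : Fin 3 → ℕ,
    b = s + ∑ i, 2 * m i * (1 - p i)}

lemma mem_expSet_of {p : Fin 3 → ℝ} {μ : Fin 4} {s : ℝ}
    (hs : s ∈ ({1 - wt p μ, 1 + wt p μ, 3 - wt p μ} : Set ℝ)) (m : Fin 3 → ℕ) :
    s + ∑ i, 2 * m i * (1 - p i) ∈ expSet p μ := ⟨s, hs, m, rfl⟩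

lemma sum_add_single (p : Fin 3 → ℝ) (m : Fin 3 → ℕ) (i : Fin 3) :
    ∑ l, 2 * ((m + Pi.single i 1 : Fin 3 → ℕ) l : ℝ) * (1 - p l) =
      ∑ l, 2 * m l * (1 - p l) + 2 * (1 - p i) := by
  simp only [Pi.add_apply, Nat.cast_add, mul_add, add_mul, Finset.sum_add_distrib]
  congr 1
  rw [Finset.sum_eq_single i]
  · simp
  · intro l _ hl; simp [hl]
  · simp

lemma expSet_add {p : Fin 3 → ℝ} {μ : Fin 4} {b : ℝ} (hb : b ∈ expSet p μ) (i : Fin 3) :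
    b + 2 * (1 - p i) ∈ expSet p μ := by
  obtain ⟨s, hs, m, rfl⟩ := hb
  rw [add_assoc, ← sum_add_single]
  exact mem_expSet_of hs _

/-- The families 1 ∓ e_μ are the homogeneous exponents, shifted by the Laplacian through multiples
of 2(1 - p_i). The coupling maps 1 - p_i, 1 + p_i, 3 - p_i to 2(1 - p_i), 2, 2 + 2(1 - p_i) in
component 0, and 0, 2 back to 1 - p_j, 3 - p_j. The third family is what closes this system. -/
lemma series_mem_expSet (p : Fin 3 → ℝ) (n : ℕ) (κ : DataIndex) (μ : Fin 4) :
    series p n κ μ ∈ expIn (expSet p μ) := by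
  induction n generalizing μ with
  | zero => exact Submodule.zero_mem _
  | succ n ih =>
    refine Submodule.add_mem _ ?_ (solve_mem _ _ (opD_mem_of ih (fun i b hb => expSet_add hb i)
      ?_ ?_))
    · unfold homSol
      split_ifs with h
      · refine mono_mem_expIn ?_ 0
        obtain ⟨ν, σ⟩ := κ
        simp only at h
        subst h
        have := mem_expSet_of (p := p) (μ := μ) (s := -eig p (μ, σ))
          (by
            simp only [Set.mem_insert_iff]
            cases σ
            · rw [eig_false]; right; left; ring
            · rw [eig_true]; left; ring) 0
        simpa using this
      · exact Submodule.zero_mem _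
    · rintro rfl i b ⟨s, hs, m, rfl⟩
      simp only [wt, Fin.cons_succ, Set.mem_insert_iff, Set.mem_singleton_iff] at hs
      rcases hs with rfl | rfl | rfl
      · have := mem_expSet_of (p := p) (μ := 0) (s := 0) (by simp [wt]) (m + Pi.single i 1)
        rw [sum_add_single] at this
        convert this using 1; ring
      · have := mem_expSet_of (p := p) (μ := 0) (s := 2) (by simp [wt]; norm_num) m
        convert this using 1; ring
      · have := mem_expSet_of (p := p) (μ := 0) (s := 2) (by simp [wt]; norm_num)
          (m + Pi.single i 1)
        rw [sum_add_single] at this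
        convert this using 1; ring
    · rintro j rfl b ⟨s, hs, m, rfl⟩
      have hs' : s = 0 ∨ s = 2 := by
        simp only [wt, Fin.cons_zero, Set.mem_insert_iff, Set.mem_singleton_iff] at hs
        rcases hs with rfl | rfl | rfl
        · left; norm_num
        · right; norm_num
        · right; norm_num
      rcases hs' with rfl | rfl
      · have := mem_expSet_of (p := p) (μ := j.succ) (s := 1 - p j) (by simp [wt]) m
        convert this using 1; ring
      · have := mem_expSet_of (p := p) (μ := j.succ) (s := 3 - p j) (by simp [wt]) m
        convert this using 1; ring

/-- The smallest exponent of the `μ`-th component. -/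
def leadExp (p : Fin 3 → ℝ) : Fin 4 → ℝ :=
  Fin.cons 0 fun i => if i = 0 then 1 + p 0 else 1 - p i

section

variable {p : Fin 3 → ℝ} (hp : IsKasner p)

include hp

lemma sum_exp_nonneg (m : Fin 3 → ℕ) : 0 ≤ ∑ i, 2 * (m i : ℝ) * (1 - p i) :=
  Finset.sum_nonneg fun i _ => by
    have := hp.lt_one' i
    have : 0 < 1 - p i := by linarith
    positivity

/-- The sign of p_i decides which of 1 - p_i and 1 + p_i is smaller, and only `p 0` is negative. -/
lemma leadExp_le {μ : Fin 4} {b : ℝ} (hb : b ∈ expSet p μ) : leadExp p μ ≤ b := by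
  obtain ⟨s, hs, m, rfl⟩ := hb
  have h0 := sum_exp_nonneg hp m
  suffices leadExp p μ ≤ s by linarith
  revert hs
  refine Fin.cases ?_ (fun i => ?_) μ
  · simp only [leadExp, wt, Fin.cons_zero, Set.mem_insert_iff, Set.mem_singleton_iff]
    rintro (rfl | rfl | rfl) <;> norm_num
  · simp only [leadExp, wt, Fin.cons_succ, Set.mem_insert_iff, Set.mem_singleton_iff]
    by_cases hi : i = 0
    · subst hi
      have := hp.zero_neg
      rintro (rfl | rfl | rfl) <;> simp <;> linarith
    · have := hp.pos_of_ne hi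
      rintro (rfl | rfl | rfl) <;> simp [hi]
      linarith

lemma leadExp_succ_pos (i : Fin 3) : 0 < leadExp p i.succ := by
  simp only [leadExp, Fin.cons_succ]
  have := hp.neg_one_lt 0
  have := hp.lt_one' i
  split_ifs <;> linarith

/-- All exponents are nonnegative and D strictly raises those which reach component 0, so exponent 0
comes from the homogeneous solution with eigenvalue λ_{0,+} = 0 alone. -/
lemma series_zero_lead (n : ℕ) (κ : DataIndex) :
    series p (n + 1) κ 0 - (if κ = (0, true) then (1 : Op) else 0) • mono 0 0 ∈
      expIn (Set.Ioi 0) := by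
  have h1 : homSol p κ 0 - (if κ = (0, true) then (1 : Op) else 0) • mono 0 0 ∈
      expIn (Set.Ioi (0 : ℝ)) := by
    rw [homSol_eq_sum, Fintype.sum_bool]
    have e : eig p (0, true) = 0 := by simp [eig, wt]
    have e' : eig p (0, false) = -2 := by simp [eig, wt]; norm_num
    rw [e, e']
    simp only [eq_comm (a := κ), neg_zero, neg_neg, add_sub_cancel_left]
    exact Submodule.smul_mem _ _ (mono_mem_expIn (by simp) 0)
  rw [series_succ, add_sub_right_comm]
  refine Submodule.add_mem _ h1 (solve_mem _ _ (opD_mem_of (series_mem_expSet p n κ)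
    (fun i b hb => ?_) (fun _ i b hb => ?_) (fun j hj => ?_)))
  · have h2 : (0 : ℝ) ≤ b := leadExp_le hp hb
    have := hp.lt_one' i
    simp only [Set.mem_Ioi]; linarith
  · have h2 := leadExp_le hp hb
    have := leadExp_succ_pos hp i
    have := hp.lt_one' i
    simp only [Set.mem_Ioi]; linarith
  · exact absurd hj (Fin.succ_ne_zero j).symm

lemma solve_lead {i : Fin 3} : solve p i.succ (mono (1 - p i) 0) =
    (2 * p i)⁻¹ • mono (1 - p i) 1 := by
  have h := hp.ne_zero i
  have e1 : eig p (i.succ, false) = -1 - p i := by simp [eig, wt]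
  have e2 : eig p (i.succ, true) = -(1 - p i) := by simp [eig, wt]; ring
  have h1 : 1 - p i + (-1 - p i) ≠ 0 := by
    intro h'; apply h; linarith
  rw [solve, LinearMap.comp_apply, e1, e2, prim_const h1, LinearMap.map_smul_of_tower]
  have h2 := prim_resonant_const (-(1 - p i))
  rw [neg_neg] at h2
  rw [h2]
  congr 1
  rw [← inv_neg]; congr 1; ring

/-- The constant limit of ω_τ enters D_i through 2p_i e^{-(1-p_i)τ} ∂_i, whose exponent is resonant
with λ_{i,+}. Solving produces a factor τ and the inverse of 2p_i, the difference of the eigenvalues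
(`solve_lead`). Two iterations are needed: one creates the constant, the next feeds it into
component i. -/
lemma series_succ_lead (n : ℕ) (κ : DataIndex) {i : Fin 3} (hi : i ≠ 0) :
    series p (n + 2) κ i.succ - ((if κ = (i.succ, true) then (1 : Op) else 0) • mono (1 - p i) 0
      + (if κ = (0, true) then (MvPolynomial.X i : Op) else 0) • mono (1 - p i) 1) ∈
      expIn (Set.Ioi (1 - p i)) := by
  have hpi := hp.pos_of_ne hi
  have hpi1 := hp.lt_one' i
  have h1 : homSol p κ i.succ - (if κ = (i.succ, true) then (1 : Op) else 0) • mono (1 - p i) 0 ∈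
      expIn (Set.Ioi (1 - p i)) := by
    rw [homSol_eq_sum, Fintype.sum_bool]
    have e1 : eig p (i.succ, false) = -(1 + p i) := by simp [eig, wt]; ring
    have e2 : eig p (i.succ, true) = -(1 - p i) := by simp [eig, wt]; ring
    rw [e1, e2]
    simp only [eq_comm (a := κ), neg_neg, add_sub_cancel_left]
    exact Submodule.smul_mem _ _ (mono_mem_expIn (by simp only [Set.mem_Ioi]; linarith) 0)
  have h2 : opD p (series p (n + 1) κ) i.succ -
      (if κ = (0, true) then (MvPolynomial.X i : Op) else 0) • (2 * p i) • mono (1 - p i) 0 ∈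
      expIn (Set.Ioi (1 - p i)) := by
    rw [opD_succ_comp, add_sub_assoc]
    refine Submodule.add_mem _ (Submodule.sum_mem _ fun l _ => Submodule.smul_mem _ _
      (shift_mem (fun b hb => ?_) (series_mem_expSet p (n + 1) κ i.succ))) ?_
    · have h3 := leadExp_le hp hb
      simp only [leadExp, Fin.cons_succ, hi, if_false] at h3
      have := hp.lt_one' l
      simp only [Set.mem_Ioi]; linarith
    · have h4 := shift_mem (c := 1 - p i) (T := Set.Ioi (1 - p i)) (fun b hb => by
        simp only [Set.mem_Ioi] at hb ⊢; linarith) (series_zero_lead hp n κ)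
      have h5 := real_smul_mem (2 * p i) (Submodule.smul_mem _ (MvPolynomial.X i : Op) h4)
      convert h5 using 1
      rw [map_sub, map_smul, shift_mono, zero_add, smul_sub, smul_sub]
      congr 1
      split_ifs
      · rw [one_smul, smul_comm]
      · simp
  rw [series_succ, add_sub_add_comm]
  refine Submodule.add_mem _ h1 ?_
  have h6 := solve_mem p i.succ h2
  rw [map_sub, map_smul, LinearMap.map_smul_of_tower, solve_lead hp, smul_smul,
    mul_inv_cancel₀ (by positivity), one_smul] at h6
  exact h6

/-- As `p 0` is negative, 1 + p_0 < 1 - p_0, and what ω_τ feeds into this component appears only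
from the exponent 1 - p_0 on. -/
lemma series_one_lead (n : ℕ) (κ : DataIndex) :
    series p (n + 1) κ (Fin.succ 0) -
      (if κ = (Fin.succ 0, false) then (1 : Op) else 0) • mono (1 + p 0) 0 ∈
      expIn (Set.Ioi (1 + p 0)) := by
  have hp0 := hp.zero_neg
  have h1 : homSol p κ (Fin.succ 0) -
      (if κ = (Fin.succ 0, false) then (1 : Op) else 0) • mono (1 + p 0) 0 ∈
      expIn (Set.Ioi (1 + p 0)) := by
    rw [homSol_eq_sum, Fintype.sum_bool]
    have e1 : eig p (Fin.succ 0, false) = -(1 + p 0) := by simp only [eig, wt, Fin.cons_succ]; simp; ring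
    have e2 : eig p (Fin.succ 0, true) = -(1 - p 0) := by simp only [eig, wt, Fin.cons_succ]; simp; ring
    rw [e1, e2]
    simp only [eq_comm (a := κ), neg_neg, add_sub_cancel_right]
    exact Submodule.smul_mem _ _ (mono_mem_expIn (by simp only [Set.mem_Ioi]; linarith) 0)
  rw [series_succ, add_sub_right_comm]
  refine Submodule.add_mem _ h1 (solve_mem _ _ (opD_mem_of (series_mem_expSet p n κ)
    (fun i b hb => ?_) (fun h0 => ?_) (fun j hj b hb => ?_)))
  · have h2 := leadExp_le hp hb
    simp only [leadExp, Fin.cons_succ, if_true] at h2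
    have := hp.lt_one' i
    simp only [Set.mem_Ioi]; linarith
  · exact absurd h0 (Fin.succ_ne_zero 0)
  · have h2 : (0 : ℝ) ≤ b := leadExp_le hp hb
    have : (0 : Fin 3) = j := Fin.succ_injective _ hj
    subst this
    simp only [Set.mem_Ioi]; linarith

end

/-! ### The formal counterpart of the approximations -/

/-- The coefficient of the homogeneous solution `κ` which removes the initial data at `τ = 0`. -/
def initCoef (p : Fin 3 → ℝ) (κ : DataIndex) (s : ExpPoly) : Op :=
  (-(eig p κ - eig p (κ.1, !κ.2))⁻¹) •
    atZero (dSub (eig p (κ.1, !κ.2)) (solve p κ.1 s))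

/-- The solution with vanishing initial data at `τ = 0`. -/
def solveZero (p : Fin 3 → ℝ) (μ : Fin 4) (s : ExpPoly) : ExpPoly :=
  solve p μ s + ∑ σ : Bool, initCoef p (μ, σ) s • mono (-eig p (μ, σ)) 0

lemma eig_ne {p : Fin 3 → ℝ} (hp : IsKasner p) (μ : Fin 4) (σ : Bool) :
    eig p (μ, σ) - eig p (μ, !σ) ≠ 0 := by
  have := hp.wt_ne_zero μ
  cases σ <;> simp only [Bool.not_true, Bool.not_false, eig_true, eig_false] <;>
    intro h <;> apply this <;> linarith

lemma dSub_sum_homogeneous (p : Fin 3 → ℝ) (μ : Fin 4) (σ : Bool) (c : Bool → Op) :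
    dSub (eig p (μ, !σ)) (∑ ρ, c ρ • mono (-eig p (μ, ρ)) 0) =
      c σ • (eig p (μ, σ) - eig p (μ, !σ)) • mono (-eig p (μ, σ)) 0 := by
  rw [Fintype.sum_bool]
  cases σ <;> simp only [map_add, map_smul, dSub_mono_zero, neg_neg, sub_self, zero_smul,
    smul_zero, Bool.not_true, Bool.not_false, add_zero, zero_add]

lemma dSub_solveZero (p : Fin 3 → ℝ) (μ : Fin 4) (σ : Bool) (s : ExpPoly) :
    dSub (eig p (μ, σ)) (dSub (eig p (μ, !σ)) (solveZero p μ s)) = s := by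
  rw [solveZero, map_add, map_add, dSub_solve, dSub_sum_homogeneous, map_smul,
    LinearMap.map_smul_of_tower, dSub_mono_zero]
  simp

/-- For distinct eigenvalues, vanishing of (∂ - λ)y at τ = 0 for both λ is the same as y(0) = y'(0)
= 0. These are the initial values of the integral from 0 to τ in `approx`. -/
lemma atZero_dSub_solveZero {p : Fin 3 → ℝ} (hp : IsKasner p) (μ : Fin 4) (σ : Bool)
    (s : ExpPoly) : atZero (dSub (eig p (μ, !σ)) (solveZero p μ s)) = 0 := by
  have h := eig_ne hp μ σ
  rw [solveZero, map_add, map_add, dSub_sum_homogeneous, map_smul, LinearMap.map_smul_of_tower]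
  have h1 : atZero (mono (-eig p (μ, σ)) 0) = 1 := by simp [atZero]
  rw [h1, initCoef, smul_eq_mul, Algebra.smul_mul_assoc, Algebra.mul_smul_comm, mul_one,
    smul_smul, neg_mul, inv_mul_cancel₀ h, neg_one_smul, add_neg_cancel]

/-- The coefficients of the data of the approximation of order `n + 1`, when the approximation
of order `n` is given. -/
def nextCoef (p : Fin 3 → ℝ) (n : ℕ) (F : DataIndex → Fin 4 → ExpPoly) (κ κ' : DataIndex) : Op :=
  if eig p κ ≤ -((n : ℝ) + 1) * (1 - p 2) then 0
  else (if κ = κ' then 1 else 0) - initCoef p κ (opD p (F κ') κ.1)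

/-- The formal counterpart of the approximations, in terms of the data at infinity. -/
def approxSeries (p : Fin 3 → ℝ) : ℕ → DataIndex → Fin 4 → ExpPoly
  | 0 => 0
  | n + 1 => fun κ' μ =>
      (∑ σ : Bool, nextCoef p n (approxSeries p n) (μ, σ) κ' • mono (-eig p (μ, σ)) 0) +
        solveZero p μ (opD p (approxSeries p n κ') μ)

/-- The coefficients which express the data of the approximations by the data at infinity. -/
def approxCoef (p : Fin 3 → ℝ) : ℕ → DataIndex → DataIndex → Op
  | 0 => 0
  | n + 1 => nextCoef p n (approxSeries p n)

lemma approxSeries_succ (p : Fin 3 → ℝ) (n : ℕ) (κ' : DataIndex) (μ : Fin 4) :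
    approxSeries p (n + 1) κ' μ =
      (∑ σ : Bool, approxCoef p (n + 1) (μ, σ) κ' • mono (-eig p (μ, σ)) 0) +
        solveZero p μ (opD p (approxSeries p n κ') μ) := rfl

lemma approxCoef_eq_zero (p : Fin 3 → ℝ) {n : ℕ} (hn : 1 ≤ n) {κ : DataIndex}
    (h : eig p κ ≤ -(n : ℝ) * (1 - p 2)) (κ' : DataIndex) : approxCoef p n κ κ' = 0 := by
  obtain ⟨m, rfl⟩ : ∃ m, n = m + 1 := ⟨n - 1, by omega⟩
  push_cast at h
  simp only [approxCoef, nextCoef, if_pos h]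

/-- The coefficients `nextCoef` undo the homogeneous part by which `solveZero` differs from `solve`.
Where the cutoff on the eigenvalues prevents this, the term left over has exponent at least (n +
1)(1 - p_3). -/
lemma approxSeries_sub_mem {p : Fin 3 → ℝ} (hp : IsKasner p) (n : ℕ) (κ' : DataIndex) (μ : Fin 4) :
    approxSeries p n κ' μ - series p n κ' μ ∈ expIn (Set.Ici (n * (1 - p 2))) := by
  induction n generalizing μ with
  | zero => simp only [approxSeries, series, Pi.zero_apply, sub_self]; exact Submodule.zero_mem _
  | succ n ih =>
    have h1 := opD_mem_Ici hp (Z := approxSeries p n κ' - series p n κ') ih μ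
    rw [opD_sub] at h1
    have h2 := solve_mem p μ h1
    rw [map_sub] at h2
    have e : approxSeries p (n + 1) κ' μ - series p (n + 1) κ' μ =
        (∑ σ : Bool, (approxCoef p (n + 1) (μ, σ) κ' + initCoef p (μ, σ)
          (opD p (approxSeries p n κ') μ) - if (μ, σ) = κ' then 1 else 0) •
            mono (-eig p (μ, σ)) 0) +
        (solve p μ (opD p (approxSeries p n κ') μ) - solve p μ (opD p (series p n κ') μ)) := by
      rw [approxSeries_succ, series_succ, solveZero, homSol_eq_sum]
      simp only [sub_smul, add_smul, Finset.sum_sub_distrib, Finset.sum_add_distrib]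
      abel
    rw [e]
    refine Submodule.add_mem _ (Submodule.sum_mem _ fun σ _ => ?_) ?_
    · by_cases h : eig p (μ, σ) ≤ -((n : ℝ) + 1) * (1 - p 2)
      · refine Submodule.smul_mem _ _ (mono_mem_expIn ?_ 0)
        simp only [Set.mem_Ici, Nat.cast_add, Nat.cast_one]
        linarith
      · have : approxCoef p (n + 1) (μ, σ) κ' + initCoef p (μ, σ)
            (opD p (approxSeries p n κ') μ) - (if (μ, σ) = κ' then 1 else 0) = 0 := by
          simp only [approxCoef, nextCoef, if_neg h]
          ring
        rw [this, zero_smul]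
        exact Submodule.zero_mem _
    · refine expIn_mono (Set.Ici_subset_Ici.2 (le_of_eq ?_)) h2
      push_cast; ring

lemma initCoef_zero (p : Fin 3 → ℝ) (κ : DataIndex) : initCoef p κ 0 = 0 := by
  simp [initCoef]

lemma approxCoef_of_approxSeries_eq_zero {p : Fin 3 → ℝ} {n : ℕ} {κ κ' : DataIndex}
    (h : approxSeries p n κ' = 0) (hκ : -((n : ℝ) + 1) * (1 - p 2) < eig p κ) :
    approxCoef p (n + 1) κ κ' = if κ = κ' then 1 else 0 := by
  simp only [approxCoef, nextCoef, if_neg hκ.not_ge, h, opD_zero, initCoef_zero, sub_zero]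

/-- Such a datum has not entered yet: its homogeneous solution is cut off, so D has nothing to act
on. -/
lemma approxSeries_eq_zero {p : Fin 3 → ℝ} (hp : IsKasner p) (n : ℕ) {κ' : DataIndex}
    (h : eig p κ' ≤ -(n : ℝ) * (1 - p 2)) : approxSeries p n κ' = 0 := by
  induction n with
  | zero => rfl
  | succ n ih =>
    have hg := hp.gap_pos
    push_cast at h
    have h0 : approxSeries p n κ' = 0 := ih (by linarith)
    funext μ
    rw [approxSeries_succ, h0, opD_zero, solveZero, map_zero]
    simp only [initCoef_zero, zero_smul, Finset.sum_const_zero, add_zero, Pi.zero_apply]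
    refine Finset.sum_eq_zero fun σ _ => ?_
    by_cases h1 : eig p (μ, σ) ≤ -((n : ℝ) + 1) * (1 - p 2)
    · rw [approxCoef_eq_zero p (by omega) (by push_cast; exact h1), zero_smul]
    · rw [approxCoef_of_approxSeries_eq_zero h0 (not_le.1 h1), if_neg, zero_smul]
      rintro rfl
      exact h1 h

/-- The coefficients which express the asymptotic data by the data at infinity. -/
def dataMatrix (p : Fin 3 → ℝ) : Matrix DataIndex DataIndex Op := fun κ κ' =>
  approxCoef p (level p κ) κ κ'

lemma level_spec {p : Fin 3 → ℝ} (hp : IsKasner p) (κ : DataIndex) :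
    ∃ n : ℕ, level p κ = n + 1 ∧ eig p κ ≤ -(n : ℝ) * (1 - p 2) ∧
      -((n : ℝ) + 1) * (1 - p 2) < eig p κ := by
  have hg := hp.gap_pos
  have h0 : 0 ≤ -eig p κ / (1 - p 2) := div_nonneg (by linarith [hp.eig_nonpos κ]) hg.le
  refine ⟨_, rfl, ?_, ?_⟩
  · have := (le_div_iff₀ hg).1 (Nat.floor_le h0)
    linarith
  · have := (div_lt_iff₀ hg).1 (Nat.lt_floor_add_one (-eig p κ / (1 - p 2)))
    linarith

/-- At the level where u_κ is read off, the previous approximation does not contain a datum κ'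
without larger eigenvalue, so only the direct term is left. This triangularity is the source of the
last assertion of the theorem. -/
lemma dataMatrix_eq {p : Fin 3 → ℝ} (hp : IsKasner p) {κ κ' : DataIndex}
    (h : eig p κ' ≤ eig p κ) : dataMatrix p κ κ' = if κ = κ' then 1 else 0 := by
  obtain ⟨n, h1, h2, h3⟩ := level_spec hp κ
  rw [dataMatrix, h1]
  exact approxCoef_of_approxSeries_eq_zero (approxSeries_eq_zero hp n (h.trans h2)) h3

/-! ### Unipotent matrices -/

/-- Matrices which are unipotent and triangular with respect to the eigenvalues. -/
def IsUnitri (p : Fin 3 → ℝ) (A : Matrix DataIndex DataIndex Op) : Prop :=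
  ∀ κ κ', eig p κ' ≤ eig p κ → A κ κ' = if κ = κ' then 1 else 0

/-- The matrix 1 - A is nilpotent, and the inverse is the finite Neumann series. -/
lemma IsUnitri.exists_inverse {p : Fin 3 → ℝ} {A : Matrix DataIndex DataIndex Op}
    (hA : IsUnitri p A) : ∃ B, IsUnitri p B ∧ B * A = 1 := by
  classical
  set N : Matrix DataIndex DataIndex Op := 1 - A with hN
  have hN0 : ∀ κ κ', eig p κ' ≤ eig p κ → N κ κ' = 0 := fun κ κ' h => by
    rw [hN, Matrix.sub_apply, hA κ κ' h, Matrix.one_apply, sub_self]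
  -- A nonzero entry of N leads from κ to a strictly larger eigenvalue and lowers this rank. There
  -- are eight indices, so N^9 = 0; indices with equal eigenvalues cause no problem.
  let r : DataIndex → ℕ := fun κ => (Finset.univ.filter fun κ' => eig p κ < eig p κ').card
  have hr : ∀ κ κ', eig p κ < eig p κ' → r κ' < r κ := fun κ κ' h => by
    refine Finset.card_lt_card (Finset.ssubset_iff_of_subset ?_ |>.2 ⟨κ', by simpa using h, by simp⟩)
    intro κ'' h'
    simp only [Finset.mem_filter, Finset.mem_univ, true_and] at h' ⊢
    exact h.trans h'
  have hpow : ∀ j κ κ', (N ^ j) κ κ' ≠ 0 → r κ' + j ≤ r κ := by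
    intro j
    induction j with
    | zero =>
      intro κ κ' h
      rw [pow_zero, Matrix.one_apply] at h
      have : κ = κ' := by by_contra h'; simp [h'] at h
      simp [this]
    | succ j ih =>
      intro κ κ' h
      rw [pow_succ, Matrix.mul_apply] at h
      obtain ⟨κ'', _, h1⟩ := Finset.exists_ne_zero_of_sum_ne_zero h
      have h2 := ih κ κ'' (left_ne_zero_of_mul h1)
      have h3 := right_ne_zero_of_mul h1
      have h4 : eig p κ'' < eig p κ' := by
        by_contra h'
        exact h3 (hN0 _ _ (not_lt.1 h'))
      have := hr _ _ h4
      omega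
  have hrcard : ∀ κ, r κ ≤ 8 := fun κ => (Finset.card_le_univ _).trans (by decide)
  have hnil : N ^ 9 = 0 := by
    ext1 κ κ'
    by_contra h
    have h1 := hpow 9 κ κ' h
    have := hrcard κ
    omega
  have hstrict : ∀ j, ∀ κ κ', eig p κ' ≤ eig p κ → (N ^ (j + 1)) κ κ' = 0 := by
    intro j κ κ' h
    by_contra h1
    have h2 := hpow (j + 1) κ κ' h1
    have h3 : r κ ≤ r κ' := by
      refine Finset.card_le_card fun κ'' h' => ?_
      simp only [Finset.mem_filter, Finset.mem_univ, true_and] at h' ⊢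
      exact h.trans_lt h'
    omega
  refine ⟨∑ j ∈ Finset.range 9, N ^ j, fun κ κ' h => ?_, ?_⟩
  · rw [Finset.sum_range_succ', Matrix.add_apply, pow_zero, Matrix.one_apply, Matrix.sum_apply,
      Finset.sum_eq_zero fun j _ => hstrict j κ κ' h, zero_add]
  · have h1 : A = -(N - 1) := by rw [hN]; abel
    rw [h1, mul_neg, geom_sum_mul, hnil]
    simp

open ExpPoly

/-! ### Evaluation at a frequency -/

/-- The value at `τ` of an exponential polynomial, with the operators replaced by their symbols. -/
def modeEv (n : Fin 3 → ℤ) (τ : ℝ) : ExpPoly →ₗ[ℝ] ℂ := ev (symbol n).toLinearMap τ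

lemma modeEv_op_smul (n : Fin 3 → ℤ) (τ : ℝ) (r : Op) (Z : ExpPoly) :
    modeEv n τ (r • Z) = symbol n r * modeEv n τ Z := by
  unfold modeEv
  induction Z using induction_mono with
  | h0 => simp
  | hadd Y Z hY hZ => simp only [smul_add, map_add, hY, hZ, mul_add]
  | hmono s b d =>
    rw [smul_smul, ev_smul_mono, ev_smul_mono]
    simp only [AlgHom.toLinearMap_apply, map_mul, Complex.real_smul]
    ring

lemma modeEv_real_smul (n : Fin 3 → ℤ) (τ c : ℝ) (Z : ExpPoly) :
    modeEv n τ (c • Z) = c * modeEv n τ Z := by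
  rw [map_smul, Complex.real_smul]

lemma modeEv_shift (n : Fin 3 → ℤ) (τ c : ℝ) (Z : ExpPoly) :
    modeEv n τ (shift c Z) = Real.exp (-c * τ) * modeEv n τ Z := by
  rw [modeEv, ev_shift, Complex.real_smul]

lemma modeEv_mono (n : Fin 3 → ℤ) (τ b : ℝ) (d : ℕ) :
    modeEv n τ (mono b d) = (Real.exp (-b * τ) * τ ^ d : ℝ) := by
  have := ev_smul_mono (symbol n).toLinearMap τ 1 b d
  rw [one_smul] at this
  rw [modeEv, this]
  simp

lemma hasDerivAt_modeEv (n : Fin 3 → ℤ) (τ : ℝ) (Z : ExpPoly) :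
    HasDerivAt (fun s => modeEv n s Z) (modeEv n τ (dτ Z)) τ := hasDerivAt_ev _ τ Z

lemma symbol_X (n : Fin 3 → ℤ) (i : Fin 3) : symbol n (MvPolynomial.X i) = Complex.I * n i := by
  simp [symbol]

lemma modeEv_opD (p : Fin 3 → ℝ) (n : Fin 3 → ℤ) (τ : ℝ) (Z : Fin 4 → ExpPoly) (μ : Fin 4) :
    modeEv n τ (opD p Z μ) = modeOp p n τ (fun ν => modeEv n τ (Z ν)) μ := by
  have h1 : ∀ μ, modeEv n τ (∑ i, ((MvPolynomial.X i * MvPolynomial.X i : Op)) •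
      shift (2 * (1 - p i)) (Z μ)) = ∑ i, (Real.exp (-2 * (1 - p i) * τ) : ℂ) *
        ((Complex.I * n i) * ((Complex.I * n i) * modeEv n τ (Z μ))) := by
    intro μ
    rw [map_sum]
    refine Finset.sum_congr rfl fun i _ => ?_
    rw [modeEv_op_smul, modeEv_shift, map_mul, symbol_X,
      show -(2 * (1 - p i)) * τ = -2 * (1 - p i) * τ by ring]
    ring
  have h2 : ∀ i ν, modeEv n τ ((2 * p i) • (MvPolynomial.X i : Op) • shift (1 - p i) (Z ν)) =
      ((2 * p i * Real.exp (-(1 - p i) * τ) : ℝ) : ℂ) *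
        ((Complex.I * n i) * modeEv n τ (Z ν)) := by
    intro i ν
    rw [modeEv_real_smul, modeEv_op_smul, modeEv_shift, symbol_X]
    push_cast; ring
  unfold modeOp
  refine Fin.cases ?_ (fun j => ?_) μ
  · rw [opD_zero_comp, map_add, h1, map_sum, Fin.cons_zero]
    simp only [h2]
  · rw [opD_succ_comp, map_add, h1, h2, Fin.cons_succ]

lemma modeOp_sub (p : Fin 3 → ℝ) (n : Fin 3 → ℤ) (τ : ℝ) (z w : Fin 4 → ℂ) (μ : Fin 4) :
    modeOp p n τ (fun ν => z ν - w ν) μ = modeOp p n τ z μ - modeOp p n τ w μ := by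
  unfold modeOp
  refine Fin.cases ?_ (fun j => ?_) μ
  · simp only [Fin.cons_zero, mul_sub, Finset.sum_sub_distrib]; ring
  · simp only [Fin.cons_succ, mul_sub, Finset.sum_sub_distrib]; ring

lemma modeOp_mul_right (p : Fin 3 → ℝ) (n : Fin 3 → ℤ) (τ : ℝ) (z : Fin 4 → ℂ) (c : ℂ)
    (μ : Fin 4) : modeOp p n τ (fun ν => z ν * c) μ = modeOp p n τ z μ * c := by
  unfold modeOp
  refine Fin.cases ?_ (fun j => ?_) μ
  · simp only [Fin.cons_zero, add_mul, Finset.sum_mul]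
    congr 1 <;> exact Finset.sum_congr rfl fun _ _ => by ring
  · simp only [Fin.cons_succ, add_mul, Finset.sum_mul]
    congr 1
    · exact Finset.sum_congr rfl fun _ _ => by ring
    · ring

lemma modeOp_sum {ι : Type*} (s : Finset ι) (p : Fin 3 → ℝ) (n : Fin 3 → ℤ) (τ : ℝ)
    (z : ι → Fin 4 → ℂ) (μ : Fin 4) :
    modeOp p n τ (fun ν => ∑ j ∈ s, z j ν) μ = ∑ j ∈ s, modeOp p n τ (z j) μ := by
  unfold modeOp
  refine Fin.cases ?_ (fun j => ?_) μ
  · simp only [Fin.cons_zero, Finset.mul_sum, Finset.sum_add_distrib]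
    congr 1 <;> exact Finset.sum_comm
  · simp only [Fin.cons_succ, Finset.mul_sum, Finset.sum_add_distrib]
    congr 1
    exact Finset.sum_comm

/-! ### Bounds -/

lemma abs_le_wgt (n : Fin 3 → ℤ) (i : Fin 3) : |(n i : ℝ)| ≤ wgt n := by
  have h1 : (n i : ℝ) ^ 2 ≤ ∑ i, (n i : ℝ) ^ 2 :=
    Finset.single_le_sum (f := fun i => (n i : ℝ) ^ 2) (fun _ _ => sq_nonneg _) (Finset.mem_univ i)
  rw [wgt]
  nlinarith [sq_abs (n i : ℝ), sq_nonneg (|(n i : ℝ)| - 1)]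

lemma exists_norm_symbol_le (L : Op) :
    ∃ (r : ℕ) (K : ℝ), 0 ≤ K ∧ ∀ n, ‖symbol n L‖ ≤ K * wgt n ^ r := by
  induction L using MvPolynomial.induction_on with
  | C a =>
    refine ⟨0, |a|, abs_nonneg a, fun n => ?_⟩
    rw [← MvPolynomial.algebraMap_eq, AlgHom.commutes]
    simp
  | add L M hL hM =>
    obtain ⟨r, K, hK, h⟩ := hL
    obtain ⟨r', K', hK', h'⟩ := hM
    refine ⟨max r r', K + K', add_nonneg hK hK', fun n => ?_⟩
    rw [map_add, add_mul]
    refine (norm_add_le _ _).trans (add_le_add ((h n).trans ?_) ((h' n).trans ?_)) <;> gcongr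
    · exact one_le_wgt n
    · exact le_max_left _ _
    · exact one_le_wgt n
    · exact le_max_right _ _
  | mul_X L i hL =>
    obtain ⟨r, K, hK, h⟩ := hL
    refine ⟨r + 1, K, hK, fun n => ?_⟩
    rw [map_mul, symbol_X, norm_mul, norm_mul, Complex.norm_I, one_mul, pow_succ, ← mul_assoc,
      Complex.norm_intCast]
    have := wgt_pos n
    exact mul_le_mul (h n) (abs_le_wgt n i) (abs_nonneg _) (by positivity)

lemma exists_norm_modeEv_le {β : ℝ} {Z : ExpPoly} (hZ : Z ∈ expIn (Set.Ici β)) :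
    ∃ (N r : ℕ) (K : ℝ), 0 ≤ K ∧ ∀ n τ, 0 ≤ τ →
      ‖modeEv n τ Z‖ ≤ K * wgt n ^ r * ((1 + τ) ^ N * decay β τ) := by
  have key : ∀ s : Finset (ℝ × ℕ), (∀ x ∈ s, β ≤ x.1) → ∃ (N r : ℕ) (K : ℝ), 0 ≤ K ∧
      ∀ n τ, 0 ≤ τ → ‖∑ x ∈ s, (Real.exp (-x.1 * τ) * τ ^ x.2) • symbol n (Z x)‖ ≤
        K * wgt n ^ r * ((1 + τ) ^ N * decay β τ) := by
    intro s
    induction s using Finset.cons_induction with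
    | empty => exact fun _ => ⟨0, 0, 0, le_rfl, by simp⟩
    | cons x s hx ih =>
      intro h
      obtain ⟨N, r, K, hK, hs⟩ := ih fun y hy => h y (Finset.mem_cons_of_mem hy)
      obtain ⟨r', K', hK', hs'⟩ := exists_norm_symbol_le (Z x)
      refine ⟨max N x.2, max r r', K + K', add_nonneg hK hK', fun n τ hτ => ?_⟩
      rw [Finset.sum_cons, add_comm, add_mul, add_mul]
      have h1 := one_le_wgt n
      have h2 := (decay_pos β τ).le
      refine (norm_add_le _ _).trans (add_le_add ((hs n τ hτ).trans ?_) ?_)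
      · gcongr
        · exact le_max_left _ _
        · linarith
        · exact le_max_left _ _
      · rw [norm_smul, Real.norm_of_nonneg (by positivity)]
        have h3 : Real.exp (-x.1 * τ) ≤ decay β τ :=
          decay_anti (h x (Finset.mem_cons_self x s)) hτ
        have h4 : τ ^ x.2 ≤ (1 + τ) ^ max N x.2 :=
          (pow_le_pow_left₀ hτ (by linarith) _).trans
            (pow_le_pow_right₀ (by linarith) (le_max_right _ _))
        have h5 : ‖symbol n (Z x)‖ ≤ K' * wgt n ^ max r r' := (hs' n).trans (by
          gcongr; exact le_max_right _ _)
        calc _ ≤ decay β τ * (1 + τ) ^ max N x.2 * (K' * wgt n ^ max r r') := by gcongr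
          _ = _ := by ring
  have h := key Z.support fun x hx => mem_expIn.1 hZ x.1 x.2 (by simpa using hx)
  simpa only [modeEv, ev_eq_sum, AlgHom.toLinearMap_apply] using h

/-- The power N is chosen before the data d. This is why the exponents N_n of the theorem do not
depend on the solution. -/
lemma exists_rapidO_modeEv {β : ℝ} {Z : ExpPoly} (hZ : Z ∈ expIn (Set.Ici β)) :
    ∃ N : ℕ, ∀ d : (Fin 3 → ℤ) → ℂ, Rapid d →
      RapidO (fun n τ => modeEv n τ Z * d n) fun τ => (1 + τ) ^ N * decay β τ := by
  obtain ⟨N, r, K, hK, h⟩ := exists_norm_modeEv_le hZ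
  refine ⟨N, fun d hd => hd.rapidO.mul h hK (fun τ hτ => ?_) fun τ _ => mul_one _⟩
  have := (decay_pos β τ).le
  positivity

lemma exists_pow_mul_decay_le (N : ℕ) {ε : ℝ} (hε : 0 < ε) :
    ∃ K, ∀ τ, 0 ≤ τ → (1 + τ) ^ N * decay ε τ ≤ K := by
  refine ⟨(N.factorial : ℝ) / ε ^ N * Real.exp ε, fun τ hτ => ?_⟩
  have h1 := Real.pow_div_factorial_le_exp (ε * (1 + τ)) (by positivity) N
  have h2 : decay ε τ * Real.exp (ε * (1 + τ)) = Real.exp ε := by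
    rw [decay, ← Real.exp_add]; congr 1; ring
  have h3 := decay_pos ε τ
  have h4 : (1 + τ) ^ N = (N.factorial : ℝ) / ε ^ N * ((ε * (1 + τ)) ^ N / N.factorial) := by
    have := N.factorial_pos
    rw [mul_pow]
    field_simp
  calc (1 + τ) ^ N * decay ε τ ≤ (N.factorial : ℝ) / ε ^ N * Real.exp (ε * (1 + τ)) *
        decay ε τ := by rw [h4]; gcongr
    _ = _ := by rw [mul_assoc, mul_comm _ (decay ε τ), h2]

/-- A power of 1 + τ is absorbed by an arbitrarily small loss of the rate, hence the strict
inequality. -/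
lemma RapidO.of_pow_mul_decay {f : (Fin 3 → ℤ) → ℝ → ℂ} {N : ℕ} {β γ : ℝ}
    (hf : RapidO f fun τ => (1 + τ) ^ N * decay β τ) (h : γ < β) : RapidO f (decay γ) := by
  obtain ⟨K, hK⟩ := exists_pow_mul_decay_le N (sub_pos.2 h)
  refine hf.mono K fun τ hτ => ⟨?_, ?_⟩
  · have := (decay_pos β τ).le
    positivity
  · have h1 : decay β τ = decay (β - γ) τ * decay γ τ := by rw [decay_mul]; congr 1; ring
    rw [h1, ← mul_assoc]
    exact mul_le_mul_of_nonneg_right (hK τ hτ) (decay_pos γ τ).le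

lemma rapidO_modeEv {β γ : ℝ} {Z : ExpPoly} (hZ : Z ∈ expIn (Set.Ici β)) (h : γ < β)
    {d : (Fin 3 → ℤ) → ℂ} (hd : Rapid d) :
    RapidO (fun n τ => modeEv n τ Z * d n) (decay γ) := by
  obtain ⟨N, hN⟩ := exists_rapidO_modeEv hZ
  exact (hN d hd).of_pow_mul_decay h

/-- The analytic counterpart of `opD_mem_Ici`: derivatives only cost weights in the frequency. -/
lemma RapidO.modeOp {p : Fin 3 → ℝ} (hp : IsKasner p) {z : Fin 4 → (Fin 3 → ℤ) → ℝ → ℂ} {β : ℝ}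
    (hz : ∀ μ, RapidO (z μ) (decay β)) (μ : Fin 4) :
    RapidO (fun n τ => modeOp p n τ (fun ν => z ν n τ) μ) (decay (β + (1 - p 2))) := by
  have hI : ∀ (n : Fin 3 → ℤ) i, ‖Complex.I * n i‖ ≤ wgt n := fun n i => by
    rw [norm_mul, Complex.norm_I, one_mul, Complex.norm_intCast]; exact abs_le_wgt n i
  have h1 : ∀ (i : Fin 3) ν, RapidO (fun n τ => ((2 * p i * Real.exp (-(1 - p i) * τ) : ℝ) : ℂ) *
      ((Complex.I * n i) * z ν n τ)) (decay (β + (1 - p 2))) := by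
    intro i ν
    have hi : RapidO (fun n τ => (((2 * p i * Real.exp (-(1 - p i) * τ) : ℝ) : ℂ) *
      (Complex.I * n i)) * z ν n τ) (decay ((1 - p i) + β)) := by
      refine (hz ν).mul (r := 1) (K := |2 * p i|) (ψ := decay (1 - p i)) (fun n τ _ => ?_)
        (abs_nonneg _) (fun τ _ => (decay_pos _ τ).le) fun τ _ => decay_mul _ _ τ
      rw [norm_mul, Complex.norm_real, norm_mul, Real.norm_eq_abs, Real.norm_eq_abs, Real.abs_exp,
        pow_one, mul_assoc, mul_assoc]
      have := hI n i
      have := decay_pos (1 - p i) τ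
      rw [mul_comm (wgt n)]
      gcongr
      rfl
    refine (hi.decay_mono ?_).congr fun n τ _ => (mul_assoc _ _ _).symm
    have := hp.le_two i
    linarith
  have h2 : ∀ (i : Fin 3) ν, RapidO (fun n τ => (Real.exp (-2 * (1 - p i) * τ) : ℂ) *
      ((Complex.I * n i) * ((Complex.I * n i) * z ν n τ))) (decay (β + (1 - p 2))) := by
    intro i ν
    have hi : RapidO (fun n τ => ((Real.exp (-2 * (1 - p i) * τ) : ℂ) *
      ((Complex.I * n i) * (Complex.I * n i))) * z ν n τ) (decay (2 * (1 - p i) + β)) := by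
      refine (hz ν).mul (r := 2) (K := 1) (ψ := decay (2 * (1 - p i))) (fun n τ _ => ?_)
        zero_le_one (fun τ _ => (decay_pos _ τ).le) fun τ _ => decay_mul _ _ τ
      have e : Real.exp (-2 * (1 - p i) * τ) = decay (2 * (1 - p i)) τ := by
        rw [decay]; congr 1; ring
      rw [e, norm_mul, norm_mul, Complex.norm_real, Real.norm_of_nonneg (decay_pos _ τ).le, one_mul,
        sq, mul_comm]
      have := hI n i
      have := decay_pos (2 * (1 - p i)) τ
      have := wgt_pos n
      gcongr
    refine (hi.decay_mono ?_).congr fun n τ _ => by ring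
    have := hp.le_two i
    have := hp.lt_one' i
    linarith
  unfold Kasner.modeOp
  refine RapidO.add (RapidO.sum fun i _ => h2 i μ) ?_
  refine Fin.cases ?_ (fun j => ?_) μ
  · simp only [Fin.cons_zero]
    exact RapidO.sum fun i _ => h1 i i.succ
  · simp only [Fin.cons_succ]
    exact h1 j 0

/-! ### Evaluation at a function on the torus -/

section

variable {f : (Fin 3 → ℝ) → ℝ} (hf : SmoothTorus f)

lemma ev_opAt_smul_mono (f : (Fin 3 → ℝ) → ℝ) (x : Fin 3 → ℝ) (τ : ℝ) (r : Op) (b : ℝ) (d : ℕ) :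
    ev (opAt f x) τ (r • mono b d) = Real.exp (-b * τ) * τ ^ d * diffOp r f x := by
  rw [ev_smul_mono, opAt_apply, smul_eq_mul]

include hf

lemma smoothTorus_ev (τ : ℝ) (Z : ExpPoly) : SmoothTorus fun x => ev (opAt f x) τ Z := by
  induction Z using induction_mono with
  | h0 => simpa using smoothTorus_zero
  | hadd Y Z hY hZ => simpa only [map_add] using hY.add hZ
  | hmono r b d => simpa only [ev_opAt_smul_mono] using (hf.diffOp r).const_mul _

lemma torusCoeff_ev (τ : ℝ) (Z : ExpPoly) (n : Fin 3 → ℤ) :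
    torusCoeff (fun x => ev (opAt f x) τ Z) n = modeEv n τ Z * torusCoeff f n := by
  induction Z using induction_mono with
  | h0 => simpa using torusCoeff_zero n
  | hadd Y Z hY hZ =>
    simp only [map_add, add_mul]
    rw [torusCoeff_add (smoothTorus_ev hf τ Y).continuous (smoothTorus_ev hf τ Z).continuous, hY,
      hZ]
  | hmono r b d =>
    simp only [ev_opAt_smul_mono]
    rw [torusCoeff_const_mul, torusCoeff_diffOp hf, modeEv_op_smul, modeEv_mono]
    ring

lemma pd_ev (τ : ℝ) (Z : ExpPoly) (i : Fin 3) (x : Fin 3 → ℝ) :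
    pd i (fun x => ev (opAt f x) τ Z) x = ev (opAt f x) τ ((MvPolynomial.X i : Op) • Z) := by
  induction Z using induction_mono with
  | h0 =>
    simp only [map_zero, smul_zero]
    simp [pd]
  | hadd Y Z hY hZ =>
    simp only [map_add, smul_add]
    rw [pd_add (smoothTorus_ev hf τ Y) (smoothTorus_ev hf τ Z), hY, hZ]
  | hmono r b d =>
    simp only [ev_opAt_smul_mono]
    rw [pd_const_mul (hf.diffOp r), smul_smul, ev_opAt_smul_mono, diffOp_X_mul hf]

lemma spatialOp_ev (p : Fin 3 → ℝ) (τ : ℝ) (Z : Fin 4 → ExpPoly) (μ : Fin 4) (x : Fin 3 → ℝ) :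
    spatialOp p τ (fun ν y => ev (opAt f y) τ (Z ν)) μ x = ev (opAt f x) τ (opD p Z μ) := by
  have hpd : ∀ (i : Fin 3) Y, pd i (fun x => ev (opAt f x) τ Y) =
      fun x => ev (opAt f x) τ ((MvPolynomial.X i : Op) • Y) := fun i Y =>
    funext fun x => pd_ev hf τ Y i x
  have h1 : ∀ ν, ev (opAt f x) τ (∑ i, ((MvPolynomial.X i * MvPolynomial.X i : Op)) •
      shift (2 * (1 - p i)) (Z ν)) = ∑ i, Real.exp (-2 * (1 - p i) * τ) *
        ev (opAt f x) τ ((MvPolynomial.X i : Op) • (MvPolynomial.X i : Op) • Z ν) := by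
    intro ν
    rw [map_sum]
    refine Finset.sum_congr rfl fun i _ => ?_
    rw [← map_smul, ev_shift, smul_smul, smul_eq_mul]
    congr 2; ring
  have h2 : ∀ i ν, ev (opAt f x) τ ((2 * p i) • (MvPolynomial.X i : Op) • shift (1 - p i) (Z ν)) =
      2 * p i * Real.exp (-(1 - p i) * τ) * ev (opAt f x) τ ((MvPolynomial.X i : Op) • Z ν) := by
    intro i ν
    rw [(ev (opAt f x) τ).map_smul, ← (shift (1 - p i)).map_smul, ev_shift]
    simp only [smul_eq_mul]; ring
  unfold spatialOp
  simp only [hpd]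
  refine Fin.cases ?_ (fun j => ?_) μ
  · rw [opD_zero_comp, map_add, h1, map_sum, Fin.cons_zero]
    simp only [h2]
  · rw [opD_succ_comp, map_add, h1, h2, Fin.cons_succ]

end

lemma spatialOp_sum {ι : Type*} (s : Finset ι) (p : Fin 3 → ℝ) (τ : ℝ)
    {u : ι → Fin 4 → (Fin 3 → ℝ) → ℝ} (hu : ∀ j ∈ s, ∀ ν, SmoothTorus (u j ν)) (μ : Fin 4)
    (x : Fin 3 → ℝ) : spatialOp p τ (fun ν y => ∑ j ∈ s, u j ν y) μ x =
      ∑ j ∈ s, spatialOp p τ (u j) μ x := by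
  have hpd : ∀ (i : Fin 3) ν, pd i (fun y => ∑ j ∈ s, u j ν y) =
      fun y => ∑ j ∈ s, pd i (u j ν) y := fun i ν =>
    funext fun y => pd_sum s (fun j hj => hu j hj ν) i y
  have hpd2 : ∀ (i : Fin 3) ν y, pd i (fun y => ∑ j ∈ s, pd i (u j ν) y) y =
      ∑ j ∈ s, pd i (pd i (u j ν)) y := fun i ν y =>
    pd_sum s (fun j hj => (hu j hj ν).pd i) i y
  unfold spatialOp
  simp only [hpd, hpd2]
  refine Fin.cases ?_ (fun j => ?_) μ
  · simp only [Fin.cons_zero, Finset.mul_sum, Finset.sum_add_distrib]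
    congr 1 <;> exact Finset.sum_comm
  · simp only [Fin.cons_succ, Finset.mul_sum, Finset.sum_add_distrib]
    congr 1
    exact Finset.sum_comm

lemma torusCoeff_spatialOp (p : Fin 3 → ℝ) (τ : ℝ) {u : Fin 4 → (Fin 3 → ℝ) → ℝ}
    (hu : ∀ ν, SmoothTorus (u ν)) (μ : Fin 4) (n : Fin 3 → ℤ) :
    torusCoeff (spatialOp p τ u μ) n = modeOp p n τ (fun ν => torusCoeff (u ν) n) μ := by
  have hl : ∀ i ∈ Finset.univ, SmoothTorus fun x => Real.exp (-2 * (1 - p i) * τ) *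
      pd i (pd i (u μ)) x := fun i _ => (((hu μ).pd i).pd i).const_mul _
  have ho : ∀ (i : Fin 3) ν, SmoothTorus fun x => 2 * p i * Real.exp (-(1 - p i) * τ) *
      pd i (u ν) x := fun i ν => ((hu ν).pd i).const_mul _
  unfold modeOp
  revert hl
  refine Fin.cases (fun hl => ?_) (fun j hl => ?_) μ
  · change torusCoeff (fun x => (∑ i, Real.exp (-2 * (1 - p i) * τ) * pd i (pd i (u 0)) x) +
      ∑ i : Fin 3, 2 * p i * Real.exp (-(1 - p i) * τ) * pd i (u i.succ) x) n = _
    rw [torusCoeff_add (smoothTorus_sum _ hl).continuous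
      (smoothTorus_sum _ fun i _ => ho i i.succ).continuous,
      torusCoeff_sum _ fun i hi => (hl i hi).continuous,
      torusCoeff_sum _ fun i _ => (ho i i.succ).continuous]
    simp only [torusCoeff_const_mul, torusCoeff_pd ((hu _).pd _), torusCoeff_pd (hu _),
      Fin.cons_zero]
  · change torusCoeff (fun x => (∑ i, Real.exp (-2 * (1 - p i) * τ) * pd i (pd i (u j.succ)) x) +
      2 * p j * Real.exp (-(1 - p j) * τ) * pd j (u 0) x) n = _
    rw [torusCoeff_add (smoothTorus_sum _ hl).continuous (ho j 0).continuous,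
      torusCoeff_sum _ fun i hi => (hl i hi).continuous]
    simp only [torusCoeff_const_mul, torusCoeff_pd ((hu _).pd _), torusCoeff_pd (hu _),
      Fin.cons_succ]

/-! ### The Fourier coefficients of solutions -/

lemma IsWaveSolution.modeSolution {p : Fin 3 → ℝ} {ω : (Fin 4 → ℝ) → Fin 4 → ℝ}
    (hω : IsWaveSolution p ω) (hp : IsKasner p) :
    ModeSolution p (fun μ n τ => torusCoeff (fun x => hatFam p ω μ (τ, x)) n)
      (fun μ n τ => torusCoeff (fun x => dt (hatFam p ω μ) (τ, x)) n) where
  hasDerivAt μ n τ := hasDerivAt_torusCoeff ((hω.smoothFamily μ).1.of_le (by simp)) n τ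
  hasDerivAt' μ n τ := by
    have hs := hω.smoothFamily μ
    have h1 := hasDerivAt_torusCoeff (hs.dt.1.of_le (by simp)) n τ
    refine h1.congr_deriv ?_
    have h2 : (fun x => fderiv ℝ (dt (hatFam p ω μ)) (τ, x) (1, 0)) = fun x =>
        (-2 * dt (hatFam p ω μ) (τ, x) + -(1 - wt p μ ^ 2) * hatFam p ω μ (τ, x)) +
          spatialOp p τ (fun ν z => hatFam p ω ν (τ, z)) μ x := by
      funext x
      have := hω.hat_equation hp.sum hp.sum_sq μ τ x
      rw [← this, show fderiv ℝ (dt (hatFam p ω μ)) (τ, x) (1, 0) = dt (dt (hatFam p ω μ)) (τ, x)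
        from rfl]
      ring
    have c1 := ((hs.dt.slice τ).const_mul (-2))
    have c2 := ((hs.slice τ).const_mul (-(1 - wt p μ ^ 2)))
    -- Continuity of the spatial terms is read off from the equation they satisfy.
    have c3 : Continuous (spatialOp p τ (fun ν z => hatFam p ω ν (τ, z)) μ) := by
      have e : spatialOp p τ (fun ν z => hatFam p ω ν (τ, z)) μ = fun x =>
          dt (dt (hatFam p ω μ)) (τ, x) + 2 * dt (hatFam p ω μ) (τ, x)
            + (1 - wt p μ ^ 2) * hatFam p ω μ (τ, x) :=
        funext fun x => (hω.hat_equation hp.sum hp.sum_sq μ τ x).symm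
      rw [e]
      exact (((hs.dt.dt.slice τ).add ((hs.dt.slice τ).const_mul 2)).add
        ((hs.slice τ).const_mul _)).continuous
    rw [h2, torusCoeff_add (c1.add c2).continuous c3, torusCoeff_add c1.continuous c2.continuous,
      torusCoeff_const_mul, torusCoeff_const_mul,
      torusCoeff_spatialOp p τ (fun ν => (hω.smoothFamily ν).slice τ)]
    push_cast; ring
  rapid μ := rapid_torusCoeff ((hω.smoothFamily μ).slice 0)
  rapid' μ := rapid_torusCoeff ((hω.smoothFamily μ).dt.slice 0)

open ExpPoly

/-! ### Data at infinity -/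

/-- The difference between `z` and the sum of the series with coefficients `d`. -/
def residual (z : (Fin 3 → ℤ) → ℝ → ℂ) (Z : DataIndex → ExpPoly) (d : DataIndex → (Fin 3 → ℤ) → ℂ)
    (k : Fin 3 → ℤ) (τ : ℝ) : ℂ :=
  z k τ - ∑ κ, modeEv k τ (Z κ) * d κ k

lemma RapidO.residual_change {z : (Fin 3 → ℤ) → ℝ → ℂ} {Y Z : DataIndex → ExpPoly}
    {d : DataIndex → (Fin 3 → ℤ) → ℂ} {h : ℝ → ℝ} (hz : RapidO (residual z Y d) h)
    (hYZ : ∀ κ, RapidO (fun k τ => modeEv k τ (Y κ - Z κ) * d κ k) h) :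
    RapidO (residual z Z d) h := by
  refine (hz.add (RapidO.sum (s := Finset.univ) fun κ _ => hYZ κ)).congr fun k τ _ => ?_
  simp only [residual, map_sub, sub_mul, Finset.sum_sub_distrib]
  ring

/-- The residual of a solution with respect to the `n`-th approximation decays with rate `β`. -/
def ResDecay (p : Fin 3 → ℝ) (z z' : Fin 4 → (Fin 3 → ℤ) → ℝ → ℂ)
    (d : DataIndex → (Fin 3 → ℤ) → ℂ) (n : ℕ) (β : ℝ) : Prop :=
  ∀ μ, RapidO (residual (z μ) (fun κ => series p n κ μ) d) (decay β) ∧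
    RapidO (residual (z' μ) (fun κ => dτ (series p n κ μ)) d) (decay β)

section

variable {p : Fin 3 → ℝ} (hp : IsKasner p) {z z' : Fin 4 → (Fin 3 → ℤ) → ℝ → ℂ}

lemma ResDecay.mono {d : DataIndex → (Fin 3 → ℤ) → ℂ} {n : ℕ} {β γ : ℝ}
    (h : ResDecay p z z' d n β) (hγ : γ ≤ β) : ResDecay p z z' d n γ := fun μ =>
  ⟨(h μ).1.decay_mono hγ, (h μ).2.decay_mono hγ⟩

include hp

lemma series_sub_mem_min (m n : ℕ) (κ : DataIndex) (μ : Fin 4) :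
    series p m κ μ - series p n κ μ ∈ expIn (Set.Ici ((min m n : ℕ) * (1 - p 2))) := by
  rcases le_total m n with h | h
  · rw [min_eq_left h, ← neg_sub (series p n κ μ)]
    exact Submodule.neg_mem _ (series_sub_mem hp h κ μ)
  · rw [min_eq_right h]
    exact series_sub_mem hp h κ μ

/-- Two truncations differ by exponents at least min(m, n)(1 - p_3) > β, so the order of truncation
is irrelevant at this rate. -/
lemma ResDecay.change {d : DataIndex → (Fin 3 → ℤ) → ℂ} (hd : ∀ κ, Rapid (d κ)) {m n : ℕ} {β : ℝ}
    (h : ResDecay p z z' d m β) (hm : β < m * (1 - p 2)) (hn : β < n * (1 - p 2)) :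
    ResDecay p z z' d n β := by
  have hmin : β < (min m n : ℕ) * (1 - p 2) := by
    rcases min_choice m n with e | e <;> rw [e] <;> assumption
  refine fun μ => ⟨(h μ).1.residual_change fun κ => ?_, (h μ).2.residual_change fun κ => ?_⟩
  · exact rapidO_modeEv (series_sub_mem_min hp m n κ μ) hmin (hd κ)
  · rw [← map_sub]
    exact rapidO_modeEv (dτ_mem (series_sub_mem_min hp m n κ μ)) hmin (hd κ)

omit hp in
lemma eig_add (μ : Fin 4) (σ : Bool) : eig p (μ, σ) + eig p (μ, !σ) = -2 := by
  cases σ <;> simp only [Bool.not_true, Bool.not_false, eig_true, eig_false] <;> ring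

omit hp in
lemma eig_mul (μ : Fin 4) (σ : Bool) : eig p (μ, σ) * eig p (μ, !σ) = 1 - wt p μ ^ 2 := by
  cases σ <;> simp only [Bool.not_true, Bool.not_false, eig_true, eig_false] <;> ring

omit hp in
/-- The component of a solution along an eigenvector satisfies a scalar equation. -/
lemma ModeSolution.hasDerivAt_residual (hz : ModeSolution p z z')
    (d : DataIndex → (Fin 3 → ℤ) → ℂ) (n : ℕ) (μ : Fin 4) (σ : Bool) (k : Fin 3 → ℤ) (τ : ℝ) :
    HasDerivAt (residual (fun k τ => z' μ k τ - eig p (μ, !σ) * z μ k τ)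
        (fun κ => dSub (eig p (μ, !σ)) (series p (n + 1) κ μ)) d k)
      (eig p (μ, σ) * residual (fun k τ => z' μ k τ - eig p (μ, !σ) * z μ k τ)
        (fun κ => dSub (eig p (μ, !σ)) (series p (n + 1) κ μ)) d k τ +
        modeOp p k τ (fun ν => residual (z ν) (fun κ => series p n κ ν) d k τ) μ) τ := by
  have h1 : HasDerivAt (fun τ => z' μ k τ - eig p (μ, !σ) * z μ k τ) _ τ :=
    (hz.hasDerivAt' μ k τ).sub ((hz.hasDerivAt μ k τ).const_mul _)
  have h2 : HasDerivAt (fun τ => ∑ κ, modeEv k τ (dSub (eig p (μ, !σ)) (series p (n + 1) κ μ)) *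
      d κ k) _ τ := HasDerivAt.fun_sum fun κ _ => (hasDerivAt_modeEv k τ _).mul_const _
  refine (h1.sub h2).congr_deriv ?_
  have h3 : ∀ κ, modeEv k τ (dτ (dSub (eig p (μ, !σ)) (series p (n + 1) κ μ))) =
      eig p (μ, σ) * modeEv k τ (dSub (eig p (μ, !σ)) (series p (n + 1) κ μ)) +
        modeOp p k τ (fun ν => modeEv k τ (series p n κ ν)) μ := by
    intro κ
    rw [← modeEv_opD, ← dSub_series p n κ μ σ, dSub_apply (eig p (μ, σ)), map_sub,
      modeEv_real_smul]
    ring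
  simp only [residual, h3, add_mul, Finset.sum_add_distrib, modeOp_sub, modeOp_sum,
    modeOp_mul_right]
  have h4 : ((eig p (μ, σ) : ℝ) : ℂ) + (eig p (μ, !σ) : ℝ) = -2 := by
    exact_mod_cast eig_add μ σ
  have h5 : ((eig p (μ, σ) : ℝ) : ℂ) * (eig p (μ, !σ) : ℝ) = 1 - (wt p μ : ℂ) ^ 2 := by
    exact_mod_cast eig_mul μ σ
  rw [mul_sub, Finset.mul_sum]
  simp only [mul_assoc]
  linear_combination (-z' μ k τ) * h4 + z μ k τ * h5

omit hp in
lemma residual_dSub (d : DataIndex → (Fin 3 → ℤ) → ℂ) (S : DataIndex → ExpPoly) (μ : Fin 4) (c : ℝ)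
    (k : Fin 3 → ℤ) (τ : ℝ) :
    residual (fun k τ => z' μ k τ - c * z μ k τ) (fun κ => dSub c (S κ)) d k τ =
      residual (z' μ) (fun κ => dτ (S κ)) d k τ - c * residual (z μ) S d k τ := by
  simp only [residual, dSub_apply, map_sub, modeEv_real_smul, sub_mul, Finset.sum_sub_distrib,
    mul_sub, Finset.mul_sum, mul_assoc]
  ring

/-- As the eigenvalues of a block differ, z and z' are linear combinations of z' - λ_+ z and z' -
λ_- z. -/
lemma resDecay_of_eigen {d : DataIndex → (Fin 3 → ℤ) → ℂ} {n : ℕ} {β : ℝ}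
    (h : ∀ μ σ, RapidO (residual (fun k τ => z' μ k τ - eig p (μ, !σ) * z μ k τ)
        (fun κ => dSub (eig p (μ, !σ)) (series p n κ μ)) d) (decay β)) :
    ResDecay p z z' d n β := by
  intro μ
  have hne : ((eig p (μ, true) : ℝ) : ℂ) - (eig p (μ, false) : ℝ) ≠ 0 := by
    exact_mod_cast eig_ne hp μ true
  have h0 : RapidO (residual (z μ) (fun κ => series p n κ μ) d) (decay β) := by
    refine (((h μ true).sub (h μ false)).const_mul
      (((eig p (μ, true) : ℝ) : ℂ) - (eig p (μ, false) : ℝ))⁻¹).congr fun k τ _ => ?_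
    rw [residual_dSub, residual_dSub, eq_inv_mul_iff_mul_eq₀ hne]
    simp only [Bool.not_true, Bool.not_false]
    ring
  refine ⟨h0, ((h μ true).add (h0.const_mul (eig p (μ, false) : ℝ))).congr fun k τ _ => ?_⟩
  rw [residual_dSub]
  simp only [Bool.not_true]
  ring

omit hp in
lemma RapidO.rapid_residual {z : (Fin 3 → ℤ) → ℝ → ℂ} (hz : Rapid fun k => z k 0)
    (Z : DataIndex → ExpPoly) {d : DataIndex → (Fin 3 → ℤ) → ℂ} (hd : ∀ κ, Rapid (d κ)) :
    Rapid fun k => residual z Z d k 0 := by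
  have h1 : ∀ κ, ∃ β, Z κ ∈ expIn (Set.Ici β) := fun κ => by
    obtain ⟨β, hβ⟩ := ((Z κ).support.image Prod.fst).finite_toSet.bddBelow
    refine ⟨β, mem_expIn.2 fun b e hb => hβ ?_⟩
    simp only [Finset.coe_image, Set.mem_image, Finset.mem_coe, Finsupp.mem_support_iff]
    exact ⟨(b, e), hb, rfl⟩
  have h2 : ∀ κ, Rapid fun k => modeEv k 0 (Z κ) * d κ k := fun κ => by
    obtain ⟨β, hβ⟩ := h1 κ
    exact (rapidO_modeEv hβ (sub_one_lt β) (hd κ)).rapid_at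
  have h3 : RapidO (fun k _ => residual z Z d k 0) fun _ => 1 := by
    refine (hz.rapidO.sub (RapidO.sum (s := Finset.univ) fun κ _ => (h2 κ).rapidO)).congr
      fun k τ _ => rfl
  exact h3.rapid_at

/-- The bootstrap step. A residual of rate β makes its source decay at rate β + (1 - p_3). The
scalar equation along each eigenvector then gives a pure exponential up to rate β', and this
exponential is absorbed into the data. -/
lemma ModeSolution.improve (hz : ModeSolution p z z') {d : DataIndex → (Fin 3 → ℤ) → ℂ}
    (hd : ∀ κ, Rapid (d κ)) {β β' : ℝ} (hββ' : β ≤ β') (hβ' : β' < β + (1 - p 2))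
    (hne : ∀ κ, eig p κ + β' ≠ 0) (h : ∀ n : ℕ, β < n * (1 - p 2) → ResDecay p z z' d n β) :
    ∃ d' : DataIndex → (Fin 3 → ℤ) → ℂ, (∀ κ, Rapid (d' κ)) ∧ (2 < β → d' = d) ∧
      ∀ n : ℕ, β' < n * (1 - p 2) → ResDecay p z z' d' n β' := by
  have hg := hp.gap_pos
  obtain ⟨n, hn⟩ : ∃ n : ℕ, β' < n * (1 - p 2) := by
    obtain ⟨n, hn⟩ := exists_nat_gt (β' / (1 - p 2))
    exact ⟨n, (div_lt_iff₀ hg).1 hn⟩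
  have hn1 : β' < (n + 1 : ℕ) * (1 - p 2) := by push_cast; linarith
  let w : Fin 4 → Bool → (Fin 3 → ℤ) → ℝ → ℂ := fun μ σ =>
    residual (fun k τ => z' μ k τ - eig p (μ, !σ) * z μ k τ)
        (fun κ => dSub (eig p (μ, !σ)) (series p (n + 1) κ μ)) d
  have hs : ∀ μ, RapidO (fun k τ => modeOp p k τ (fun ν =>
      residual (z ν) (fun κ => series p n κ ν) d k τ) μ) (decay β') := fun μ =>
    (RapidO.modeOp hp (fun ν => (h n (hββ'.trans_lt hn) ν).1) μ).decay_mono hβ'.le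
  have hw0 : ∀ μ σ, Rapid fun k => w μ σ k 0 := fun μ σ => by
    refine RapidO.rapid_residual ?_ _ hd
    exact (((hz.rapid' μ).rapidO.sub ((hz.rapid μ).rapidO.const_mul (eig p (μ, !σ) : ℝ)))).rapid_at
  have hwβ : ∀ μ σ, RapidO (w μ σ) (decay β) := fun μ σ => by
    have h1 := h (n + 1) (hββ'.trans_lt hn1) μ
    exact (h1.2.sub (h1.1.const_mul (eig p (μ, !σ) : ℝ))).congr fun k τ _ => residual_dSub ..
  have hex : ∀ κ : DataIndex, _ := fun κ => RapidO.asymptotics (hne κ)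
    (fun k τ _ => hz.hasDerivAt_residual d n κ.1 κ.2 k τ) (hs κ.1) (hw0 κ.1 κ.2)
  choose E hE1 hE2 hE3 using hex
  -- Here ∂ minus the other eigenvalue multiplies e^{λ_κ τ} by the difference of the eigenvalues,
  -- which has to be divided out.
  let e : DataIndex → (Fin 3 → ℤ) → ℂ := fun κ k =>
    ((eig p κ - eig p (κ.1, !κ.2) : ℝ) : ℂ)⁻¹ * E κ k
  have he : ∀ κ, Rapid (e κ) := fun κ => ((hE1 κ).rapidO.const_mul _).rapid_at
  -- If λ_κ > -β, the residual already decays faster than e^{λ_κ τ}, and no correction occurs. Since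
  -- λ_κ ≥ -2, this covers all κ once β > 2.
  have he0 : ∀ κ, 0 < eig p κ + β → e κ = 0 := fun κ hκ => funext fun k => by
    simp only [e, hE3 κ β (hwβ κ.1 κ.2) hκ k, mul_zero, Pi.zero_apply]
  have hd' : ∀ κ, Rapid fun k => d κ k + e κ k := fun κ =>
    ((hd κ).rapidO.add (he κ).rapidO).rapid_at
  refine ⟨fun κ k => d κ k + e κ k, hd', fun h2 => ?_, fun m hm => ?_⟩
  · funext κ k
    rw [he0 κ (by linarith [hp.neg_two_le_eig κ]), Pi.zero_apply, add_zero]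
  refine ResDecay.change hp hd' (m := n + 1) ?_ hn1 hm
  refine resDecay_of_eigen hp fun μ σ => ?_
  -- Changing d_κ also changes the non-homogeneous part of the series. A change occurs only for -λ_κ
  -- ≥ β, and that part has exponents at least -λ_κ + (1 - p_3) > β'.
  have hrest : ∀ κ, RapidO (fun k τ => modeEv k τ (dSub (eig p (μ, !σ))
      (series p (n + 1) κ μ - homSol p κ μ)) * e κ k) (decay β') := fun κ => by
    by_cases hκ : 0 < eig p κ + β
    · rw [he0 κ hκ]
      simpa using rapidO_zero
    · refine rapidO_modeEv (β := -eig p κ + (1 - p 2)) ?_ (by linarith) (he κ)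
      exact sub_mem (dτ_mem (series_sub_homSol_mem hp n κ μ))
        (real_smul_mem _ (series_sub_homSol_mem hp n κ μ))
  have hhom : ∀ k τ, ∑ κ, modeEv k τ (dSub (eig p (μ, !σ)) (homSol p κ μ)) * e κ k =
      E (μ, σ) k * Real.exp (eig p (μ, σ) * τ) := by
    intro k τ
    rw [Fintype.sum_eq_single (μ, σ)]
    · rw [homSol, if_pos rfl, dSub_mono_zero, modeEv_real_smul, modeEv_mono, neg_neg, pow_zero,
        mul_one]
      have h1 : ((eig p (μ, σ) - eig p (μ, !σ) : ℝ) : ℂ) ≠ 0 := by exact_mod_cast eig_ne hp μ σ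
      simp only [e]
      field_simp
    · rintro ⟨ν, ρ⟩ hνρ
      rw [homSol]
      split_ifs with hν
      · simp only at hν
        subst hν
        have hρ : ρ = !σ := by
          cases ρ <;> cases σ <;> simp_all
        rw [hρ, dSub_mono_zero]
        simp
      · simp
  refine ((hE2 (μ, σ)).sub (RapidO.sum (s := Finset.univ) fun κ _ => hrest κ)).congr
    fun k τ _ => ?_
  simp only [map_sub, sub_mul, Finset.sum_sub_distrib]
  rw [hhom]
  simp only [residual, mul_add, Finset.sum_add_distrib]
  ring

/-- Only finitely many rates are resonant with an eigenvalue. The gain of at least half the gap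
ensures that finitely many steps reach any given rate. -/
lemma exists_rate (β : ℝ) :
    ∃ β', β + (1 - p 2) / 2 ≤ β' ∧ β' < β + (1 - p 2) ∧ ∀ κ, eig p κ + β' ≠ 0 := by
  have hg := hp.gap_pos
  have h1 : (Set.Ico (β + (1 - p 2) / 2) (β + (1 - p 2))).Infinite := Set.Ico_infinite (by linarith)
  obtain ⟨β', hβ', hn⟩ := h1.exists_notMem_finset (Finset.univ.image fun κ => -eig p κ)
  refine ⟨β', hβ'.1, hβ'.2, fun κ h => hn ?_⟩
  exact Finset.mem_image.2 ⟨κ, Finset.mem_univ _, by linarith⟩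

lemma ModeSolution.exists_data (hz : ModeSolution p z z') :
    ∃ d : DataIndex → (Fin 3 → ℤ) → ℂ, (∀ κ, Rapid (d κ)) ∧
      ∀ (n : ℕ) (β : ℝ), β < n * (1 - p 2) → ResDecay p z z' d n β := by
  have hg := hp.gap_pos
  have hA : ∀ N : ℕ, ∃ (d : DataIndex → (Fin 3 → ℤ) → ℂ) (β : ℝ), (∀ κ, Rapid (d κ)) ∧
      -7 + N * ((1 - p 2) / 2) ≤ β ∧ ∀ n : ℕ, β < n * (1 - p 2) → ResDecay p z z' d n β := by
    intro N
    induction N with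
    | zero =>
      refine ⟨fun _ _ => 0, -7, fun κ m => ⟨0, by simp⟩, by simp, fun n _ μ => ?_⟩
      have := hz.rapidO hp.sum_sq μ
      constructor
      · exact this.1.congr fun k τ _ => by simp [residual]
      · exact this.2.congr fun k τ _ => by simp [residual]
    | succ N ih =>
      obtain ⟨d, β, hd, hβ, h⟩ := ih
      obtain ⟨β', h1, h2, h3⟩ := exists_rate hp β
      obtain ⟨d', hd', -, h'⟩ := hz.improve hp hd (by linarith) h2 h3 h
      exact ⟨d', β', hd', by push_cast; linarith, h'⟩
  -- The distance from the initial rate -7 to 2 is 9, covered in steps of at least (1 - p_3)/2.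
  obtain ⟨N, hN⟩ : ∃ N : ℕ, 9 / ((1 - p 2) / 2) < N := exists_nat_gt _
  rw [div_lt_iff₀ (by linarith)] at hN
  obtain ⟨d, β, hd, hβ, h⟩ := hA N
  -- From here on the data no longer change, so one and the same d serves all rates.
  have hB : ∀ N : ℕ, ∃ γ, β + N * ((1 - p 2) / 2) ≤ γ ∧
      ∀ n : ℕ, γ < n * (1 - p 2) → ResDecay p z z' d n γ := by
    intro N
    induction N with
    | zero => exact ⟨β, by simp, h⟩
    | succ N ih =>
      obtain ⟨γ, hγ, hγ'⟩ := ih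
      obtain ⟨β', h1, h2, h3⟩ := exists_rate hp γ
      obtain ⟨d', hd', h4, h'⟩ := hz.improve hp hd (by linarith) h2 h3 hγ'
      have h5 : (0 : ℝ) ≤ N * ((1 - p 2) / 2) := by positivity
      rw [h4 (by linarith)] at h'
      exact ⟨β', by push_cast; linarith, h'⟩
  refine ⟨d, hd, fun n γ hγ => ?_⟩
  obtain ⟨N', hN'⟩ : ∃ N : ℕ, (γ - β) / ((1 - p 2) / 2) < N := exists_nat_gt _
  rw [div_lt_iff₀ (by linarith)] at hN'
  obtain ⟨γ', h1, h2⟩ := hB N'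
  obtain ⟨m, hm⟩ : ∃ m : ℕ, γ' / (1 - p 2) < m := exists_nat_gt _
  rw [div_lt_iff₀ hg] at hm
  exact ResDecay.change hp hd ((h2 m hm).mono (by linarith)) (by linarith) hγ

end

/-! ### Reality -/

lemma wgt_neg (n : Fin 3 → ℤ) : wgt (-n) = wgt n := by simp [wgt]

lemma RapidO.conj_neg {g : (Fin 3 → ℤ) → ℝ → ℂ} {h : ℝ → ℝ} (hg : RapidO g h) :
    RapidO (fun n τ => starRingEnd ℂ (g (-n) τ)) h := fun m => by
  obtain ⟨C, hC⟩ := hg m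
  refine ⟨C, fun n τ hτ => ?_⟩
  rw [RCLike.norm_conj, ← wgt_neg]
  exact hC (-n) τ hτ

lemma conj_symbol_neg (n : Fin 3 → ℤ) (L : Op) : starRingEnd ℂ (symbol (-n) L) = symbol n L := by
  induction L using MvPolynomial.induction_on with
  | C a =>
    rw [← MvPolynomial.algebraMap_eq, AlgHom.commutes, AlgHom.commutes]
    simp
  | add L M hL hM => rw [map_add, map_add, map_add, hL, hM]
  | mul_X L i hL =>
    rw [map_mul, map_mul, map_mul, hL, symbol_X, symbol_X]
    simp

lemma conj_modeEv_neg (n : Fin 3 → ℤ) (τ : ℝ) (Z : ExpPoly) :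
    starRingEnd ℂ (modeEv (-n) τ Z) = modeEv n τ Z := by
  induction Z using induction_mono with
  | h0 => simp
  | hadd Y Z hY hZ => rw [map_add, map_add, map_add, hY, hZ]
  | hmono r b d =>
    rw [modeEv_op_smul, modeEv_op_smul, map_mul, conj_symbol_neg, modeEv_mono, modeEv_mono,
      Complex.conj_ofReal]

lemma conj_torusCoeff_neg (u : (Fin 3 → ℝ) → ℝ) (n : Fin 3 → ℤ) :
    starRingEnd ℂ (torusCoeff u (-n)) = torusCoeff u n := by
  rw [torusCoeff_eq, torusCoeff_eq, ← integral_conj]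
  congr 1
  funext x
  rw [map_mul, Complex.conj_ofReal, conj_chr, neg_neg]

/-- The operators in the series have real coefficients and z comes from real functions. Conjugating
and reflecting the frequency therefore only conjugates and reflects the data, and averaging makes
the data real. -/
lemma residual_symm {z : (Fin 3 → ℤ) → ℝ → ℂ} (hz : ∀ k τ, starRingEnd ℂ (z (-k) τ) = z k τ)
    (Z : DataIndex → ExpPoly) (d : DataIndex → (Fin 3 → ℤ) → ℂ) (k : Fin 3 → ℤ) (τ : ℝ) :
    residual z Z (fun κ k => (d κ k + starRingEnd ℂ (d κ (-k))) / 2) k τ =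
      (2 : ℂ)⁻¹ * (residual z Z d k τ + starRingEnd ℂ (residual z Z d (-k) τ)) := by
  simp only [residual, map_sub, map_sum, map_mul, hz, conj_modeEv_neg, mul_div_assoc', mul_add,
    ← Finset.sum_div, Finset.sum_add_distrib]
  ring

/-- Every solution has smooth data at infinity. -/
lemma IsWaveSolution.exists_data {p : Fin 3 → ℝ} {ω : (Fin 4 → ℝ) → Fin 4 → ℝ}
    (hω : IsWaveSolution p ω) (hp : IsKasner p) :
    ∃ f : DataIndex → (Fin 3 → ℝ) → ℝ, (∀ κ, SmoothTorus (f κ)) ∧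
      ∀ (n : ℕ) (β : ℝ), β < n * (1 - p 2) →
        ResDecay p (fun μ k τ => torusCoeff (fun x => hatFam p ω μ (τ, x)) k)
          (fun μ k τ => torusCoeff (fun x => dt (hatFam p ω μ) (τ, x)) k)
          (fun κ => torusCoeff (f κ)) n β := by
  obtain ⟨d, hd, h⟩ := (hω.modeSolution hp).exists_data hp
  choose f hf1 hf2 using fun κ => exists_smoothTorus (hd κ)
  refine ⟨f, hf1, fun n β hβ μ => ?_⟩
  have e : (fun κ => torusCoeff (f κ)) = fun κ k => (d κ k + starRingEnd ℂ (d κ (-k))) / 2 :=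
    funext fun κ => funext (hf2 κ)
  rw [e]
  obtain ⟨h1, h2⟩ := h n β hβ μ
  constructor
  · exact ((h1.add h1.conj_neg).const_mul (2 : ℂ)⁻¹).congr fun k τ _ =>
      residual_symm (fun k τ => conj_torusCoeff_neg _ k) _ _ k τ
  · exact ((h2.add h2.conj_neg).const_mul (2 : ℂ)⁻¹).congr fun k τ _ =>
      residual_symm (fun k τ => conj_torusCoeff_neg _ k) _ _ k τ

open ExpPoly

/-! ### Evaluation at families of functions -/

lemma diffOp_mul (L M : Op) {f : (Fin 3 → ℝ) → ℝ} (hf : SmoothTorus f) :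
    diffOp (L * M) f = diffOp L (diffOp M f) := by
  induction L using MvPolynomial.induction_on generalizing M f with
  | C a =>
    funext x
    rw [← MvPolynomial.smul_eq_C_mul, diffOp_smul,
      show (MvPolynomial.C a : Op) = MvPolynomial.monomial 0 a from rfl, diffOp_monomial]
    rfl
  | add L L' hL hL' =>
    funext x
    rw [add_mul, diffOp_add, diffOp_add, hL M hf, hL' M hf]
  | mul_X L i hL =>
    rw [mul_assoc, hL _ hf, hL _ (hf.diffOp M)]
    congr 1
    funext x
    rw [diffOp_X_mul hf, diffOp_X i (hf.diffOp M)]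

lemma diffOp_fun_sum {ι : Type*} (s : Finset ι) (L : Op) {f : ι → (Fin 3 → ℝ) → ℝ}
    (hf : ∀ j ∈ s, SmoothTorus (f j)) (x : Fin 3 → ℝ) :
    diffOp L (fun y => ∑ j ∈ s, f j y) x = ∑ j ∈ s, diffOp L (f j) x := by
  induction L using MvPolynomial.induction_on generalizing f x with
  | C a =>
    simp only [show (MvPolynomial.C a : Op) = MvPolynomial.monomial 0 a from rfl, diffOp_monomial]
    rw [← Finset.mul_sum]
    rfl
  | add L M hL hM => simp only [diffOp_add, hL hf, hM hf, Finset.sum_add_distrib]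
  | mul_X L i hL =>
    have h1 : ∀ j ∈ s, diffOp (L * MvPolynomial.X i) (f j) x =
        diffOp L (diffOp (MvPolynomial.X i) (f j)) x := fun j hj => by rw [diffOp_mul _ _ (hf j hj)]
    rw [diffOp_mul _ _ (smoothTorus_sum s hf), Finset.sum_congr rfl h1,
      ← hL fun j hj => (hf j hj).diffOp _]
    congr 1
    funext y
    rw [diffOp_X i (smoothTorus_sum s hf), pd_sum s hf]
    exact Finset.sum_congr rfl fun j hj => (diffOp_X i (hf j hj) y).symm

/-- The value of a family of exponential polynomials at a family of functions. -/
def dataEv (f : DataIndex → (Fin 3 → ℝ) → ℝ) (x : Fin 3 → ℝ) (τ : ℝ) (Z : DataIndex → ExpPoly) : ℝ :=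
  ∑ κ, ev (opAt (f κ) x) τ (Z κ)

lemma hasDerivAt_dataEv (f : DataIndex → (Fin 3 → ℝ) → ℝ) (x : Fin 3 → ℝ) (τ : ℝ)
    (Z : DataIndex → ExpPoly) :
    HasDerivAt (fun s => dataEv f x s Z) (dataEv f x τ fun κ => dτ (Z κ)) τ :=
  HasDerivAt.fun_sum fun κ _ => hasDerivAt_ev _ τ (Z κ)

lemma dataEv_add (f : DataIndex → (Fin 3 → ℝ) → ℝ) (x : Fin 3 → ℝ) (τ : ℝ)
    (Y Z : DataIndex → ExpPoly) :
    dataEv f x τ (fun κ => Y κ + Z κ) = dataEv f x τ Y + dataEv f x τ Z := by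
  simp only [dataEv, map_add, Finset.sum_add_distrib]

lemma dataEv_dSub (f : DataIndex → (Fin 3 → ℝ) → ℝ) (x : Fin 3 → ℝ) (τ c : ℝ)
    (Z : DataIndex → ExpPoly) : dataEv f x τ (fun κ => dSub c (Z κ)) =
      dataEv f x τ (fun κ => dτ (Z κ)) - c * dataEv f x τ Z := by
  simp only [dataEv, dSub_apply, map_sub, Finset.sum_sub_distrib, map_smul, smul_eq_mul,
    Finset.mul_sum]

lemma smoothTorus_dataEv {f : DataIndex → (Fin 3 → ℝ) → ℝ} (hf : ∀ κ, SmoothTorus (f κ)) (τ : ℝ)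
    (Z : DataIndex → ExpPoly) : SmoothTorus fun x => dataEv f x τ Z :=
  smoothTorus_sum _ fun κ _ => smoothTorus_ev (hf κ) τ (Z κ)

lemma torusCoeff_dataEv {f : DataIndex → (Fin 3 → ℝ) → ℝ} (hf : ∀ κ, SmoothTorus (f κ)) (τ : ℝ)
    (Z : DataIndex → ExpPoly) (k : Fin 3 → ℤ) :
    torusCoeff (fun x => dataEv f x τ Z) k = ∑ κ, modeEv k τ (Z κ) * torusCoeff (f κ) k := by
  unfold dataEv
  rw [torusCoeff_sum _ fun κ _ => (smoothTorus_ev (hf κ) τ (Z κ)).continuous]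
  exact Finset.sum_congr rfl fun κ _ => torusCoeff_ev (hf κ) τ (Z κ) k

lemma torusCoeff_sub_dataEv {f : DataIndex → (Fin 3 → ℝ) → ℝ} (hf : ∀ κ, SmoothTorus (f κ))
    {g : ℝ → (Fin 3 → ℝ) → ℝ} (hg : ∀ τ, SmoothTorus (g τ)) (Z : DataIndex → ExpPoly)
    (k : Fin 3 → ℤ) (τ : ℝ) : torusCoeff (fun x => g τ x - dataEv f x τ Z) k =
      residual (fun k τ => torusCoeff (g τ) k) Z (fun κ => torusCoeff (f κ)) k τ := by
  rw [torusCoeff_sub (hg τ).continuous (smoothTorus_dataEv hf τ Z).continuous,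
    torusCoeff_dataEv hf]
  rfl

/-! ### The approximations -/

open scoped Matrix.Norms.Operator in
lemma exp_mulVec_of_eigen {m : Type*} [Fintype m] [DecidableEq m] {B : Matrix m m ℝ} {v : m → ℝ}
    {c : ℝ} (h : B.mulVec v = c • v) : (NormedSpace.exp B).mulVec v = Real.exp c • v := by
  have hpow : ∀ n : ℕ, (B ^ n).mulVec v = c ^ n • v := by
    intro n
    induction n with
    | zero => simp
    | succ n ih => rw [pow_succ, ← Matrix.mulVec_mulVec, h, Matrix.mulVec_smul, ih, smul_smul,
        pow_succ, mul_comm]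
  have h1 := NormedSpace.exp_series_hasSum_exp' (𝕂 := ℝ) B
  let T : Matrix m m ℝ →ₗ[ℝ] (m → ℝ) :=
    { toFun := fun A => A.mulVec v
      map_add' := fun A A' => Matrix.add_mulVec A A' v
      map_smul' := fun a A => Matrix.smul_mulVec a A v }
  have h2 := h1.map T T.continuous_of_finiteDimensional
  have h3 := (NormedSpace.exp_series_hasSum_exp' (𝕂 := ℝ) c).smul_const v
  refine h2.unique ?_
  rw [Real.exp_eq_exp_ℝ]
  convert h3 using 1
  funext n
  change ((n.factorial⁻¹ : ℝ) • B ^ n).mulVec v = ((n.factorial⁻¹ : ℝ) • c ^ n) • v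
  rw [Matrix.smul_mulVec, hpow, smul_smul, smul_eq_mul]

lemma blockA_mulVec_eigVec (p : Fin 3 → ℝ) (μ : Fin 4) (σ : Bool) :
    (blockA p μ).mulVec (eigVec p (μ, σ)) = eig p (μ, σ) • eigVec p (μ, σ) := by
  funext c
  fin_cases c
  · simp [blockA, eigVec, Matrix.mulVec, dotProduct]
  · simp only [blockA, eigVec, Matrix.mulVec, dotProduct, Fin.sum_univ_two]
    cases σ <;> simp [eig_true, eig_false] <;> ring

lemma exp_blockA_mulVec (p : Fin 3 → ℝ) (μ : Fin 4) (σ : Bool) (t : ℝ) :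
    (NormedSpace.exp (t • blockA p μ)).mulVec (eigVec p (μ, σ)) =
      Real.exp (eig p (μ, σ) * t) • eigVec p (μ, σ) := by
  refine exp_mulVec_of_eigen ?_
  rw [Matrix.smul_mulVec, blockA_mulVec_eigVec, smul_smul, mul_comm]

/-- The linear form b - λ a annihilates the eigenvector (1, λ), so it reads off the coordinate along
the other one. -/
lemma eq_sum_eigVec {p : Fin 3 → ℝ} (hp : IsKasner p) (μ : Fin 4) (a b : ℝ) :
    ![a, b] = ∑ σ : Bool, ((b - eig p (μ, !σ) * a) / (eig p (μ, σ) - eig p (μ, !σ))) •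
      eigVec p (μ, σ) := by
  have h := eig_ne hp μ true
  have h' := eig_ne hp μ false
  simp only [Bool.not_true, Bool.not_false] at h h'
  rw [Fintype.sum_bool]
  simp only [Bool.not_true, Bool.not_false]
  rw [show eig p (μ, false) - eig p (μ, true) = -(eig p (μ, true) - eig p (μ, false)) by ring]
  funext c
  fin_cases c
  · simp only [eigVec, Pi.add_apply, Pi.smul_apply, smul_eq_mul]
    simp
    field_simp
    ring
  · simp only [eigVec, Pi.add_apply, Pi.smul_apply, smul_eq_mul]
    simp
    field_simp
    ring

/-- The data of the approximations for given data at infinity. -/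
def approxData (p : Fin 3 → ℝ) (f : DataIndex → (Fin 3 → ℝ) → ℝ) (n : ℕ) (κ : DataIndex)
    (x : Fin 3 → ℝ) : ℝ :=
  ∑ κ', diffOp (approxCoef p n κ κ') (f κ') x

/-- Duhamel's formula. With y the solution with zero initial data and W_σ the result of applying ∂
minus the other eigenvalue to y, one has W_σ' = λ_σ W_σ + S and W_σ(0) = 0. Hence e^{λ_σ(τ-r)}
W_σ(r) is an antiderivative of the σ-component of the integrand. -/
lemma integral_exp_blockA {p : Fin 3 → ℝ} (hp : IsKasner p) (f : DataIndex → (Fin 3 → ℝ) → ℝ)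
    (x : Fin 3 → ℝ) (μ : Fin 4) (S : DataIndex → ExpPoly) (τ : ℝ) :
    ∫ r in (0 : ℝ)..τ, (NormedSpace.exp ((τ - r) • blockA p μ)).mulVec ![0, dataEv f x r S] =
      ![dataEv f x τ fun κ => solveZero p μ (S κ),
        dataEv f x τ fun κ => dτ (solveZero p μ (S κ))] := by
  set W : Bool → ℝ → ℝ := fun σ r =>
    dataEv f x r fun κ => dSub (eig p (μ, !σ)) (solveZero p μ (S κ)) with hW
  have hWd : ∀ σ r, HasDerivAt (W σ) (eig p (μ, σ) * W σ r + dataEv f x r S) r := by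
    intro σ r
    refine (hasDerivAt_dataEv f x r _).congr_deriv ?_
    have := dataEv_dSub f x r (eig p (μ, σ)) fun κ => dSub (eig p (μ, !σ)) (solveZero p μ (S κ))
    simp only [dSub_solveZero] at this
    simp only [hW]
    linarith
  have hW0 : ∀ σ, W σ 0 = 0 := fun σ => by
    simp only [hW, dataEv, ev_zero, atZero_dSub_solveZero hp, map_zero, Finset.sum_const_zero]
  have hS : Continuous fun r => dataEv f x r S := continuous_iff_continuousAt.2 fun r =>
    (hasDerivAt_dataEv f x r S).continuousAt
  have h1 : ∀ r, (NormedSpace.exp ((τ - r) • blockA p μ)).mulVec ![0, dataEv f x r S] =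
      ∑ σ : Bool, (Real.exp (eig p (μ, σ) * (τ - r)) * dataEv f x r S /
        (eig p (μ, σ) - eig p (μ, !σ))) • eigVec p (μ, σ) := by
    intro r
    rw [eq_sum_eigVec hp μ 0 (dataEv f x r S), Matrix.mulVec_sum]
    refine Finset.sum_congr rfl fun σ _ => ?_
    rw [Matrix.mulVec_smul, exp_blockA_mulVec, smul_smul, mul_zero, sub_zero]
    congr 1
    ring
  have h2 : ∀ r, HasDerivAt (fun r => ∑ σ : Bool, (Real.exp (eig p (μ, σ) * (τ - r)) * W σ r /
        (eig p (μ, σ) - eig p (μ, !σ))) • eigVec p (μ, σ))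
      (∑ σ : Bool, (Real.exp (eig p (μ, σ) * (τ - r)) * dataEv f x r S /
        (eig p (μ, σ) - eig p (μ, !σ))) • eigVec p (μ, σ)) r := by
    intro r
    refine HasDerivAt.fun_sum fun σ _ => HasDerivAt.smul_const ?_ _
    refine HasDerivAt.div_const ?_ _
    have h3 : HasDerivAt (fun r => Real.exp (eig p (μ, σ) * (τ - r)))
        (Real.exp (eig p (μ, σ) * (τ - r)) * (-eig p (μ, σ))) r := by
      simpa using (((hasDerivAt_id r).const_sub τ).const_mul (eig p (μ, σ))).exp
    refine (h3.mul (hWd σ r)).congr_deriv ?_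
    ring
  rw [intervalIntegral.integral_congr fun r _ => h1 r,
    intervalIntegral.integral_eq_sub_of_hasDerivAt fun r _ => h2 r]
  · simp only [hW0, mul_zero, zero_div, zero_smul, Finset.sum_const_zero, sub_zero, sub_self,
      Real.exp_zero, one_mul]
    rw [eq_sum_eigVec hp μ]
    refine Finset.sum_congr rfl fun σ _ => ?_
    simp only [hW, dataEv_dSub]
  · refine Continuous.intervalIntegrable ?_ _ _
    fun_prop

lemma approx_eq {p : Fin 3 → ℝ} (hp : IsKasner p) {f : DataIndex → (Fin 3 → ℝ) → ℝ}
    (hf : ∀ κ, SmoothTorus (f κ)) (n : ℕ) (μ : Fin 4) (τ : ℝ) (x : Fin 3 → ℝ) :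
    approx p (approxData p f) n μ τ x =
      ![dataEv f x τ fun κ => approxSeries p n κ μ,
        dataEv f x τ fun κ => dτ (approxSeries p n κ μ)] := by
  induction n generalizing μ τ x with
  | zero =>
    funext c
    fin_cases c <;> simp [approx, approxSeries, dataEv]
  | succ n ih =>
    have hs : ∀ r, spatialOp p r (fun ν y => approx p (approxData p f) n ν r y 0) μ x =
        dataEv f x r fun κ => opD p (approxSeries p n κ) μ := by
      intro r
      simp only [ih, Matrix.cons_val_zero]
      unfold dataEv
      rw [spatialOp_sum (u := fun κ ν y => ev (opAt (f κ) y) r (approxSeries p n κ ν)) _ _ _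
        fun κ _ ν => smoothTorus_ev (hf κ) r _]
      exact Finset.sum_congr rfl fun κ _ => spatialOp_ev (hf κ) p r _ μ x
    have h1 : approx p (approxData p f) (n + 1) μ τ x =
        (NormedSpace.exp (τ • blockA p μ)).mulVec
          (∑ σ : Bool, approxData p f (n + 1) (μ, σ) x • eigVec p (μ, σ))
        + ∫ r in (0 : ℝ)..τ, (NormedSpace.exp ((τ - r) • blockA p μ)).mulVec
          ![0, spatialOp p r (fun ν y => approx p (approxData p f) n ν r y 0) μ x] := rfl
    rw [h1]
    simp only [hs]
    rw [integral_exp_blockA hp, Matrix.mulVec_sum]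
    have h2 : ∀ b (c : DataIndex → Op), dataEv f x τ (fun κ => c κ • mono b 0) =
        Real.exp (-b * τ) * ∑ κ, diffOp (c κ) (f κ) x := fun b c => by
      simp only [dataEv, ev_opAt_smul_mono, pow_zero, mul_one, Finset.mul_sum]
    have h3 : ∀ b (c : DataIndex → Op), dataEv f x τ (fun κ => dτ (c κ • mono b 0)) =
        -b * (Real.exp (-b * τ) * ∑ κ, diffOp (c κ) (f κ) x) := fun b c => by
      have e : ∀ κ, dτ (c κ • mono b 0) = (-b) • c κ • mono b 0 := fun κ => by
        rw [map_smul, dτ_mono, Nat.cast_zero, zero_smul, add_zero, smul_comm]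
      rw [← h2]
      simp only [dataEv, e, map_smul, smul_eq_mul, Finset.mul_sum]
    have h4 : ∀ σ : Bool, (NormedSpace.exp (τ • blockA p μ)).mulVec
        (approxData p f (n + 1) (μ, σ) x • eigVec p (μ, σ)) =
        ![dataEv f x τ fun κ => approxCoef p (n + 1) (μ, σ) κ • mono (-eig p (μ, σ)) 0,
          dataEv f x τ fun κ => dτ (approxCoef p (n + 1) (μ, σ) κ • mono (-eig p (μ, σ)) 0)] := by
      intro σ
      rw [Matrix.mulVec_smul, exp_blockA_mulVec, h2, h3, neg_neg, smul_smul, ← approxData]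
      funext c
      fin_cases c <;> simp [eigVec] <;> ring
    simp only [h4, Fintype.sum_bool, approxSeries_succ, dataEv_add, map_add]
    funext c
    fin_cases c <;> simp

/-! ### Existence of the asymptotic data -/

lemma one_add_le_bracket (τ : ℝ) : 1 + τ ≤ 2 * bracket τ := by
  have h1 : 1 ≤ bracket τ := Real.one_le_sqrt.2 (by nlinarith)
  have h2 : τ ≤ bracket τ := Real.le_sqrt_of_sq_le (by nlinarith)
  linarith

lemma RapidO.bracket {f : (Fin 3 → ℤ) → ℝ → ℂ} {M N : ℕ} {β : ℝ} {h : ℝ → ℝ}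
    (hf : RapidO f fun τ => (1 + τ) ^ M * decay β τ) (hMN : M ≤ N)
    (hh : ∀ τ, h τ = decay β τ) : RapidO f fun τ => bracket τ ^ N * h τ := by
  refine hf.mono (2 ^ N) fun τ hτ => ?_
  have h1 := decay_pos β τ
  have h2 : (1 + τ) ^ M ≤ (2 * Kasner.bracket τ) ^ N :=
    (pow_le_pow_right₀ (by linarith) hMN).trans
      (pow_le_pow_left₀ (by linarith) (one_add_le_bracket τ) N)
  rw [hh, ← mul_assoc, ← mul_pow]
  exact ⟨by positivity, by gcongr⟩

/-- Unlike `ResDecay.change`, this keeps the borderline rate β and pays with a power of 1 + τ, which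
depends only on Y and Z. -/
lemma exists_rapidO_residual {β : ℝ} {Y Z : DataIndex → ExpPoly}
    (hYZ : ∀ κ, Y κ - Z κ ∈ expIn (Set.Ici β)) :
    ∃ N : ℕ, ∀ (z : (Fin 3 → ℤ) → ℝ → ℂ) (d : DataIndex → (Fin 3 → ℤ) → ℂ), (∀ κ, Rapid (d κ)) →
      RapidO (residual z Y d) (decay β) →
        RapidO (residual z Z d) fun τ => (1 + τ) ^ N * decay β τ := by
  choose N hN using fun κ => exists_rapidO_modeEv (hYZ κ)
  have hpow : ∀ (M : ℕ), M ≤ ∑ κ, N κ → ∀ g : (Fin 3 → ℤ) → ℝ → ℂ,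
      RapidO g (fun τ => (1 + τ) ^ M * decay β τ) →
      RapidO g fun τ => (1 + τ) ^ (∑ κ, N κ) * decay β τ := fun M hM g hg =>
    hg.mono 1 fun τ hτ => by
      have h1 := decay_pos β τ
      have h2 : (1 + τ) ^ M ≤ (1 + τ) ^ (∑ κ, N κ) := pow_le_pow_right₀ (by linarith) hM
      exact ⟨by positivity, by rw [one_mul]; gcongr⟩
  refine ⟨∑ κ, N κ, fun z d hd hz => RapidO.residual_change (Y := Y) (hpow 0 (Nat.zero_le _) _ ?_)
    fun κ => hpow _ (Finset.single_le_sum (fun _ _ => Nat.zero_le _) (Finset.mem_univ κ)) _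
      (hN κ (d κ) (hd κ))⟩
  simpa using hz

lemma IsWaveSolution.withDeriv_hatComp {p : Fin 3 → ℝ} {ω : (Fin 4 → ℝ) → Fin 4 → ℝ}
    (hω : IsWaveSolution p ω) (μ : Fin 4) (τ : ℝ) (x : Fin 3 → ℝ) :
    withDeriv (hatComp p ω μ) τ x = ![hatFam p ω μ (τ, x), dt (hatFam p ω μ) (τ, x)] := by
  rw [withDeriv, ← ((hω.smoothFamily μ).hasDerivAt τ x).deriv]
  rfl

/-- The asymptotic data of a solution in terms of the data at infinity. -/
def asympData (p : Fin 3 → ℝ) (f : DataIndex → (Fin 3 → ℝ) → ℝ) (κ : DataIndex) (x : Fin 3 → ℝ) :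
    ℝ := ∑ κ', diffOp (dataMatrix p κ κ') (f κ') x

lemma isAsymptoticData_asympData {p : Fin 3 → ℝ} (hp : IsKasner p)
    {ω : (Fin 4 → ℝ) → Fin 4 → ℝ} (hω : IsWaveSolution p ω) {f : DataIndex → (Fin 3 → ℝ) → ℝ}
    (hf : ∀ κ, SmoothTorus (f κ))
    (hres : ∀ (n : ℕ) (β : ℝ), β < n * (1 - p 2) →
        ResDecay p (fun μ k τ => torusCoeff (fun x => hatFam p ω μ (τ, x)) k)
          (fun μ k τ => torusCoeff (fun x => dt (hatFam p ω μ) (τ, x)) k)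
          (fun κ => torusCoeff (f κ)) n β) :
    IsAsymptoticData p ω (asympData p f) := by
  have hg := hp.gap_pos
  refine ⟨approxData p f, fun n κ => smoothTorus_sum _ fun κ' _ => (hf κ').diffOp _,
    fun n κ hn hκ => ?_, fun n _ => ?_, fun κ => rfl⟩
  · funext x
    simp only [approxData, approxCoef_eq_zero p hn hκ, diffOp_zero, Finset.sum_const_zero,
      Pi.zero_apply]
  -- The series of order n + 1 is the intermediary. The residual of the solution with respect to it
  -- has rate n(1 - p_3) without polynomial factor, and its difference from the n-th approximation
  -- has exponents at least n(1 - p_3).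
  have hmem : ∀ μ κ, series p (n + 1) κ μ - approxSeries p n κ μ ∈
      expIn (Set.Ici (n * (1 - p 2))) := fun μ κ => by
    rw [← sub_sub_sub_cancel_right _ _ (series p n κ μ)]
    exact sub_mem (series_succ_sub_mem hp n κ μ) (approxSeries_sub_mem hp n κ μ)
  choose N₀ hN₀ using fun μ => exists_rapidO_residual (hmem μ)
  choose N₁ hN₁ using fun μ => exists_rapidO_residual (β := n * (1 - p 2))
    (Y := fun κ => dτ (series p (n + 1) κ μ)) (Z := fun κ => dτ (approxSeries p n κ μ))
    fun κ => by rw [← map_sub]; exact dτ_mem (hmem μ κ)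
  refine ⟨∑ μ, (N₀ μ + N₁ μ), fun μ => sobolevO_of_rapidO fun c => ?_⟩
  have hle : N₀ μ + N₁ μ ≤ ∑ μ, (N₀ μ + N₁ μ) :=
    Finset.single_le_sum (f := fun μ => N₀ μ + N₁ μ) (fun _ _ => Nat.zero_le _) (Finset.mem_univ μ)
  have hr := hres (n + 1) (n * (1 - p 2)) (by push_cast; linarith) μ
  have hrap := fun κ => rapid_torusCoeff (hf κ)
  have hdec : ∀ τ, Real.exp (-(n : ℝ) * (1 - p 2) * τ) = decay (n * (1 - p 2)) τ := fun τ => by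
    rw [decay]; congr 1; ring
  simp only [hω.withDeriv_hatComp, approx_eq hp hf]
  fin_cases c
  · refine ((hN₀ μ _ _ hrap hr.1).bracket (by omega) hdec).congr fun k τ _ => ?_
    simp only [Fin.zero_eta, Pi.sub_apply, Matrix.cons_val_zero]
    exact torusCoeff_sub_dataEv hf (g := fun τ x => hatFam p ω μ (τ, x))
      (fun τ => (hω.smoothFamily μ).slice τ) _ k τ
  · have h1 := hN₁ μ _ _ hrap hr.2
    have h2 := h1.bracket (by omega : N₁ μ ≤ ∑ μ, (N₀ μ + N₁ μ)) hdec
    refine h2.congr fun k τ _ => ?_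
    have h3 := torusCoeff_sub_dataEv hf (g := fun τ x => dt (hatFam p ω μ) (τ, x))
      (fun τ => (hω.smoothFamily μ).dt.slice τ) (fun κ => dτ (approxSeries p n κ μ)) k τ
    simp only [Fin.mk_one, Pi.sub_apply, Matrix.cons_val_one]
    exact h3

open ExpPoly

/-! ### Enumeration of the exponents -/

/-- Every nonempty subset of S has a minimum, so there is a successor function. An element that is
never reached would have infinitely many elements of S below it. -/
lemma exists_enumeration {S : Set ℝ} (hinf : S.Infinite) (hfin : ∀ B, (S ∩ Set.Iio B).Finite) :
    ∃ e : ℕ → ℝ, StrictMono e ∧ Set.range e = S := by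
  have hmin : ∀ T ⊆ S, T.Nonempty → ∃ m ∈ T, ∀ t ∈ T, m ≤ t := by
    rintro T hT ⟨t, ht⟩
    have h1 : (T ∩ Set.Iio (t + 1)).Finite :=
      (hfin (t + 1)).subset (Set.inter_subset_inter_left _ hT)
    obtain ⟨m, hm, hm'⟩ := Set.exists_min_image _ id h1 ⟨t, ht, lt_add_one t⟩
    refine ⟨m, hm.1, fun s hs => ?_⟩
    by_cases hst : s < t + 1
    · exact hm' s ⟨hs, hst⟩
    · exact (hm' t ⟨ht, lt_add_one t⟩).trans (by simp only [id]; linarith)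
  have hnext : ∀ b : ℝ, ∃ m ∈ S, b < m ∧ ∀ t ∈ S, b < t → m ≤ t := fun b => by
    obtain ⟨s, hs, hs'⟩ := hinf.exists_notMem_finite (hfin (b + 1))
    have hbs : b < s := by
      by_contra h
      exact hs' ⟨hs, by simp only [Set.mem_Iio]; linarith⟩
    obtain ⟨m, hm, hm'⟩ := hmin (S ∩ Set.Ioi b) Set.inter_subset_left ⟨s, hs, hbs⟩
    exact ⟨m, hm.1, hm.2, fun t ht hbt => hm' t ⟨ht, hbt⟩⟩
  choose next h1 h2 h3 using hnext
  obtain ⟨m₀, _, hm₀⟩ := hmin S subset_rfl hinf.nonempty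
  -- The starting point m₀ - 1 lies below S, so the first application of the successor function
  -- lands on the minimum.
  let e : ℕ → ℝ := fun n => next^[n + 1] (m₀ - 1)
  have he : ∀ n, e (n + 1) = next (e n) := fun n => Function.iterate_succ_apply' next (n + 1) _
  have hmono : StrictMono e := strictMono_nat_of_lt_succ fun n => by rw [he]; exact h2 _
  have hmem : ∀ n, e n ∈ S := fun n => by
    cases n with
    | zero => exact h1 _
    | succ n => rw [he]; exact h1 _
  refine ⟨e, hmono, Set.Subset.antisymm (Set.range_subset_iff.2 hmem) fun s hs => ?_⟩
  by_contra hn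
  have hlt : ∀ n, e n < s := by
    intro n
    refine lt_of_le_of_ne ?_ fun h => hn ⟨n, h⟩
    induction n with
    | zero => exact h3 _ s hs (by linarith [hm₀ s hs])
    | succ n ih =>
      rw [he]
      exact h3 _ s hs (lt_of_le_of_ne ih fun h => hn ⟨n, h⟩)
  exact Set.infinite_range_of_injective hmono.injective
    ((hfin s).subset (Set.range_subset_iff.2 fun n => ⟨hmem n, hlt n⟩))

/-- The decay rate of the leading term of `ω_μ`. -/
def leadRate (p : Fin 3 → ℝ) (μ : Fin 4) : ℝ := leadExp p μ - (1 - wt p μ)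

lemma leadRate_zero (p : Fin 3 → ℝ) : leadRate p 0 = 0 := by simp [leadRate, leadExp, wt]

lemma leadRate_one (p : Fin 3 → ℝ) : leadRate p (Fin.succ 0) = 2 * p 0 := by
  simp only [leadRate, leadExp, wt, Fin.cons_succ, if_true]; ring

lemma leadRate_succ (p : Fin 3 → ℝ) {i : Fin 3} (hi : i ≠ 0) : leadRate p i.succ = 0 := by
  simp only [leadRate, leadExp, wt, Fin.cons_succ, hi, if_false, sub_self]

/-- The decay rates of the corrections to `ω_μ`. -/
def rateSet (p : Fin 3 → ℝ) (μ : Fin 4) : Set ℝ :=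
  {b | b + (1 - wt p μ) ∈ expSet p μ ∧ leadRate p μ < b}

/-- The smallest decay rate of the corrections to `ω_μ`. -/
def minRate (p : Fin 3 → ℝ) : Fin 4 → ℝ :=
  Fin.cons (2 * (1 - p 2)) fun i => if i = 0 then min (2 * p 0 + 2 * (1 - p 2)) 0 else 2 * (1 - p 2)

section

variable {p : Fin 3 → ℝ} (hp : IsKasner p)

include hp

lemma sum_exp_eq_zero_or_le (m : Fin 3 → ℕ) : ∑ i, 2 * (m i : ℝ) * (1 - p i) = 0 ∨
    2 * (1 - p 2) ≤ ∑ i, 2 * (m i : ℝ) * (1 - p i) := by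
  by_cases h : ∀ i, m i = 0
  · left
    simp [h]
  · right
    push Not at h
    obtain ⟨i, hi⟩ := h
    have h1 : 2 * (m i : ℝ) * (1 - p i) ≤ ∑ i, 2 * (m i : ℝ) * (1 - p i) :=
      Finset.single_le_sum (f := fun i => 2 * (m i : ℝ) * (1 - p i)) (fun j _ => by
        have := hp.lt_one' j
        have : 0 < 1 - p j := by linarith
        positivity) (Finset.mem_univ i)
    have h2 : (1 : ℝ) ≤ m i := by exact_mod_cast Nat.one_le_iff_ne_zero.2 hi
    have h3 := hp.le_two i
    have h4 := hp.gap_pos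
    nlinarith

lemma abs_wt_le (μ : Fin 4) : |wt p μ| ≤ 1 := by
  refine Fin.cases ?_ (fun i => ?_) μ
  · simp [wt]
  · simp only [wt, Fin.cons_succ]
    exact abs_le_one_of_sum_sq hp.sum_sq i

/-- The three base exponents are nonnegative and every 1 - p_i is at least 1 - p_3 > 0, so a bound
on the sum bounds the multiplicities. -/
lemma expSet_inter_finite (μ : Fin 4) (B : ℝ) : (expSet p μ ∩ Set.Iio B).Finite := by
  have hg := hp.gap_pos
  obtain ⟨K, hK⟩ := exists_nat_gt (B / (2 * (1 - p 2)))
  rw [div_lt_iff₀ (by linarith)] at hK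
  have hS : (({1 - wt p μ, 1 + wt p μ, 3 - wt p μ} : Set ℝ) ×ˢ
      Set.Iic (fun _ : Fin 3 => K)).Finite := (Set.toFinite _).prod (Set.finite_Iic _)
  refine (hS.image fun x => x.1 + ∑ i, 2 * (x.2 i : ℝ) * (1 - p i)).subset ?_
  rintro b ⟨⟨s, hs, m, rfl⟩, hb⟩
  refine ⟨(s, m), ⟨hs, fun i => ?_⟩, rfl⟩
  simp only [Set.mem_Iio] at hb
  have hs0 : 0 ≤ s := by
    have := abs_le.1 (abs_wt_le hp μ)
    simp only [Set.mem_insert_iff, Set.mem_singleton_iff] at hs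
    rcases hs with rfl | rfl | rfl <;> linarith
  have h1 : 2 * (m i : ℝ) * (1 - p i) ≤ ∑ i, 2 * (m i : ℝ) * (1 - p i) :=
    Finset.single_le_sum (f := fun i => 2 * (m i : ℝ) * (1 - p i)) (fun j _ => by
      have := hp.lt_one' j
      have : 0 < 1 - p j := by linarith
      positivity) (Finset.mem_univ i)
  have h2 : 2 * (m i : ℝ) * (1 - p 2) ≤ 2 * (m i : ℝ) * (1 - p i) := by
    have := hp.le_two i
    gcongr
  have h3 : (m i : ℝ) < K := by nlinarith
  exact_mod_cast h3.le

lemma rateSet_inter_finite (μ : Fin 4) (B : ℝ) : (rateSet p μ ∩ Set.Iio B).Finite := by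
  refine Set.Finite.subset ((expSet_inter_finite hp μ (B + (1 - wt p μ))).image
    fun b => b - (1 - wt p μ)) ?_
  rintro b ⟨⟨h1, _⟩, h2⟩
  refine ⟨b + (1 - wt p μ), ⟨h1, ?_⟩, by ring⟩
  simp only [Set.mem_Iio] at h2 ⊢
  linarith

lemma leadRate_nonpos (μ : Fin 4) : leadRate p μ ≤ 0 := by
  refine Fin.cases (leadRate_zero p).le (fun i => ?_) μ
  by_cases hi : i = 0
  · subst hi
    rw [leadRate_one]
    linarith [hp.zero_neg]
  · exact (leadRate_succ p hi).le

omit hp in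
lemma sum_exp_single (p : Fin 3 → ℝ) (k : ℕ) :
    ∑ i, 2 * ((Pi.single 2 k : Fin 3 → ℕ) i : ℝ) * (1 - p i) = 2 * k * (1 - p 2) := by
  rw [Finset.sum_eq_single 2]
  · simp
  · intro i _ hi; simp [hi]
  · simp

lemma rateSet_infinite (μ : Fin 4) : (rateSet p μ).Infinite := by
  have hg := hp.gap_pos
  refine Set.infinite_of_injective_forall_mem (f := fun k : ℕ => 2 * ((k + 1 : ℕ) : ℝ) * (1 - p 2))
    (fun k l h => ?_) fun k => ⟨?_, ?_⟩
  · have h1 := mul_right_cancel₀ hg.ne' h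
    have h2 := mul_left_cancel₀ two_ne_zero h1
    have : k + 1 = l + 1 := by exact_mod_cast h2
    omega
  · have := mem_expSet_of (p := p) (μ := μ) (s := 1 - wt p μ) (by simp) (Pi.single 2 (k + 1))
    rw [sum_exp_single] at this
    rwa [add_comm]
  · refine (leadRate_nonpos hp μ).trans_lt ?_
    positivity

/-- From 1 - `p 2` = `p 0` + `p 1` < `p 1` ≤ p_i one gets 2(1 - p_3) < 2p_i in the components 2 and
3. In component 1 the candidates above 2`p 0` are 0 and the first shift of 2`p 0`. -/
lemma minRate_le {μ : Fin 4} {b : ℝ} (hb : b ∈ rateSet p μ) : minRate p μ ≤ b := by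
  obtain ⟨⟨s, hs, m, hm⟩, hlt⟩ := hb
  have h0 := sum_exp_nonneg hp m
  have h1 := sum_exp_eq_zero_or_le hp m
  generalize ∑ i, 2 * (m i : ℝ) * (1 - p i) = A at *
  have hg := hp.gap_pos
  have hsum := hp.sum'
  have hp0 := hp.zero_neg
  have hp1 := hp.one_lt
  have h12 := hp.le_two 1
  revert hs hm hlt
  refine Fin.cases (fun hlt hs hm => ?_) (fun i hlt hs hm => ?_) μ
  · rw [leadRate_zero] at hlt
    simp only [minRate, wt, Fin.cons_zero, Set.mem_insert_iff, Set.mem_singleton_iff] at *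
    rcases h1 with h1 | h1 <;> rcases hs with hs | hs | hs <;> linarith
  · by_cases hi : i = 0
    · subst hi
      rw [leadRate_one] at hlt
      simp only [minRate, wt, Fin.cons_succ, Set.mem_insert_iff, Set.mem_singleton_iff,
        if_true] at *
      rcases hs with hs | hs | hs
      · exact (min_le_right _ _).trans (by linarith)
      · refine (min_le_left _ _).trans ?_
        rcases h1 with h1 | h1 <;> linarith
      · exact (min_le_right _ _).trans (by linarith)
    · rw [leadRate_succ p hi] at hlt
      have h1i : p 1 ≤ p i := hp.mono (by omega)
      simp only [minRate, wt, Fin.cons_succ, Set.mem_insert_iff, Set.mem_singleton_iff,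
        if_neg hi] at *
      rcases h1 with h1 | h1 <;> rcases hs with hs | hs | hs <;> linarith

lemma minRate_mem (μ : Fin 4) : minRate p μ ∈ rateSet p μ := by
  have hg := hp.gap_pos
  have h0 := hp.zero_neg
  have hmain : ∀ μ, leadRate p μ = 0 → 2 * (1 - p 2) ∈ rateSet p μ := fun μ hμ => by
    refine ⟨?_, by rw [hμ]; linarith⟩
    have := mem_expSet_of (p := p) (μ := μ) (s := 1 - wt p μ) (by simp) (Pi.single 2 1)
    rw [sum_exp_single] at this
    convert this using 1; push_cast; ring
  refine Fin.cases (hmain 0 (leadRate_zero p)) (fun i => ?_) μ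
  by_cases hi : i = 0
  · subst hi
    simp only [minRate, Fin.cons_succ, if_true]
    rcases min_choice (2 * p 0 + 2 * (1 - p 2)) 0 with e | e <;> rw [e]
    · refine ⟨?_, by rw [leadRate_one]; linarith⟩
      have := mem_expSet_of (p := p) (μ := Fin.succ 0) (s := 1 + wt p (Fin.succ 0)) (by simp)
        (Pi.single 2 1)
      rw [sum_exp_single] at this
      convert this using 1
      simp only [wt, Fin.cons_succ]
      push_cast; ring
    · refine ⟨?_, by rw [leadRate_one]; linarith⟩
      have := mem_expSet_of (p := p) (μ := Fin.succ 0) (s := 1 - wt p (Fin.succ 0)) (by simp) 0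
      simpa using this
  · simp only [minRate, Fin.cons_succ, if_neg hi]
    exact hmain _ (leadRate_succ p hi)

lemma exists_rates (μ : Fin 4) :
    ∃ e : ℕ → ℝ, StrictMono e ∧ Set.range e = rateSet p μ ∧ e 0 = minRate p μ := by
  obtain ⟨e, h1, h2⟩ := exists_enumeration (rateSet_infinite hp μ) (rateSet_inter_finite hp μ)
  refine ⟨e, h1, h2, le_antisymm ?_ (minRate_le hp (h2 ▸ ⟨0, rfl⟩))⟩
  obtain ⟨j, hj⟩ : minRate p μ ∈ Set.range e := h2 ▸ minRate_mem hp μ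
  rw [← hj]
  exact h1.monotone (Nat.zero_le j)

lemma exists_cutoff {μ : Fin 4} {e : ℕ → ℝ} (he : StrictMono e) (hr : Set.range e = rateSet p μ)
    (B : ℝ) : ∃ q : ℕ, ∀ k, k < q ↔ e k < B := by
  classical
  have hex : ∃ k, B ≤ e k := by
    by_contra h
    push Not at h
    exact Set.infinite_range_of_injective he.injective ((rateSet_inter_finite hp μ B).subset
      (Set.range_subset_iff.2 fun n => ⟨hr ▸ ⟨n, rfl⟩, h n⟩))
  refine ⟨Nat.find hex, fun k => ⟨fun h => not_le.1 (Nat.find_min hex h), fun h => ?_⟩⟩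
  by_contra hk
  exact absurd h (not_lt.2 ((Nat.find_spec hex).trans (he.monotone (not_lt.1 hk))))

/-- For n = 1 the rate of the error does not exceed the first rate of the corrections, so the sum is
empty. -/
lemma sub_le_minRate (μ : Fin 4) : (1 - p 2) - (1 - wt p μ) ≤ minRate p μ := by
  have hg := hp.gap_pos
  refine Fin.cases ?_ (fun i => ?_) μ
  · simp only [minRate, wt, Fin.cons_zero]; linarith
  · have h1 := hp.lt_one' i
    have h2 := hp.le_two i
    have h3 := hp.neg_one_lt 0
    simp only [minRate, wt, Fin.cons_succ]
    split_ifs with hi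
    · subst hi
      exact le_min (by linarith) (by linarith)
    · linarith

end

/-! ### The series in terms of the modified data -/

/-- The leading terms of the series. -/
def hatLead (p : Fin 3 → ℝ) (μ : Fin 4) (κ : DataIndex) : ExpPoly :=
  (Fin.cons ((if κ = (0, true) then (1 : Op) else 0) • mono 0 0) (fun i : Fin 3 =>
    if i = 0 then (if κ = leadIndex 0 then (1 : Op) else 0) • mono (1 + p 0) 0
    else (if κ = leadIndex i then (1 : Op) else 0) • mono (1 - p i) 0
      + (if κ = (0, true) then (MvPolynomial.X i : Op) else 0) • mono (1 - p i) 1) :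
    Fin 4 → ExpPoly) μ

lemma leadIndex_zero : leadIndex 0 = (Fin.succ 0, false) := by simp [leadIndex]

lemma leadIndex_of_ne {i : Fin 3} (hi : i ≠ 0) : leadIndex i = (i.succ, true) := by
  simp [leadIndex, hi]

lemma hatLead_zero (p : Fin 3 → ℝ) (κ : DataIndex) :
    hatLead p 0 κ = (if κ = (0, true) then (1 : Op) else 0) • mono 0 0 := rfl

lemma hatLead_one (p : Fin 3 → ℝ) (κ : DataIndex) : hatLead p (Fin.succ 0) κ =
    (if κ = leadIndex 0 then (1 : Op) else 0) • mono (1 + p 0) 0 := rfl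

lemma hatLead_succ (p : Fin 3 → ℝ) (κ : DataIndex) {i : Fin 3} (hi : i ≠ 0) : hatLead p i.succ κ =
    (if κ = leadIndex i then (1 : Op) else 0) • mono (1 - p i) 0
      + (if κ = (0, true) then (MvPolynomial.X i : Op) else 0) • mono (1 - p i) 1 := by
  rw [hatLead, Fin.cons_succ, if_neg hi]

lemma leadExp_one (p : Fin 3 → ℝ) : leadExp p (Fin.succ 0) = 1 + p 0 := rfl

lemma leadExp_succ (p : Fin 3 → ℝ) {i : Fin 3} (hi : i ≠ 0) : leadExp p i.succ = 1 - p i := by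
  rw [leadExp, Fin.cons_succ, if_neg hi]

lemma hatLead_mem (p : Fin 3 → ℝ) (μ : Fin 4) (κ : DataIndex) :
    hatLead p μ κ ∈ expIn {leadExp p μ} := by
  have hmono : ∀ (b : ℝ) (d : ℕ) (r : Op), r • mono b d ∈ expIn {b} := fun b d r =>
    Submodule.smul_mem _ _ (mono_mem_expIn (Set.mem_singleton b) d)
  refine Fin.cases ?_ (fun i => ?_) μ
  · rw [hatLead_zero]
    exact hmono 0 0 _
  · by_cases hi : i = 0
    · subst hi
      rw [hatLead_one, leadExp_one]
      exact hmono _ 0 _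
    · rw [hatLead_succ p κ hi, leadExp_succ p hi]
      exact add_mem (hmono _ 0 _) (hmono _ 1 _)

lemma series_sub_hatLead_mem {p : Fin 3 → ℝ} (hp : IsKasner p) (n : ℕ) (κ : DataIndex)
    (μ : Fin 4) : series p (n + 2) κ μ - hatLead p μ κ ∈ expIn (Set.Ioi (leadExp p μ)) := by
  refine Fin.cases (series_zero_lead hp (n + 1) κ) (fun i => ?_) μ
  by_cases hi : i = 0
  · subst hi
    rw [hatLead_one, leadExp_one, leadIndex_zero]
    exact series_one_lead hp (n + 1) κ
  · rw [hatLead_succ p κ hi, leadExp_succ p hi, leadIndex_of_ne hi]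
    exact series_succ_lead hp n κ hi

lemma mem_expIn_inter {S T : Set ℝ} {Z : ExpPoly} (hS : Z ∈ expIn S) (hT : Z ∈ expIn T) :
    Z ∈ expIn (S ∩ T) :=
  mem_expIn.2 fun b d h => ⟨mem_expIn.1 hS b d h, mem_expIn.1 hT b d h⟩

/-- The combination of a family of series which corresponds to the change of data `G`, multiplied
with `e^{cτ}`. -/
def comb (G : Matrix DataIndex DataIndex Op) (c : ℝ) (Z : DataIndex → ExpPoly) (κ : DataIndex) :
    ExpPoly := shift (-c) (∑ κ', G κ' κ • Z κ')

lemma comb_sub (G : Matrix DataIndex DataIndex Op) (c : ℝ) (Y Z : DataIndex → ExpPoly)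
    (κ : DataIndex) : comb G c Y κ - comb G c Z κ = comb G c (fun κ' => Y κ' - Z κ') κ := by
  simp only [comb, smul_sub, Finset.sum_sub_distrib, map_sub]

lemma comb_mem {S T : Set ℝ} {c : ℝ} (h : ∀ b ∈ S, b - c ∈ T) (G : Matrix DataIndex DataIndex Op)
    {Z : DataIndex → ExpPoly} (hZ : ∀ κ, Z κ ∈ expIn S) (κ : DataIndex) : comb G c Z κ ∈ expIn T :=
  shift_mem h (Submodule.sum_mem _ fun κ' _ => Submodule.smul_mem _ _ (hZ κ'))

/-- A series and its derivative. -/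
def withD (Z : DataIndex → ExpPoly) (c : Fin 2) (κ : DataIndex) : ExpPoly := ![Z κ, dτ (Z κ)] c

lemma withD_sub_mem {Y Z : DataIndex → ExpPoly} {S : Set ℝ} (h : ∀ κ, Y κ - Z κ ∈ expIn S)
    (c : Fin 2) (κ : DataIndex) : withD Y c κ - withD Z c κ ∈ expIn S := by
  fin_cases c
  · exact h κ
  · have := dτ_mem (h κ)
    rw [map_sub] at this
    exact this

lemma withD_mem {Z : DataIndex → ExpPoly} {S : Set ℝ} (h : ∀ κ, Z κ ∈ expIn S)
    (c : Fin 2) (κ : DataIndex) : withD Z c κ ∈ expIn S := by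
  fin_cases c
  · exact h κ
  · exact dτ_mem (h κ)

/-- The series of `ω_μ`. -/
def tauSeries (p : Fin 3 → ℝ) (G : Matrix DataIndex DataIndex Op) (n : ℕ) (μ : Fin 4) :
    DataIndex → ExpPoly := comb G (1 - wt p μ) fun κ => series p n κ μ

/-- The leading term of the series of `ω_μ`. -/
def tauLead (p : Fin 3 → ℝ) (G : Matrix DataIndex DataIndex Op) (μ : Fin 4) :
    DataIndex → ExpPoly := comb G (1 - wt p μ) fun κ => hatLead p μ κ

lemma tauLead_mem (p : Fin 3 → ℝ) (G : Matrix DataIndex DataIndex Op) (μ : Fin 4) (κ : DataIndex) :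
    tauLead p G μ κ ∈ expIn {leadRate p μ} :=
  comb_mem (fun b hb => by rw [Set.mem_singleton_iff] at hb ⊢; rw [hb, leadRate]) G
    (hatLead_mem p μ) κ

lemma tauSeries_sub_tauLead_mem {p : Fin 3 → ℝ} (hp : IsKasner p)
    (G : Matrix DataIndex DataIndex Op) (n : ℕ) (μ : Fin 4) (κ : DataIndex) :
    tauSeries p G (n + 2) μ κ - tauLead p G μ κ ∈ expIn (rateSet p μ) := by
  rw [tauSeries, tauLead, comb_sub]
  refine comb_mem (S := (expSet p μ ∪ {leadExp p μ}) ∩ Set.Ioi (leadExp p μ)) ?_ G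
    (fun κ => mem_expIn_inter ?_ (series_sub_hatLead_mem hp n κ μ)) κ
  · rintro b ⟨hb | hb, hlt⟩
    · refine ⟨by rwa [sub_add_cancel], ?_⟩
      simp only [Set.mem_Ioi, leadRate] at hlt ⊢
      linarith
    · rw [Set.mem_singleton_iff] at hb
      exact absurd hb (ne_of_gt hlt)
  · exact sub_mem (expIn_mono Set.subset_union_left (series_mem_expSet p (n + 2) κ μ))
      (expIn_mono Set.subset_union_right (hatLead_mem p μ κ))

lemma tauSeries_sub_mem {p : Fin 3 → ℝ} (hp : IsKasner p) (G : Matrix DataIndex DataIndex Op)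
    (m n : ℕ) (μ : Fin 4) (κ : DataIndex) : tauSeries p G m μ κ - tauSeries p G n μ κ ∈
      expIn (Set.Ici ((min m n : ℕ) * (1 - p 2) - (1 - wt p μ))) := by
  rw [tauSeries, tauSeries, comb_sub]
  refine comb_mem (fun b hb => ?_) G (fun κ => series_sub_mem_min hp m n κ μ) κ
  simp only [Set.mem_Ici] at hb ⊢
  linarith

lemma polyAt_congr {Y Z : ExpPoly} {β b : ℝ} (h : Y - Z ∈ expIn (Set.Ici β)) (hb : b < β) :
    polyAt Y b = polyAt Z b := by
  ext1 d
  rw [coeff_polyAt, coeff_polyAt, ← sub_eq_zero, ← Finsupp.sub_apply]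
  by_contra h'
  exact absurd (mem_expIn.1 h b d h') (not_le.2 hb)

/-- The coefficient of `e^{-bτ}` in the expansions of `ω_μ` and its derivative. -/
def rateCoef (p : Fin 3 → ℝ) (G : Matrix DataIndex DataIndex Op) (μ : Fin 4) (b : ℝ) (c : Fin 2)
    (κ : DataIndex) : Polynomial Op :=
  polyAt (withD (tauSeries p G (⌊(b + (1 - wt p μ)) / (1 - p 2)⌋₊ + 1) μ) c κ) b

/-- From the order used in `rateCoef` on, the coefficient at the exponent b has stabilised. So the
polynomials P_{μk} do not depend on n. -/
lemma rateCoef_eq {p : Fin 3 → ℝ} (hp : IsKasner p) (G : Matrix DataIndex DataIndex Op) (μ : Fin 4)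
    {b : ℝ} {n : ℕ} (hb : b < n * (1 - p 2) - (1 - wt p μ)) (c : Fin 2) (κ : DataIndex) :
    rateCoef p G μ b c κ = polyAt (withD (tauSeries p G n μ) c κ) b := by
  refine polyAt_congr (withD_sub_mem (tauSeries_sub_mem hp G _ n μ) c κ) ?_
  have h1 := (div_lt_iff₀ hp.gap_pos).1
    (Nat.lt_floor_add_one ((b + (1 - wt p μ)) / (1 - p 2)))
  rcases min_choice (⌊(b + (1 - wt p μ)) / (1 - p 2)⌋₊ + 1) n with e | e <;> rw [e]
  · push_cast; linarith
  · exact hb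

/-- Below B a coefficient of T either sits at the exponent l, where T and Z agree because l is not
in S, or belongs to one of the first q values of e and is subtracted exactly once. -/
lemma sub_truncation_mem {T Z : ExpPoly} {S : Set ℝ} {l B : ℝ} (hT : T - Z ∈ expIn S)
    (hZ : Z ∈ expIn {l}) (hl : l ∉ S) {e : ℕ → ℝ} (he : StrictMono e) (hr : Set.range e = S)
    {q : ℕ} (hq : ∀ k, k < q ↔ e k < B) :
    T - (Z + ∑ k ∈ Finset.range q, T.filter fun x => x.1 = e k) ∈ expIn (Set.Ici B) := by
  refine mem_expIn.2 fun b d h => ?_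
  by_contra hb
  apply h
  rw [Set.mem_Ici, not_le] at hb
  have hs : (∑ k ∈ Finset.range q, T.filter fun x => x.1 = e k : ExpPoly) (b, d) =
      ∑ k ∈ Finset.range q, if b = e k then T (b, d) else 0 := by
    rw [Finsupp.finsetSum_apply]
    exact Finset.sum_congr rfl fun k _ => by rw [Finsupp.filter_apply]
  rw [Finsupp.sub_apply, Finsupp.add_apply, hs]
  by_cases hbl : b = l
  · have h1 : T (b, d) - Z (b, d) = 0 := by
      by_contra h'
      exact hl (hbl ▸ mem_expIn.1 hT b d h')
    rw [Finset.sum_eq_zero, add_zero, h1]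
    intro k _
    rw [if_neg]
    intro hk
    exact hl (hbl ▸ hr ▸ ⟨k, hk.symm⟩)
  · have h1 : Z (b, d) = 0 := by
      by_contra h'
      exact hbl (mem_expIn.1 hZ b d h')
    rw [h1, zero_add]
    by_cases hTb : T (b, d) = 0
    · simp [hTb]
    · obtain ⟨j, hj⟩ : b ∈ Set.range e := by
        rw [hr]
        refine mem_expIn.1 hT b d ?_
        rwa [Finsupp.sub_apply, h1, sub_zero]
      rw [Finset.sum_eq_single j, if_pos hj.symm, sub_self]
      · intro k _ hk
        rw [if_neg]
        intro h'
        exact hk (he.injective (h'.symm.trans hj.symm))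
      · intro hjq
        exact absurd ((hq j).2 (hj ▸ hb)) (by simpa using hjq)

open ExpPoly

/-! ### The expansions -/

lemma dτ_shift (c : ℝ) (Z : ExpPoly) : dτ (shift c Z) = shift c (dτ Z) - c • shift c Z := by
  induction Z using induction_mono with
  | h0 => simp
  | hadd Y Z hY hZ => simp only [map_add, smul_add, hY, hZ]; abel
  | hmono r b d =>
    simp only [map_smul, shift_mono, dτ_mono, map_add, LinearMap.map_smul_of_tower]
    rw [smul_comm c r, ← smul_sub]
    congr 1
    module

/-- This moves the change of data G from the series to the Fourier coefficients, where it acts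
through its symbol. -/
lemma residual_sum_smul (z : (Fin 3 → ℤ) → ℝ → ℂ) (G : Matrix DataIndex DataIndex Op)
    (Z : DataIndex → ExpPoly) (w : DataIndex → (Fin 3 → ℤ) → ℂ) (k : Fin 3 → ℤ) (τ : ℝ) :
    residual z (fun κ => ∑ κ', G κ' κ • Z κ') w k τ =
      residual z Z (fun κ' k => ∑ κ, symbol k (G κ' κ) * w κ k) k τ := by
  simp only [residual, map_sum, modeEv_op_smul, Finset.sum_mul, Finset.mul_sum]
  rw [Finset.sum_comm]
  congr 1
  exact Finset.sum_congr rfl fun κ' _ => Finset.sum_congr rfl fun κ _ => by ring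

lemma tauComp_eq (p : Fin 3 → ℝ) (ω : (Fin 4 → ℝ) → Fin 4 → ℝ) (μ : Fin 4) (τ : ℝ)
    (x : Fin 3 → ℝ) :
    tauComp ω μ τ x = Real.exp ((1 - wt p μ) * τ) * hatFam p ω μ (τ, x) := by
  rw [hatFam, hatComp, ← mul_assoc, ← Real.exp_add, ← add_mul, add_neg_cancel, zero_mul,
    Real.exp_zero, one_mul]

lemma IsWaveSolution.withDeriv_tauComp {p : Fin 3 → ℝ} {ω : (Fin 4 → ℝ) → Fin 4 → ℝ}
    (hω : IsWaveSolution p ω) (μ : Fin 4) (τ : ℝ) (x : Fin 3 → ℝ) :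
    withDeriv (tauComp ω μ) τ x = ![Real.exp ((1 - wt p μ) * τ) * hatFam p ω μ (τ, x),
      Real.exp ((1 - wt p μ) * τ) *
        ((1 - wt p μ) * hatFam p ω μ (τ, x) + dt (hatFam p ω μ) (τ, x))] := by
  have h1 : HasDerivAt (fun r => Real.exp ((1 - wt p μ) * r))
      (Real.exp ((1 - wt p μ) * τ) * (1 - wt p μ)) τ := by
    simpa using ((hasDerivAt_id τ).const_mul (1 - wt p μ)).exp
  have h2 := h1.mul ((hω.smoothFamily μ).hasDerivAt τ x)
  rw [withDeriv, tauComp_eq p]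
  congr 1
  have h3 : (fun r => tauComp ω μ r x) =
      (fun r => Real.exp ((1 - wt p μ) * r)) * fun r => hatFam p ω μ (r, x) :=
    funext fun r => tauComp_eq p ω μ r x
  rw [h3, h2.deriv]
  congr 1
  ring

lemma IsWaveSolution.smoothTorus_withDeriv {p : Fin 3 → ℝ} {ω : (Fin 4 → ℝ) → Fin 4 → ℝ}
    (hω : IsWaveSolution p ω) (μ : Fin 4) (τ : ℝ) (c : Fin 2) :
    SmoothTorus fun x => withDeriv (tauComp ω μ) τ x c := by
  have h1 := (hω.smoothFamily μ).slice τ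
  simp only [hω.withDeriv_tauComp]
  fin_cases c
  · exact h1.const_mul _
  · exact ((h1.const_mul _).add ((hω.smoothFamily μ).dt.slice τ)).const_mul _

/-- The residual of a solution and its derivative in the original components. -/
lemma IsWaveSolution.rapidO_residual_tau {p : Fin 3 → ℝ} {ω : (Fin 4 → ℝ) → Fin 4 → ℝ}
    (hω : IsWaveSolution p ω) {G : Matrix DataIndex DataIndex Op}
    {w : DataIndex → (Fin 3 → ℤ) → ℂ} {n : ℕ} {β : ℝ}
    (hres : ResDecay p (fun μ k τ => torusCoeff (fun x => hatFam p ω μ (τ, x)) k)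
      (fun μ k τ => torusCoeff (fun x => dt (hatFam p ω μ) (τ, x)) k)
      (fun κ' k => ∑ κ, symbol k (G κ' κ) * w κ k) n β) (μ : Fin 4) (c : Fin 2) :
    RapidO (residual (fun k τ => torusCoeff (fun x => withDeriv (tauComp ω μ) τ x c) k)
      (withD (tauSeries p G n μ) c) w) (decay (β - (1 - wt p μ))) := by
  have hexp : ∀ {g : (Fin 3 → ℤ) → ℝ → ℂ}, RapidO g (decay β) →
      RapidO (fun k τ => (Real.exp ((1 - wt p μ) * τ) : ℂ) * g k τ)
        (decay (β - (1 - wt p μ))) := fun hg => by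
    refine hg.mul (r := 0) (K := 1) (ψ := decay (-(1 - wt p μ))) (fun k τ _ => ?_) zero_le_one
      (fun τ _ => (decay_pos _ τ).le) fun τ _ => ?_
    · rw [Complex.norm_real, Real.norm_eq_abs, Real.abs_exp, decay, neg_neg]
      simp
    · rw [decay_mul]; congr 1; ring
  obtain ⟨h1, h2⟩ := hres μ
  have hs := (hω.smoothFamily μ).slice
  have hs' := (hω.smoothFamily μ).dt.slice
  have key : ∀ k τ, residual (fun k τ => torusCoeff (fun x => hatFam p ω μ (τ, x)) k)
      (fun κ => ∑ κ', G κ' κ • series p n κ' μ) w k τ = _ := fun k τ =>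
    residual_sum_smul _ G (fun κ => series p n κ μ) w k τ
  have key' : ∀ k τ, residual (fun k τ => torusCoeff (fun x => dt (hatFam p ω μ) (τ, x)) k)
      (fun κ => ∑ κ', G κ' κ • dτ (series p n κ' μ)) w k τ = _ := fun k τ =>
    residual_sum_smul _ G (fun κ => dτ (series p n κ μ)) w k τ
  simp only [hω.withDeriv_tauComp]
  fin_cases c
  · refine (hexp h1).congr fun k τ _ => ?_
    rw [← key]
    simp only [Fin.zero_eta, Matrix.cons_val_zero, residual, withD, tauSeries, comb,
      modeEv_shift, torusCoeff_const_mul, neg_neg, mul_sub, Finset.mul_sum, mul_assoc]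
  · refine (hexp ((h1.const_mul ((1 - wt p μ : ℝ) : ℂ)).add h2)).congr fun k τ _ => ?_
    rw [← key, ← key']
    have e : ∀ κ, modeEv k τ (dτ (shift (-(1 - wt p μ)) (∑ κ', G κ' κ • series p n κ' μ))) =
        (Real.exp ((1 - wt p μ) * τ) : ℂ) * modeEv k τ (∑ κ', G κ' κ • dτ (series p n κ' μ)) +
        (Real.exp ((1 - wt p μ) * τ) : ℂ) * (((1 - wt p μ : ℝ) : ℂ) *
          modeEv k τ (∑ κ', G κ' κ • series p n κ' μ)) := fun κ => by
      rw [dτ_shift, map_sub, modeEv_real_smul, modeEv_shift, modeEv_shift, neg_neg]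
      simp only [map_sum (dτ : ExpPoly →ₗ[Op] ExpPoly), map_smul (dτ : ExpPoly →ₗ[Op] ExpPoly)]
      push_cast; ring
    simp only [Fin.mk_one, Matrix.cons_val_one, Matrix.cons_val_zero, residual, withD, tauSeries,
      comb, e]
    rw [torusCoeff_const_mul, torusCoeff_add ((hs τ).const_mul _).continuous (hs' τ).continuous,
      torusCoeff_const_mul]
    simp only [add_mul, Finset.sum_add_distrib, mul_add, mul_sub, Finset.mul_sum, mul_assoc]
    ring

/-- The theorem numbers the rates from 1 and the enumeration starts at 0, hence the shift in k. -/
lemma correction_eq {e : ℕ → ℝ} {q : ℕ}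
    {L : ℕ → Fin 2 → DataIndex → Polynomial (MvPolynomial (Fin 3) ℝ)} {T : DataIndex → ExpPoly}
    {c : Fin 2} (hL : ∀ k < q, ∀ κ, L (k + 1) c κ = polyAt (T κ) (e k))
    (w : DataIndex → (Fin 3 → ℝ) → ℝ) (τ : ℝ) (x : Fin 3 → ℝ) :
    correction q (fun k => e (k - 1)) L w τ x c =
      dataEv w x τ fun κ => ∑ k ∈ Finset.range q, (T κ).filter fun y => y.1 = e k := by
  have h1 : Finset.Icc 1 q = (Finset.range q).image Nat.succ := by
    ext k
    simp only [Finset.mem_Icc, Finset.mem_image, Finset.mem_range]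
    constructor
    · rintro ⟨h1, h2⟩; exact ⟨k - 1, by omega, by omega⟩
    · rintro ⟨j, hj, rfl⟩; omega
  rw [correction, h1, Finset.sum_image fun _ _ _ _ h => Nat.succ_injective h]
  simp only [dataEv, map_sum, ev_filter, Finset.sum_apply, Pi.smul_apply, smul_eq_mul]
  rw [Finset.sum_comm]
  refine Finset.sum_congr rfl fun k hk => ?_
  rw [opPoly, Finset.mul_sum]
  refine Finset.sum_congr rfl fun κ _ => ?_
  rw [Nat.succ_eq_add_one, hL k (Finset.mem_range.1 hk) κ, Nat.add_sub_cancel]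
  rfl

/-- The order N is chosen before the solution, and any larger N' works too, so that one order can
serve all four components. The condition 1 ≤ n is needed because the leading terms are complete only
from the second iterate on and the series of order n + 1 is used. -/
lemma exists_expansion {p : Fin 3 → ℝ} (hp : IsKasner p) (G : Matrix DataIndex DataIndex Op)
    (μ : Fin 4) {e : ℕ → ℝ} (he : StrictMono e) (hr : Set.range e = rateSet p μ) {n q : ℕ}
    (hq : ∀ k, k < q ↔ e k < n * (1 - p 2) - (1 - wt p μ)) :
    ∃ N : ℕ, 1 ≤ n → ∀ N' ≥ N, ∀ ω, IsWaveSolution p ω →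
      ∀ w : DataIndex → (Fin 3 → ℝ) → ℝ, (∀ κ, SmoothTorus (w κ)) →
      (∀ (n : ℕ) (β : ℝ), β < n * (1 - p 2) →
        ResDecay p (fun μ k τ => torusCoeff (fun x => hatFam p ω μ (τ, x)) k)
          (fun μ k τ => torusCoeff (fun x => dt (hatFam p ω μ) (τ, x)) k)
          (fun κ' k => ∑ κ, symbol k (G κ' κ) * torusCoeff (w κ) k) n β) →
      SobolevO (fun τ x => withDeriv (tauComp ω μ) τ x
          - (fun c => dataEv w x τ (withD (tauLead p G μ) c))
          - correction q (fun k => e (k - 1)) (fun k c κ => rateCoef p G μ (e (k - 1)) c κ) w τ x)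
        (fun τ => bracket τ ^ N' * Real.exp ((1 - wt p μ - n * (1 - p 2)) * τ)) := by
  by_cases hn : 1 ≤ n
  swap
  · exact ⟨0, fun h => absurd h hn⟩
  have hg := hp.gap_pos
  let Z : Fin 2 → DataIndex → ExpPoly := fun c κ => withD (tauLead p G μ) c κ +
    ∑ k ∈ Finset.range q, (withD (tauSeries p G (n + 1) μ) c κ).filter fun y => y.1 = e k
  have hmem : ∀ c κ, withD (tauSeries p G (n + 1) μ) c κ - Z c κ ∈
      expIn (Set.Ici (n * (1 - p 2) - (1 - wt p μ))) := by
    intro c κ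
    refine sub_truncation_mem (withD_sub_mem (fun κ => ?_) c κ)
      (withD_mem (tauLead_mem p G μ) c κ) (fun h => lt_irrefl _ h.2) he hr hq
    obtain ⟨m, rfl⟩ : ∃ m, n = m + 1 := ⟨n - 1, by omega⟩
    exact tauSeries_sub_tauLead_mem hp G m μ κ
  choose N hN using fun c => exists_rapidO_residual (hmem c)
  refine ⟨∑ c, N c, fun _ N' hN' ω hω w hw hres => sobolevO_of_rapidO fun c => ?_⟩
  have h1 := hN c _ (fun κ => torusCoeff (w κ)) (fun κ => rapid_torusCoeff (hw κ))
    (hω.rapidO_residual_tau (hres (n + 1) (n * (1 - p 2)) (by push_cast; linarith)) μ c)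
  have hle : N c ≤ N' :=
    (Finset.single_le_sum (f := N) (fun _ _ => Nat.zero_le _) (Finset.mem_univ c)).trans hN'
  have h2 := h1.bracket hle
    (h := fun τ => Real.exp ((1 - wt p μ - n * (1 - p 2)) * τ)) fun τ => by
      rw [decay]; congr 1; ring
  refine h2.congr fun k τ _ => ?_
  have h3 := torusCoeff_sub_dataEv hw (g := fun τ x => withDeriv (tauComp ω μ) τ x c)
    (fun τ => hω.smoothTorus_withDeriv μ τ c) (Z c) k τ
  rw [← h3]
  congr 1
  funext x
  have h4 : ∀ k < q, ∀ κ, rateCoef p G μ (e (k + 1 - 1)) c κ =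
      polyAt (withD (tauSeries p G (n + 1) μ) c κ) (e k) := fun k hk κ => by
    rw [Nat.add_sub_cancel]
    refine rateCoef_eq hp G μ ?_ c κ
    have := (hq k).1 hk
    push_cast; linarith
  have h5 := correction_eq (L := fun k c κ => rateCoef p G μ (e (k - 1)) c κ) h4 w τ x
  simp only [Pi.sub_apply]
  rw [h5, sub_sub, ← dataEv_add]

/-! ### The leading terms -/

lemma dataEv_single (w : DataIndex → (Fin 3 → ℝ) → ℝ) (x : Fin 3 → ℝ) (τ : ℝ) (κ₀ : DataIndex)
    (r : Op) (b : ℝ) (d : ℕ) :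
    dataEv w x τ (fun κ => (if κ₀ = κ then r else 0) • mono b d) =
      Real.exp (-b * τ) * τ ^ d * diffOp r (w κ₀) x := by
  simp only [dataEv, ev_opAt_smul_mono]
  rw [Fintype.sum_eq_single κ₀ fun κ hκ => by rw [if_neg hκ.symm, diffOp_zero, mul_zero],
    if_pos rfl]

/-- If the row of G is that of the identity, the datum is not mixed with others and the leading term
keeps its form. -/
lemma sum_smul_single {G : Matrix DataIndex DataIndex Op} {κ₀ : DataIndex}
    (hG : ∀ κ, G κ₀ κ = if κ₀ = κ then 1 else 0) (r : Op) (b : ℝ) (d : ℕ) (κ : DataIndex) :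
    ∑ κ', G κ' κ • (if κ' = κ₀ then r else 0) • mono b d = (if κ₀ = κ then r else 0) • mono b d := by
  rw [Fintype.sum_eq_single κ₀ fun κ' hκ' => by rw [if_neg hκ', zero_smul, smul_zero], if_pos rfl,
    hG, smul_smul, ite_mul, one_mul, zero_mul]

section

variable (p : Fin 3 → ℝ) {G : Matrix DataIndex DataIndex Op}
  (w : DataIndex → (Fin 3 → ℝ) → ℝ) (τ : ℝ) (x : Fin 3 → ℝ)

lemma dataEv_tauLead_zero (hG : ∀ κ, G (0, true) κ = if (0, true) = κ then 1 else 0) :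
    (fun c => dataEv w x τ (withD (tauLead p G 0) c)) = w (0, true) x • ![1, 0] := by
  have h1 : tauLead p G 0 = fun κ => (if (0, true) = κ then (1 : Op) else 0) • mono 0 0 := by
    funext κ
    simp only [tauLead, comb, hatLead_zero]
    rw [sum_smul_single hG, map_smul, shift_mono]
    simp [wt]
  have h2 : (fun κ => dτ (tauLead p G 0 κ)) = fun κ => 0 := by
    funext κ
    rw [h1, map_smul, dτ_mono]
    simp
  funext c
  fin_cases c
  · change dataEv w x τ (tauLead p G 0) = _
    rw [h1, dataEv_single, diffOp_one]
    simp
  · change dataEv w x τ (fun κ => dτ (tauLead p G 0 κ)) = _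
    rw [h2]
    simp [dataEv]

lemma dataEv_tauLead_one
    (hG : ∀ κ, G (leadIndex 0) κ = if leadIndex 0 = κ then 1 else 0) :
    (fun c => dataEv w x τ (withD (tauLead p G (Fin.succ 0)) c)) =
      (w (leadIndex 0) x * Real.exp (-2 * p 0 * τ)) • ![1, -2 * p 0] := by
  have h1 : tauLead p G (Fin.succ 0) =
      fun κ => (if leadIndex 0 = κ then (1 : Op) else 0) • mono (2 * p 0) 0 := by
    funext κ
    simp only [tauLead, comb, hatLead_one]
    rw [sum_smul_single hG, map_smul, shift_mono]
    congr 2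
    simp only [wt, Fin.cons_succ]
    ring
  have h2 : (fun κ => dτ (tauLead p G (Fin.succ 0) κ)) =
      fun κ => (if leadIndex 0 = κ then (-(2 * p 0)) • (1 : Op) else 0) • mono (2 * p 0) 0 := by
    funext κ
    rw [h1, map_smul, dτ_mono]
    split_ifs <;> simp
  funext c
  fin_cases c
  · change dataEv w x τ (tauLead p G (Fin.succ 0)) = _
    rw [h1, dataEv_single, diffOp_one]
    simp
    ring
  · change dataEv w x τ (fun κ => dτ (tauLead p G (Fin.succ 0) κ)) = _
    rw [h2, dataEv_single, diffOp_smul, diffOp_one]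
    simp
    ring

lemma dataEv_tauLead_succ {i : Fin 3} (hi : i ≠ 0)
    (hG : ∀ κ, G (leadIndex i) κ = if leadIndex i = κ then 1 else 0)
    (hG0 : ∀ κ, G (0, true) κ = if (0, true) = κ then 1 else 0)
    (hw : SmoothTorus (w (0, true))) :
    (fun c => dataEv w x τ (withD (tauLead p G i.succ) c)) =
      ![w (leadIndex i) x + pd i (w (0, true)) x * τ, pd i (w (0, true)) x] := by
  have h1 : tauLead p G i.succ =
      fun κ => (if leadIndex i = κ then (1 : Op) else 0) • mono 0 0 +
        (if (0, true) = κ then (MvPolynomial.X i : Op) else 0) • mono 0 1 := by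
    funext κ
    simp only [tauLead, comb, hatLead_succ p _ hi, smul_add, Finset.sum_add_distrib]
    rw [sum_smul_single hG, sum_smul_single hG0, map_add, map_smul, map_smul, shift_mono,
      shift_mono]
    simp [wt]
  have h2 : (fun κ => dτ (tauLead p G i.succ κ)) =
      fun κ => (if (0, true) = κ then (MvPolynomial.X i : Op) else 0) • mono 0 0 := by
    funext κ
    rw [h1, map_add, map_smul, map_smul, dτ_mono, dτ_mono]
    simp
  funext c
  fin_cases c
  · change dataEv w x τ (tauLead p G i.succ) = _
    rw [h1, dataEv_add, dataEv_single, dataEv_single, diffOp_one, diffOp_X i hw]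
    simp
    ring
  · change dataEv w x τ (fun κ => dτ (tauLead p G i.succ κ)) = _
    rw [h2, dataEv_single, diffOp_X i hw]
    simp

end

/-! ### The change of data -/

lemma sum_diffOp_mul (A B : Matrix DataIndex DataIndex Op) {f : DataIndex → (Fin 3 → ℝ) → ℝ}
    (hf : ∀ κ, SmoothTorus (f κ)) (κ₀ : DataIndex) (x : Fin 3 → ℝ) :
    ∑ κ, diffOp (B κ₀ κ) (fun y => ∑ κ', diffOp (A κ κ') (f κ') y) x =
      ∑ κ', diffOp ((B * A) κ₀ κ') (f κ') x := by
  have h1 : ∀ κ, diffOp (B κ₀ κ) (fun y => ∑ κ', diffOp (A κ κ') (f κ') y) x =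
      ∑ κ', diffOp (B κ₀ κ * A κ κ') (f κ') x := fun κ => by
    rw [diffOp_fun_sum _ _ fun κ' _ => (hf κ').diffOp _]
    exact Finset.sum_congr rfl fun κ' _ => by rw [diffOp_mul _ _ (hf κ')]
  simp only [h1, Matrix.mul_apply, diffOp_sum]
  exact Finset.sum_comm

lemma sum_diffOp_single (f : DataIndex → (Fin 3 → ℝ) → ℝ) (κ₀ : DataIndex) (x : Fin 3 → ℝ) :
    ∑ κ, diffOp (if κ₀ = κ then 1 else 0) (f κ) x = f κ₀ x := by
  rw [Fintype.sum_eq_single κ₀ fun κ hκ => by rw [if_neg hκ.symm, diffOp_zero], if_pos rfl,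
    diffOp_one]

/-- The matrix which expresses the modified asymptotic data by the data at infinity. -/
def modMatrix (p : Fin 3 → ℝ) : Matrix DataIndex DataIndex Op := fun κ κ' =>
  open Classical in
  if ∃ i, κ = leadIndex i then (if κ = κ' then 1 else 0) else dataMatrix p κ κ'

lemma modMatrix_lead (p : Fin 3 → ℝ) (i : Fin 3) (κ : DataIndex) :
    modMatrix p (leadIndex i) κ = if leadIndex i = κ then 1 else 0 := by
  rw [modMatrix, if_pos ⟨i, rfl⟩]

lemma isUnitri_modMatrix {p : Fin 3 → ℝ} (hp : IsKasner p) : IsUnitri p (modMatrix p) :=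
  fun κ κ' h => by
    rw [modMatrix]
    split_ifs with h1 h2 h2
    · rfl
    · rfl
    · rw [dataMatrix_eq hp h, if_pos h2]
    · rw [dataMatrix_eq hp h, if_neg h2]

lemma replaceData_lead (u : DataIndex → (Fin 3 → ℝ) → ℝ) (v : Fin 3 → (Fin 3 → ℝ) → ℝ)
    (i : Fin 3) : replaceData u v (leadIndex i) = v i := by
  fin_cases i <;> simp [replaceData, leadIndex]

lemma replaceData_of_ne (u : DataIndex → (Fin 3 → ℝ) → ℝ) (v : Fin 3 → (Fin 3 → ℝ) → ℝ)
    {κ : DataIndex} (h : ¬ ∃ i, κ = leadIndex i) : replaceData u v κ = u κ := by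
  push Not at h
  simp only [replaceData, h, if_false]

lemma replaceData_asympData (p : Fin 3 → ℝ) (f : DataIndex → (Fin 3 → ℝ) → ℝ) (κ : DataIndex) :
    replaceData (asympData p f) (fun i => f (leadIndex i)) κ =
      fun x => ∑ κ', diffOp (modMatrix p κ κ') (f κ') x := by
  funext x
  by_cases h : ∃ i, κ = leadIndex i
  · obtain ⟨i, rfl⟩ := h
    simp only [replaceData_lead, modMatrix_lead, sum_diffOp_single]
  · simp only [replaceData_of_ne _ _ h, modMatrix, if_neg h, asympData]

end Kasner

end

/-! ### The main theorem -/

open Kasner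

theorem mainTheorem5 (p : Fin 3 → ℝ) (hp : Monotone p) (hsum : ∑ i, p i = 1)
    (hsq : ∑ i, p i ^ 2 = 1) (hflat : p 2 < 1) :
    ∃ (q : Fin 4 → ℕ → ℕ) (a : Fin 4 → ℕ → ℝ) (N : ℕ → ℕ)
      (L : Fin 4 → ℕ → Fin 2 → Kasner.DataIndex → Polynomial (MvPolynomial (Fin 3) ℝ))
      (M : Fin 3 → Kasner.DataIndex → MvPolynomial (Fin 3) ℝ),
      (∀ μ, Monotone (q μ)) ∧ (∀ μ, q μ 1 = 0) ∧
      (∀ μ, StrictMonoOn (a μ) (Set.Ici 1)) ∧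
      (∀ μ k, 1 ≤ k → μ ≠ 1 → 0 < a μ k) ∧
      (∀ k, 1 ≤ k → 2 * p 0 < a 1 k) ∧
      a 0 1 = 2 * (1 - p 2) ∧
      a 1 1 = min (2 * p 0 + 2 * (1 - p 2)) 0 ∧
      a 2 1 = 2 * (1 - p 2) ∧
      a 3 1 = 2 * (1 - p 2) ∧
      (∀ i κ, Kasner.eig p κ ≤ Kasner.eig p (Kasner.leadIndex i) → M i κ = 0) ∧
      ∀ ω : (Fin 4 → ℝ) → Fin 4 → ℝ, Kasner.IsWaveSolution p ω →
        ∃ (u : Kasner.DataIndex → (Fin 3 → ℝ) → ℝ) (v : Fin 3 → (Fin 3 → ℝ) → ℝ),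
          Kasner.IsAsymptoticData p ω u ∧
          (∀ i, Kasner.SmoothTorus (v i)) ∧
          (∀ i x, v i x = u (Kasner.leadIndex i) x + ∑ κ, Kasner.diffOp (M i κ) (u κ) x) ∧
          ∀ n : ℕ, 1 ≤ n →
            Kasner.SobolevO
              (fun τ x => Kasner.withDeriv (Kasner.tauComp ω 0) τ x
                - u (0, true) x • ![1, 0]
                - Kasner.correction (q 0 n) (a 0) (L 0) (Kasner.replaceData u v) τ x)
              (fun τ => Kasner.bracket τ ^ N n * Real.exp (-(n : ℝ) * (1 - p 2) * τ)) ∧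
            Kasner.SobolevO
              (fun τ x => Kasner.withDeriv (Kasner.tauComp ω 1) τ x
                - (v 0 x * Real.exp (-2 * p 0 * τ)) • ![1, -2 * p 0]
                - Kasner.correction (q 1 n) (a 1) (L 1) (Kasner.replaceData u v) τ x)
              (fun τ => Kasner.bracket τ ^ N n *
                Real.exp ((1 - p 0 - (n : ℝ) * (1 - p 2)) * τ)) ∧
            ∀ i : Fin 3, i ≠ 0 →
              Kasner.SobolevO
                (fun τ x => Kasner.withDeriv (Kasner.tauComp ω i.succ) τ x
                  - ![v i x + Kasner.pd i (u (0, true)) x * τ, Kasner.pd i (u (0, true)) x]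
                  - Kasner.correction (q i.succ n) (a i.succ) (L i.succ)
                      (Kasner.replaceData u v) τ x)
                (fun τ => Kasner.bracket τ ^ N n *
                  Real.exp ((1 - p i - (n : ℝ) * (1 - p 2)) * τ)) := by
  classical
  have hp' : IsKasner p := ⟨hp, hsum, hsq, hflat⟩
  have hg := hp'.gap_pos
  -- V recovers the data at infinity from the asymptotic data and yields the operators M. G recovers
  -- them from the modified family and yields the coefficients L.
  obtain ⟨V, hV, hVA⟩ := IsUnitri.exists_inverse (A := dataMatrix p) fun κ κ' h => dataMatrix_eq hp' h
  obtain ⟨G, hG, hGF⟩ := (isUnitri_modMatrix hp').exists_inverse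
  have hFG : modMatrix p * G = 1 := mul_eq_one_comm.1 hGF
  -- The eigenvalue λ_{0,+} = 0 is the largest one, so triangularity determines the whole row.
  have hG0 : ∀ κ, G (0, true) κ = if (0, true) = κ then 1 else 0 := fun κ => by
    refine hG _ κ ((hp'.eig_nonpos κ).trans ?_)
    simp [eig, wt]
  -- The row of `modMatrix` is that of the identity, so the corresponding row of the product with G
  -- is the row of G itself.
  have hGl : ∀ i κ, G (leadIndex i) κ = if leadIndex i = κ then 1 else 0 := fun i κ => by
    have h1 := congrFun (congrFun hFG (leadIndex i)) κ
    rw [Matrix.mul_apply, Matrix.one_apply, Fintype.sum_eq_single (leadIndex i) fun κ' hκ' => by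
      rw [modMatrix_lead, if_neg hκ'.symm, zero_mul], modMatrix_lead, if_pos rfl, one_mul] at h1
    exact h1
  choose e he hr he0 using exists_rates hp'
  -- The error in ω_μ has rate n(1 - p_3) - (1 - e_μ), and q counts the correction rates strictly
  -- below it.
  choose q hq using fun μ (n : ℕ) =>
    exists_cutoff hp' (he μ) (hr μ) (n * (1 - p 2) - (1 - wt p μ))
  choose N hN using fun μ n => exists_expansion hp' G μ (he μ) (hr μ) (hq μ n)
  have hlead : ∀ μ k, leadRate p μ < e μ k := fun μ k => by
    have h1 : e μ k ∈ rateSet p μ := hr μ ▸ ⟨k, rfl⟩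
    exact h1.2
  -- At k = 0 the truncated subtraction repeats the first rate; only k ≥ 1 matters. Summing the
  -- orders over μ gives a common one, and the operators M are V minus the identity.
  refine ⟨q, fun μ k => e μ (k - 1), fun n => ∑ μ, N μ n,
    fun μ k c κ => rateCoef p G μ (e μ (k - 1)) c κ,
    fun i κ => V (leadIndex i) κ - if leadIndex i = κ then 1 else 0, fun μ m n hmn => ?_,
    fun μ => ?_, fun μ k hk l hl hkl => he μ ?_, fun μ k _ hμ => ?_, fun k _ => ?_, ?_, ?_, ?_, ?_,
    fun i κ h => ?_, fun ω hω => ?_⟩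
  · by_contra h
    rw [not_le] at h
    have h1 := (hq μ m (q μ n)).1 h
    have h2 : (m : ℝ) * (1 - p 2) ≤ n * (1 - p 2) := by gcongr
    exact lt_irrefl _ ((hq μ n (q μ n)).2 (by linarith))
  · by_contra h
    have h1 := (hq μ 1 0).1 (Nat.pos_of_ne_zero h)
    rw [he0, Nat.cast_one, one_mul] at h1
    exact absurd (sub_le_minRate hp' μ) (not_le.2 h1)
  · simp only [Set.mem_Ici] at hk hl
    omega
  · refine lt_of_le_of_lt (le_of_eq ?_) (hlead μ (k - 1))
    revert hμ
    refine Fin.cases (fun _ => (leadRate_zero p).symm) (fun i hi => (leadRate_succ p ?_).symm) μ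
    rintro rfl
    exact hi rfl
  · exact lt_of_le_of_lt (leadRate_one p).ge (hlead 1 (k - 1))
  · exact he0 0
  · exact he0 1
  · exact he0 2
  · exact he0 3
  · exact sub_eq_zero.2 (hV _ κ h)
  · obtain ⟨f, hf, hres⟩ := hω.exists_data hp'
    -- The functions u_i are the data at infinity with the leading indices; the other entries of w
    -- are the asymptotic data.
    set w := replaceData (asympData p f) fun i => f (leadIndex i) with hw
    have hweq : ∀ κ, w κ = fun x => ∑ κ', diffOp (modMatrix p κ κ') (f κ') x :=
      replaceData_asympData p f
    have hws : ∀ κ, SmoothTorus (w κ) := fun κ => by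
      rw [hweq]
      exact smoothTorus_sum _ fun κ' _ => (hf κ').diffOp _
    have hfw : ∀ κ', f κ' = fun x => ∑ κ, diffOp (G κ' κ) (w κ) x := fun κ' => by
      funext x
      simp only [hweq]
      rw [sum_diffOp_mul _ _ hf, hGF]
      simp only [Matrix.one_apply, sum_diffOp_single]
    have hcoef : ∀ κ', torusCoeff (f κ') =
        fun k => ∑ κ, symbol k (G κ' κ) * torusCoeff (w κ) k := fun κ' => by
      funext k
      rw [hfw κ', torusCoeff_sum _ fun κ _ => ((hws κ).diffOp _).continuous]
      exact Finset.sum_congr rfl fun κ _ => torusCoeff_diffOp (hws κ) _ k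
    have hres' := hres
    simp only [hcoef] at hres'
    have hw0 : w (0, true) = asympData p f (0, true) :=
      replaceData_of_ne _ _ (by rintro ⟨i, hi⟩; exact Fin.succ_ne_zero i (Prod.mk.inj hi).1.symm)
    have hwl : ∀ i, w (leadIndex i) = f (leadIndex i) := replaceData_lead _ _
    refine ⟨asympData p f, fun i => f (leadIndex i), isAsymptoticData_asympData hp' hω hf hres,
      fun i => hf _, fun i x => ?_, fun n hn => ?_⟩
    · have h1 := sum_diffOp_mul (dataMatrix p) V hf (leadIndex i) x
      simp only [hVA, Matrix.one_apply, sum_diffOp_single] at h1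
      have h2 : ∀ κ, diffOp (V (leadIndex i) κ - if leadIndex i = κ then 1 else 0)
          (asympData p f κ) x = diffOp (V (leadIndex i) κ) (asympData p f κ) x -
            diffOp (if leadIndex i = κ then 1 else 0) (asympData p f κ) x := fun κ =>
        (opAt (asympData p f κ) x).map_sub _ _
      simp only [h2, Finset.sum_sub_distrib, sum_diffOp_single]
      rw [← h1]
      unfold asympData
      ring
    · have hmain := fun μ => hN μ n hn (∑ μ, N μ n)
        (Finset.single_le_sum (f := fun μ => N μ n) (fun _ _ => Nat.zero_le _) (Finset.mem_univ μ))
        ω hω w hws hres'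
      refine ⟨?_, ?_, fun i hi => ?_⟩
      · have h1 := hmain 0
        simp only [dataEv_tauLead_zero p w _ _ hG0, hw0] at h1
        convert h1 using 3
        simp [wt]
      · have h1 := hmain (Fin.succ 0)
        simp only [dataEv_tauLead_one p w _ _ (hGl 0), hwl] at h1
        exact h1
      · have h1 := hmain i.succ
        simp only [dataEv_tauLead_succ p w _ _ hi (hGl i) hG0 (hws _), hwl, hw0] at h1
        exact h1
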